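/- **Setting.** Let $G=(\mathcal S,\mathcal A,\mathcal B,H,\mathbb P,r)$ be a two-player zero-sum Markov game with measurable state space $\mathcal S$, finite action sets $\mathcal A,\mathcal B$, transition kernels $\mathbb P_h$ and rewards $r_h:\mathcal S\times\mathcal A\times\mathcal B\to[0,1]$, $h\in[H]$. It is linear with known feature map $\phi:\mathcal S\times\mathcal A\times\mathcal B\to\mathbb R^d$: for each $h$ there are signed measures $\mu_h=(\mu_h^{(1)},\dots,\mu_h^{(d)})$ on $\mathcal S$ and $\theta_h\in\mathbb R^d$ with $\mathbb P_h(\cdot\mid x,a,b)=\langle\phi(x,a,b),\mu_h(\cdot)\rangle$, $r_h=\langle\phi,\theta_h\rangle$, $\|\phi\|_2\le1$, $\|\mu_h(\mathcal S)\|_2,\|\theta_h\|_2\le\sqrt d$. Policies are Markov: $\pi_h:\mathcal S\to\Delta_{\mathcal A}$, $\nu_h:\mathcal S\to\Delta_{\mathcal B}$. Put $V_h^{\pi,\nu}(x)=\mathbb E_{\pi,\nu}[\sum_{h'\ge h}r_{h'}(x_{h'},a_{h'},b_{h'})\mid x_h=x]$, $V_h^{*,\nu}=\max_\pi V_h^{\pi,\nu}$,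 $V_h^{\pi,*}=\min_\nu V_h^{\pi,\nu}$. Let $(\pi^*,\nu^*)$ be a Nash equilibrium (mutual best responses at every state and step) and $V^*_h=V_h^{\pi^*,\nu^*}$ (with $V^*_{H+1}=0$). For $V:\mathcal S\to\mathbb R$ put $[\mathbb V_hV]=\max\{1,\ \mathbb P_hV^2-(\mathbb P_hV)^2\}$. For a positive semidefinite matrix $\Lambda$ write $\|u\|_\Lambda=\sqrt{u^\top\Lambda u}$, and $y_{[0,M]}=\max\{0,\min\{M,y\}\}$. **Data.** Four independent datasets $\mathcal D_{\rm ref},\mathcal D_0,\mathcal D_0',\mathcal D_1$, each of $K$ i.i.d. episodes generated in $G$ from some initial law by a behavior policy (a Markov policy that draws the pair $(a_h,b_h)$ jointly); $\kappa=\min_{h}\lambda_{\min}\big(\mathbb E[\phi(x_h,a_h,b_h)\phi(x_h,a_h,b_h)^\top]\big)>0$ under that law. Write $\phi_h^\tau=\phi(x_h^\tau,a_h^\tau,b_h^\tau)$, $r_h^\tau=r_h(x_h^\tau,a_h^\tau,b_h^\tau)$. When a dataset is split into $H$ folds, each fold has $\lfloor K/H\rfloor$ episodes (so $K/H$ if $H\mid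 K$). Let $0<\delta<1$, $0<\lambda<\kappa$, $\iota_0=\log\frac{4Hd}{\delta\kappa^2}$, $\iota=\log\frac{4HdK}{\delta\kappa^2}$. **SPMVI** (parameter $\beta$, dataset $\mathcal D$ split into folds $\mathcal D_1,\dots,\mathcal D_H$). Set $\underline V_{H+1}=\overline V_{H+1}=0$. For $h=H,\dots,1$: $\Lambda_h=\sum_{\tau\in\mathcal D_h}\phi_h^\tau(\phi_h^\tau)^\top+\lambda I$; $\underline w_h=\Lambda_h^{-1}\sum_{\tau\in\mathcal D_h}\phi_h^\tau(r_h^\tau+\underline V_{h+1}(x_{h+1}^\tau))$ and $\overline w_h$ likewise with $\overline V_{h+1}$; $\underline Q_h=(\phi^\top\underline w_h-\beta\|\phi\|_{\Lambda_h^{-1}})_{[0,H-h+1]}$, $\overline Q_h=(\phi^\top\overline w_h+\beta\|\phi\|_{\Lambda_h^{-1}})_{[0,H-h+1]}$; at every $x$ let $(\widehat\pi_h(\cdot|x),\nu'_h(\cdot|x))$ and $(\pi'_h(\cdot|x),\widehat\nu_h(\cdot|x))$ be any Nash equilibria of the matrix games $\underline Q_h(x,\cdot,\cdot)$ and $\overline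 Q_h(x,\cdot,\cdot)$ (chosen measurably in $x$), and let $\underline V_h(x),\overline V_h(x)$ be their payoffs. **SPMVI+** (parameters $\beta,\gamma,b_1$). Run SPMVI on $\mathcal D_{\rm ref}$, with parameter $\beta$ and the same $\lambda$, to get $\underline V^{\rm ref},\overline V^{\rm ref}$; split $\mathcal D_1$ into folds $\mathcal D_{1,h}$; set $\underline V_{H+1}=\overline V_{H+1}=0$. For $h=H,\dots,1$: with $\widetilde\beta_{h,i}=\arg\min_{\beta'\in\mathbb R^d}\sum_{\tau\in\mathcal D_0'}(\langle\phi_h^\tau,\beta'\rangle-\underline V^{\rm ref}_{h+1}(x_{h+1}^\tau)^i)^2+\lambda\|\beta'\|_2^2$ ($i=1,2$) put $\underline\sigma_h=\max\{1,\langle\phi,\widetilde\beta_{h,2}\rangle_{[0,H^2]}-(\langle\phi,\widetilde\beta_{h,1}\rangle_{[0,H]})^2\}$; $\widehat{\underline Z}_h=\sum_{\tau\in\mathcal D_0}\phi_h^\tau(\phi_h^\tau)^\top/\underline\sigma_h(x_h^\tau,a_h^\tau,b_h^\tau)+\lambda I$; $\underline w_{0,h}=\widehat{\underline Z}_h^{-1}\sum_{\tau\in\mathcal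 D_0}\phi_h^\tau\frac{r_h^\tau+\underline V^{\rm ref}_{h+1}(x_{h+1}^\tau)}{\underline\sigma_h(x_h^\tau,a_h^\tau,b_h^\tau)}$; $W_h=\sum_{\tau\in\mathcal D_{1,h}}\phi_h^\tau(\phi_h^\tau)^\top+\lambda I$; $\underline w_{1,h}=W_h^{-1}\sum_{\tau\in\mathcal D_{1,h}}\phi_h^\tau(\underline V_{h+1}-\underline V^{\rm ref}_{h+1})(x_{h+1}^\tau)$; $\underline b_{0,h}=\gamma\|\phi\|_{\widehat{\underline Z}_h^{-1}}+\frac{4\lambda H^3\sqrt d}{K\kappa}$; $\underline Q_h=\phi^\top\underline w_{0,h}-\underline b_{0,h}+\phi^\top\underline w_{1,h}-b_1$. Define $\overline Q_h=\phi^\top\overline w_{0,h}+\overline b_{0,h}+\phi^\top\overline w_{1,h}+b_1$ analogously from $\overline V^{\rm ref}_{h+1},\overline V_{h+1}$. Then solve the matrix games and set $\underline V_h,\overline V_h$ exactly as in SPMVI. The output is $(\widehat\pi,\widehat\nu)$. **Theorem.** There are universal constants $c_\beta,c_0,c_1,c_K,C_1,C_2>0$ and $p_\beta,p_0,p_1,p_K,q_1,q_2\in\mathbb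 N$ such that in every such setting with $$K>\max\Big\{512H\log\tfrac{4Hd}{\delta\kappa^2},\ c_K\,\iota_0^{p_K}\,\tfrac{dH^{13}}{\kappa^4}\Big\},$$ SPMVI+ run with $\beta=c_\beta\iota^{p_\beta}\sqrt dH$, $\gamma=c_0\iota^{p_0}\sqrt d$, $b_1=c_1\iota^{p_1}\frac{dH^3}{K\kappa}$ satisfies, with probability at least $1-\delta$ and simultaneously for all $x\in\mathcal S$, $$V_1^{*,\widehat\nu}(x)-V_1^{\widehat\pi,*}(x)\le C_1\iota^{q_1}\sqrt d\,\Big(\max_\nu\sum_{h=1}^H\mathbb E_{\pi^*,\nu}\big[\|\phi(x_h,a_h,b_h)\|_{Z_h^{*-1}}\big|x_1=x\big]+\max_\pi\sum_{h=1}^H\mathbb E_{\pi,\nu^*}\big[\|\phi(x_h,a_h,b_h)\|_{Z_h^{*-1}}\big|x_1=x\big]\Big)+C_2\iota^{q_2}\frac{dH^3}{K\kappa},$$ where $Z_h^*=\sum_{\tau\in\mathcal D_0}\phi_h^\tau(\phi_h^\tau)^\top/[\mathbb V_hV^*_{h+1}](x_h^\tau,a_h^\tau,b_h^\tau)+\lambda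 I_d$. -/

import Mathlib

open MeasureTheory ProbabilityTheory

noncomputable section

namespace ZeroSumMG

/-! Steps are numbered `0, …, H - 1`, and `Fin (H + 1)` numbers the value functions
`V_0, …, V_H` with `V_H = 0`. -/

/-- A Markov policy over a finite action set: a (measurable) map from states to the simplex
at each step. -/
structure Policy (H : ℕ) (S C : Type*) [MeasurableSpace S] [Fintype C] where
  prob : Fin H → S → C → ℝ
  mem_simplex : ∀ h x, prob h x ∈ stdSimplex ℝ C
  measurable_prob : ∀ h c, Measurable fun x => prob h x c

namespace Policy

variable {H : ℕ} {S A B C : Type*} [MeasurableSpace S] [Fintype A] [Fintype B] [Fintype C]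

/-- The law of the action as a kernel. -/
def kernel [MeasurableSpace C] (σ : Policy H S C) (h : Fin H) : Kernel S C where
  toFun x := ∑ c, ENNReal.ofReal (σ.prob h x c) • Measure.dirac c
  measurable' := by
    refine Measure.measurable_of_measurable_coe _ fun s hs => ?_
    simp only [Measure.coe_finsetSum, Measure.coe_smul, Finset.sum_apply, Pi.smul_apply,
      smul_eq_mul]
    exact Finset.measurable_sum _ fun c _ =>
      ((σ.measurable_prob h c).ennreal_ofReal).mul_const _

/-- The two players draw their actions independently given the state. -/
def prod (π : Policy H S A) (ν : Policy H S B) : Policy H S (A × B) where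
  prob h x c := π.prob h x c.1 * ν.prob h x c.2
  mem_simplex h x := by
    refine ⟨fun c => mul_nonneg ((π.mem_simplex h x).1 _) ((ν.mem_simplex h x).1 _), ?_⟩
    rw [Fintype.sum_prod_type]
    simp only [← Finset.mul_sum, (ν.mem_simplex h x).2, mul_one, (π.mem_simplex h x).2]
  measurable_prob h c := (π.measurable_prob h c.1).mul (ν.measurable_prob h c.2)

end Policy

/-- A transition `((x_h, a_h, b_h), x_{h+1})`. -/
abbrev Transition (S A B : Type*) := (S × A × B) × S

/-- An episode: its `H` successive transitions. -/
abbrev Episode (H : ℕ) (S A B : Type*) := Fin H → Transition S A B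

/-- A two-player zero-sum Markov game with horizon `H`. -/
structure Game (H : ℕ) (S A B : Type*) [MeasurableSpace S] [MeasurableSpace A]
    [MeasurableSpace B] where
  trans : Fin H → Kernel (S × A × B) S
  markov : ∀ h, IsMarkovKernel (trans h)
  reward : Fin H → S × A × B → ℝ
  measurable_reward : ∀ h, Measurable (reward h)
  reward_mem : ∀ h z, reward h z ∈ Set.Icc (0 : ℝ) 1

namespace Game

variable {H : ℕ} {S A B : Type*} [MeasurableSpace S] [MeasurableSpace A] [MeasurableSpace B]
  [Fintype A] [Fintype B]

/-- From `x_h`, draw `(a_h, b_h)` and then `x_{h+1}`. -/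
def step (G : Game H S A B) (σ : Policy H S (A × B)) (h : Fin H) :
    Kernel S (Transition S A B) :=
  (Kernel.id ×ₖ σ.kernel h) ⊗ₖ (G.trans h).prodMkLeft S

/-- The law of the `n` transitions from step `h` to the end of the episode, given `x_h`, when
actions are drawn from the (possibly correlated) joint policy `σ`. -/
def rollout (G : Game H S A B) (σ : Policy H S (A × B)) :
    (n h : ℕ) → h + n = H → Kernel S (Fin n → Transition S A B)
  | 0, _, _ => Kernel.const S (Measure.dirac fun i => i.elim0)
  | n + 1, h, e =>
    (G.step σ ⟨h, by omega⟩ ⊗ₖ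
      (G.rollout σ n (h + 1) (by omega)).comap
        (fun p : S × Transition S A B => p.2.2) (by fun_prop)).map
      fun p => (Fin.cons p.1 p.2 : Fin (n + 1) → Transition S A B)

/-- `E_σ [∑_{h' ≥ h} f_{h'}(x_{h'}, a_{h'}, b_{h'}) | x_h = x]`. -/
def expect (G : Game H S A B) (σ : Policy H S (A × B)) (f : Fin H → S × A × B → ℝ)
    (h : Fin (H + 1)) (x : S) : ℝ :=
  ∫ ep, ∑ i : Fin (H - h), f ⟨h + i, by omega⟩ (ep i).1
    ∂(G.rollout σ (H - h) h (by omega) x)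

/-- The value function `V_h^{π,ν}(x)`. -/
def value (G : Game H S A B) (π : Policy H S A) (ν : Policy H S B) (h : Fin (H + 1)) (x : S) :
    ℝ :=
  G.expect (π.prod ν) G.reward h x

/-- `V_h^{*,ν}(x)`: the max-player best-responds to `ν`. -/
def valueBestMax (G : Game H S A B) (ν : Policy H S B) (h : Fin (H + 1)) (x : S) : ℝ :=
  ⨆ π : Policy H S A, G.value π ν h x

/-- `V_h^{π,*}(x)`: the min-player best-responds to `π`. -/
def valueBestMin (G : Game H S A B) (π : Policy H S A) (h : Fin (H + 1)) (x : S) : ℝ :=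
  ⨅ ν : Policy H S B, G.value π ν h x

/-- Nash equilibrium: each policy is a best response to the other at every state and step. -/
def IsNash (G : Game H S A B) (π : Policy H S A) (ν : Policy H S B) : Prop :=
  ∀ (h : Fin H) (x : S),
    (∀ π' : Policy H S A, G.value π' ν h.castSucc x ≤ G.value π ν h.castSucc x) ∧
    (∀ ν' : Policy H S B, G.value π ν h.castSucc x ≤ G.value π ν' h.castSucc x)

/-- `(Var_h V)(x, a, b)`. -/
def condVar (G : Game H S A B) (h : Fin H) (V : S → ℝ) (z : S × A × B) : ℝ :=
  (∫ x', V x' ^ 2 ∂(G.trans h z)) - (∫ x', V x' ∂(G.trans h z)) ^ 2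

/-- `(𝕍_h V)(x, a, b) = max {1, (Var_h V)(x, a, b)}`. -/
def truncVar (G : Game H S A B) (h : Fin H) (V : S → ℝ) (z : S × A × B) : ℝ :=
  max 1 (G.condVar h V z)

/-- Linear Markov game with feature map `φ`. -/
def IsLinear (G : Game H S A B) {d : ℕ} (φ : S × A × B → Fin d → ℝ) : Prop :=
  Measurable φ ∧ (∀ z, ‖WithLp.toLp 2 (φ z)‖ ≤ 1) ∧
  ∀ h : Fin H, ∃ (μ : Fin d → SignedMeasure S) (θ : Fin d → ℝ),
    (∀ z E, MeasurableSet E → (G.trans h z).real E = ∑ i, φ z i * μ i E) ∧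
    (∀ z, G.reward h z = φ z ⬝ᵥ θ) ∧
    ‖WithLp.toLp 2 (fun i => μ i Set.univ)‖ ≤ √(d : ℝ) ∧
    ‖WithLp.toLp 2 θ‖ ≤ √(d : ℝ)

/-- The law of one episode with initial law `ρ` under the behavior policy `σ`. -/
def episodeLaw (G : Game H S A B) (ρ : Measure S) (σ : Policy H S (A × B)) :
    Measure (Episode H S A B) :=
  ρ.bind (G.rollout σ H 0 (Nat.zero_add H))

/-- `E_{d_h^b} [φ φᵀ]`. -/
def featureCov (G : Game H S A B) (ρ : Measure S) (σ : Policy H S (A × B)) {d : ℕ}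
    (φ : S × A × B → Fin d → ℝ) (h : Fin H) : Matrix (Fin d) (Fin d) ℝ :=
  Matrix.of fun i j => ∫ ep, φ (ep h).1 i * φ (ep h).1 j ∂(G.episodeLaw ρ σ)

/-- The coverage coefficient `κ = min_h λ_min (E_{d_h^b} [φ φᵀ])`. -/
def coverage (G : Game H S A B) (ρ : Measure S) (σ : Policy H S (A × B)) {d : ℕ}
    (φ : S × A × B → Fin d → ℝ) : ℝ :=
  ⨅ h : Fin H, sInf (spectrum ℝ (G.featureCov ρ σ φ h))

end Game

/-- `‖u‖_Λ = √(uᵀ Λ u)`. -/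
def wnorm {d : ℕ} (Λ : Matrix (Fin d) (Fin d) ℝ) (u : Fin d → ℝ) : ℝ :=
  √(u ⬝ᵥ Λ.mulVec u)

/-- The value `f` clipped to `[0, M]`. -/
def clip (M f : ℝ) : ℝ := max 0 (min M f)

/-- Expected payoff of a pair of mixed strategies in a matrix game. -/
def payoff {A B : Type*} [Fintype A] [Fintype B] (Q : A → B → ℝ) (p : A → ℝ) (q : B → ℝ) : ℝ :=
  ∑ a, ∑ b, p a * q b * Q a b

/-- `(p, q)` is a Nash equilibrium of the matrix game `Q` (rows maximize). -/
def IsMatrixNash {A B : Type*} [Fintype A] [Fintype B] (Q : A → B → ℝ) (p : A → ℝ) (q : B → ℝ) :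
    Prop :=
  p ∈ stdSimplex ℝ A ∧ q ∈ stdSimplex ℝ B ∧
  (∀ p' ∈ stdSimplex ℝ A, payoff Q p' q ≤ payoff Q p q) ∧
  (∀ q' ∈ stdSimplex ℝ B, payoff Q p q ≤ payoff Q p q')

section Algorithm

variable {H K d : ℕ} {S A B : Type*}

/-- The `h`-th of `H` disjoint blocks of `⌊K / H⌋` consecutive indices. -/
def fold (H K : ℕ) (h : Fin H) : Finset (Fin K) :=
  Finset.univ.filter fun τ => (h : ℕ) * (K / H) ≤ τ ∧ (τ : ℕ) < (h + 1) * (K / H)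

/-- `∑_{τ ∈ I} φ_h^τ (φ_h^τ)ᵀ / w(x_h^τ, a_h^τ, b_h^τ) + λ I_d`. -/
def gram (φ : S × A × B → Fin d → ℝ) (lam : ℝ) (D : Fin K → Episode H S A B)
    (I : Finset (Fin K)) (w : S × A × B → ℝ) (h : Fin H) : Matrix (Fin d) (Fin d) ℝ :=
  ∑ τ ∈ I, (w (D τ h).1)⁻¹ • Matrix.vecMulVec (φ (D τ h).1) (φ (D τ h).1) + lam • 1

/-- Weighted ridge regression at step `h` of the target `y` on the features. -/
def ridge (φ : S × A × B → Fin d → ℝ) (lam : ℝ) (D : Fin K → Episode H S A B)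
    (I : Finset (Fin K)) (w : S × A × B → ℝ) (y : Transition S A B → ℝ) (h : Fin H) :
    Fin d → ℝ :=
  (gram φ lam D I w h)⁻¹.mulVec (∑ τ ∈ I, (y (D τ h) / w (D τ h).1) • φ (D τ h).1)

/-- The variance estimator `𝕍̄_h V` built from the dataset `D`. -/
def varEst (φ : S × A × B → Fin d → ℝ) (lam : ℝ) (D : Fin K → Episode H S A B)
    (V : S → ℝ) (h : Fin H) (z : S × A × B) : ℝ :=
  max 1
    (clip ((H : ℝ) ^ 2)
        (φ z ⬝ᵥ ridge φ lam D Finset.univ (fun _ => 1) (fun t => V t.2 ^ 2) h) -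
      clip (H : ℝ) (φ z ⬝ᵥ ridge φ lam D Finset.univ (fun _ => 1) (fun t => V t.2) h) ^ 2)

/-- The `Q`-estimate of SPMVI at step `h` from the next value estimate `V`; the sign `s` is `-1`
for the max-player (lower bound) and `+1` for the min-player (upper bound). -/
def spmviQ (r : Fin H → S × A × B → ℝ) (φ : S × A × B → Fin d → ℝ) (lam β : ℝ)
    (D : Fin K → Episode H S A B) (s : ℝ) (h : Fin H) (V : S → ℝ) (x : S) (a : A) (b : B) : ℝ :=
  clip ((H : ℝ) - h)
    (φ (x, a, b) ⬝ᵥ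
        ridge φ lam D (fold H K h) (fun _ => 1) (fun t => r h t.1 + V t.2) h +
      s * (β * wnorm (gram φ lam D (fold H K h) (fun _ => 1) h)⁻¹ (φ (x, a, b))))

/-- The bonus `b_{0,h}` of SPMVI+, with weight function `w`. -/
def bonus0 (φ : S × A × B → Fin d → ℝ) (lam κ γ : ℝ) (D₀ : Fin K → Episode H S A B)
    (w : S × A × B → ℝ) (h : Fin H) (z : S × A × B) : ℝ :=
  γ * wnorm (gram φ lam D₀ Finset.univ w h)⁻¹ (φ z) + 4 * lam * H ^ 3 * √(d : ℝ) / (K * κ)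

/-- The `Q`-estimate of SPMVI+ at step `h` from the reference `Vref` and the estimate `V` of the
next value function: reference part from `D₀` with weights from `D₀'`, advantage part from the
`h`-th fold of `D₁`. -/
def spmviPlusQ (r : Fin H → S × A × B → ℝ) (φ : S × A × B → Fin d → ℝ) (lam κ γ b₁ : ℝ)
    (D₀ D₀' D₁ : Fin K → Episode H S A B) (s : ℝ) (h : Fin H) (Vref V : S → ℝ)
    (x : S) (a : A) (b : B) : ℝ :=
  φ (x, a, b) ⬝ᵥ
      ridge φ lam D₀ Finset.univ (varEst φ lam D₀' Vref h) (fun t => r h t.1 + Vref t.2) h +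
    φ (x, a, b) ⬝ᵥ
      ridge φ lam D₁ (fold H K h) (fun _ => 1) (fun t => V t.2 - Vref t.2) h +
    s * (bonus0 φ lam κ γ D₀ (varEst φ lam D₀' Vref h) h (x, a, b) + b₁)

variable [MeasurableSpace S] [Fintype A] [Fintype B]

/-- One backward sweep: with `Qlo h V`, `Qup h V` the `Q`-estimates at step `h` built from the
next value estimate `V`, the matrix games are solved at every state, by any equilibria. The output
policies are `πhat` and `νhat`. -/
structure IsSweep (Qlo Qup : Fin H → (S → ℝ) → S → A → B → ℝ)
    (πhat : Policy H S A) (ν' : Policy H S B) (π' : Policy H S A) (νhat : Policy H S B)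
    (Vlo Vup : Fin (H + 1) → S → ℝ) : Prop where
  lo_last : Vlo (Fin.last H) = 0
  up_last : Vup (Fin.last H) = 0
  lo_nash : ∀ h x, IsMatrixNash (Qlo h (Vlo h.succ) x) (πhat.prob h x) (ν'.prob h x)
  up_nash : ∀ h x, IsMatrixNash (Qup h (Vup h.succ) x) (π'.prob h x) (νhat.prob h x)
  lo_value : ∀ h x,
    Vlo h.castSucc x = payoff (Qlo h (Vlo h.succ) x) (πhat.prob h x) (ν'.prob h x)
  up_value : ∀ h x,
    Vup h.castSucc x = payoff (Qup h (Vup h.succ) x) (π'.prob h x) (νhat.prob h x)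

/-- `(Vlo, Vup)` are the value estimates returned by a run of SPMVI on `D`. -/
def IsSpmviValues (r : Fin H → S × A × B → ℝ) (φ : S × A × B → Fin d → ℝ) (lam β : ℝ)
    (D : Fin K → Episode H S A B) (Vlo Vup : Fin (H + 1) → S → ℝ) : Prop :=
  ∃ (πhat : Policy H S A) (ν' : Policy H S B) (π' : Policy H S A) (νhat : Policy H S B),
    IsSweep (spmviQ r φ lam β D (-1)) (spmviQ r φ lam β D 1) πhat ν' π' νhat Vlo Vup

/-- `(πhat, νhat)` is the output of a run of SPMVI+ on the four datasets. -/
def IsSpmviPlusOutput (r : Fin H → S × A × B → ℝ) (φ : S × A × B → Fin d → ℝ)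
    (lam κ β γ b₁ : ℝ) (Dref D₀ D₀' D₁ : Fin K → Episode H S A B)
    (πhat : Policy H S A) (νhat : Policy H S B) : Prop :=
  ∃ Vloref Vupref : Fin (H + 1) → S → ℝ, IsSpmviValues r φ lam β Dref Vloref Vupref ∧
  ∃ (ν' : Policy H S B) (π' : Policy H S A) (Vlo Vup : Fin (H + 1) → S → ℝ),
    IsSweep
      (fun h V => spmviPlusQ r φ lam κ γ b₁ D₀ D₀' D₁ (-1) h (Vloref h.succ) V)
      (fun h V => spmviPlusQ r φ lam κ γ b₁ D₀ D₀' D₁ 1 h (Vupref h.succ) V)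
      πhat ν' π' νhat Vlo Vup

end Algorithm

/-- `∑_h E_{π,ν} [‖φ(x_h, a_h, b_h)‖_{Z_h^{-1}} | x_1 = x]`. -/
def uncertainty {H d : ℕ} {S A B : Type*} [MeasurableSpace S] [MeasurableSpace A]
    [MeasurableSpace B] [Fintype A] [Fintype B] (G : Game H S A B)
    (φ : S × A × B → Fin d → ℝ) (Z : Fin H → Matrix (Fin d) (Fin d) ℝ)
    (π : Policy H S A) (ν : Policy H S B) (x : S) : ℝ :=
  G.expect (π.prod ν) (fun h z => wnorm (Z h)⁻¹ (φ z)) 0 x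

/-- The matrices `Z_h^*`, for an equilibrium `(πs, νs)`. -/
def Zstar {H K d : ℕ} {S A B : Type*} [MeasurableSpace S] [MeasurableSpace A]
    [MeasurableSpace B] [Fintype A] [Fintype B] (G : Game H S A B)
    (φ : S × A × B → Fin d → ℝ) (lam : ℝ) (D₀ : Fin K → Episode H S A B)
    (πs : Policy H S A) (νs : Policy H S B) (h : Fin H) : Matrix (Fin d) (Fin d) ℝ :=
  gram φ lam D₀ Finset.univ (G.truncVar h (G.value πs νs h.succ)) h

end ZeroSumMG

end

open ZeroSumMG

open ZeroSumMG

set_option linter.unusedSectionVars false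

noncomputable section

namespace ZeroSumMG

/-! ### Inverse quadratic forms, whitening and the error of ridge regression -/

section LinearAlgebra

open Matrix

variable {d : ℕ}

/-! Pessimism reduces the duality gap to the accuracy of the `Q`-estimates. Suppose that every lower
estimate lies between the Bellman backup of the next lower value and that backup minus twice the
bonus. Then the lower value is below $V^{\hat\pi,*}$, because $\hat\pi$ is the max-player's half of
a matrix equilibrium. It is also above $V^*$ minus the sum of twice the bonuses expected under
$(\pi^*,\nu')$, because $\nu'$ is the other half and $\nu^*$ is a best response to $\pi^*$. The
upper value is symmetric. It remains to bound twice the bonus by $10\iota\sqrt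
d\,\|\phi\|_{Z_h^{*-1}}$.

Write $q=\sqrt{dH/(K\kappa)}$. A ridge regression of a function of range $c$ has error of order
$c\,\iota\sqrt d\,\|\phi\|_{\Lambda^{-1}}$, and the coverage bounds $\sqrt
d\,\|\phi\|_{\Lambda^{-1}}$ by $2q$ even on one fold. So the reference values are within $8\iota
H^2q$ of $V^*$. This is small enough for the estimated variances to be at most twice $[\mathbb
V_hV^*_{h+1}]$, so that weighting by them removes the factor $H$ from the bonus of the reference
part. The advantage part regresses a function of range of order $\iota H^2q$, so its error is of
order $\iota^2H^2q^2=\iota^2dH^3/(K\kappa)$, which is `b₁`. That term decays like $1/K$ and is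
absorbed as well: $1=\mathbb P_h(\mathcal S)\le\sqrt d\,\|\phi\|_2$ forces $\sqrt
d\,\|\phi\|_{Z_h^{*-1}}\ge1/\sqrt{2K}$.

The noise vector of a regression is controlled without a covering argument. Whitening by the
population Gram matrix turns its norm into $d$ scalar sums, each handled by Bernstein's inequality,
and the empirical Gram matrix dominates half of its mean. This needs the regressed function and the
weight to be independent of the episodes used, which the separate datasets and the folds provide:
$V_{h+1}$ depends only on the folds of steps after $h$. Overwriting the episodes of one fold by
fresh ones (`resample`) makes this precise. The estimated variance and the advantage satisfy the
hypotheses of Bernstein's inequality only on good events. They are therefore replaced by truncations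
(`refWeight`, `advantage`) which always satisfy them and which agree with the originals outside the
bad events.

The main steps are `noise_concentration`, `noiseBad_le`, `GoodRun.plusQ_error`,
`GoodRun.bonus_le_oracle` and `duality_gap_le`. -/

theorem exists_transpose_mul_self {M : Matrix (Fin d) (Fin d) ℝ} (hM : M.PosDef) :
    ∃ B : Matrix (Fin d) (Fin d) ℝ, IsUnit B.det ∧ M = Bᵀ * B := by
  open scoped MatrixOrder in
  obtain ⟨B, hB⟩ := CStarAlgebra.nonneg_iff_eq_star_mul_self.mp hM.posSemidef.nonneg
  have hB' : M = Bᵀ * B := by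
    rw [hB, star_eq_conjTranspose, conjTranspose_eq_transpose_of_trivial]
  refine ⟨B, ?_, hB'⟩
  have h := hM.det_pos
  rw [hB', det_mul, det_transpose] at h
  exact isUnit_iff_ne_zero.2 fun h0 => by simp [h0] at h

theorem inv_quad_eq {B : Matrix (Fin d) (Fin d) ℝ} (u s : Fin d → ℝ) :
    u ⬝ᵥ (Bᵀ * B)⁻¹ *ᵥ s = ((B⁻¹)ᵀ *ᵥ u) ⬝ᵥ ((B⁻¹)ᵀ *ᵥ s) := by
  rw [Matrix.mul_inv_rev, ← transpose_nonsing_inv, ← mulVec_mulVec, dotProduct_mulVec,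
    ← mulVec_transpose]

theorem quad_eq {B : Matrix (Fin d) (Fin d) ℝ} (u s : Fin d → ℝ) :
    u ⬝ᵥ (Bᵀ * B) *ᵥ s = (B *ᵥ u) ⬝ᵥ (B *ᵥ s) := by
  rw [← mulVec_mulVec, dotProduct_mulVec, vecMul_transpose]

theorem dotProduct_sq_le (u v : Fin d → ℝ) : (u ⬝ᵥ v) ^ 2 ≤ (u ⬝ᵥ u) * (v ⬝ᵥ v) := by
  have := Finset.sum_mul_sq_le_sq_mul_sq Finset.univ u v
  simpa [dotProduct, pow_two] using this

theorem dotProduct_self_nonneg' (u : Fin d → ℝ) : 0 ≤ u ⬝ᵥ u :=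
  Finset.sum_nonneg fun _ _ => mul_self_nonneg _

/-- Cauchy–Schwarz for the dual pair of norms: with $M=B^\top B$ one has $s\cdot
y=(B^{-\top}s)\cdot(By)$. -/
theorem PosDef.dotProduct_sq_le_inv {M : Matrix (Fin d) (Fin d) ℝ} (hM : M.PosDef)
    (s y : Fin d → ℝ) : (s ⬝ᵥ y) ^ 2 ≤ (s ⬝ᵥ M⁻¹ *ᵥ s) * (y ⬝ᵥ M *ᵥ y) := by
  obtain ⟨B, hB, rfl⟩ := exists_transpose_mul_self hM
  rw [inv_quad_eq, quad_eq]
  refine le_trans (le_of_eq ?_) (dotProduct_sq_le _ _)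
  congr 1
  rw [mulVec_transpose, ← dotProduct_mulVec, mulVec_mulVec, nonsing_inv_mul _ hB, one_mulVec]

theorem PosDef.inv_cauchySchwarz {M : Matrix (Fin d) (Fin d) ℝ} (hM : M.PosDef)
    (u s : Fin d → ℝ) :
    (u ⬝ᵥ M⁻¹ *ᵥ s) ^ 2 ≤ (u ⬝ᵥ M⁻¹ *ᵥ u) * (s ⬝ᵥ M⁻¹ *ᵥ s) := by
  obtain ⟨B, hB, rfl⟩ := exists_transpose_mul_self hM
  simp only [inv_quad_eq]
  exact dotProduct_sq_le _ _

theorem PosDef.inv_quad_nonneg {M : Matrix (Fin d) (Fin d) ℝ} (hM : M.PosDef)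
    (u : Fin d → ℝ) : 0 ≤ u ⬝ᵥ M⁻¹ *ᵥ u := by
  obtain ⟨B, hB, rfl⟩ := exists_transpose_mul_self hM
  rw [inv_quad_eq]
  exact dotProduct_self_nonneg' _

/-- Inversion reverses the order of quadratic forms. -/
theorem inv_quad_le_of_quad_le {M N : Matrix (Fin d) (Fin d) ℝ} (hM : M.PosDef) (hN : N.PosDef)
    {c : ℝ} (hc : 0 ≤ c) (h : ∀ v : Fin d → ℝ, v ⬝ᵥ M *ᵥ v ≤ c * (v ⬝ᵥ N *ᵥ v))
    (s : Fin d → ℝ) : s ⬝ᵥ N⁻¹ *ᵥ s ≤ c * (s ⬝ᵥ M⁻¹ *ᵥ s) := by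
  -- For this $y$, duality gives $(s\cdot y)^2\le(s^\top M^{-1}s)(y^\top My)\le c\,(s^\top
  -- M^{-1}s)(s\cdot y)$, and one factor $s\cdot y$ cancels.
  set y := N⁻¹ *ᵥ s with hy
  have hNy : N *ᵥ y = s := by
    rw [hy, mulVec_mulVec, mul_nonsing_inv _ ((isUnit_iff_isUnit_det _).1 hN.isUnit), one_mulVec]
  have hq : y ⬝ᵥ N *ᵥ y = s ⬝ᵥ y := by rw [hNy, dotProduct_comm]
  have h1 := PosDef.dotProduct_sq_le_inv hM s y
  have h2 := h y
  rw [hq] at h2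
  have h0 : 0 ≤ s ⬝ᵥ y := PosDef.inv_quad_nonneg hN s
  have hm := PosDef.inv_quad_nonneg hM s
  rcases h0.eq_or_lt with h0 | h0
  · rw [← h0]; positivity
  · have h3 : (s ⬝ᵥ y) * (s ⬝ᵥ y) ≤ (c * (s ⬝ᵥ M⁻¹ *ᵥ s)) * (s ⬝ᵥ y) := by nlinarith
    exact le_of_mul_le_mul_right h3 h0

theorem inv_quad_le_of_le_quad {N : Matrix (Fin d) (Fin d) ℝ} (hN : N.PosDef)
    {a : ℝ} (ha : 0 < a) (h : ∀ v : Fin d → ℝ, a * (v ⬝ᵥ v) ≤ v ⬝ᵥ N *ᵥ v) (s : Fin d → ℝ) :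
    s ⬝ᵥ N⁻¹ *ᵥ s ≤ (s ⬝ᵥ s) / a := by
  have := inv_quad_le_of_quad_le (M := 1) PosDef.one hN (c := a⁻¹) (by positivity)
    (fun v => by
      rw [one_mulVec, inv_mul_eq_div, le_div_iff₀ ha]; linarith [h v]) s
  rw [inv_one, one_mulVec] at this
  rwa [inv_mul_eq_div] at this

theorem le_inv_quad_of_quad_le {M : Matrix (Fin d) (Fin d) ℝ} (hM : M.PosDef)
    {b : ℝ} (hb : 0 < b) (h : ∀ v : Fin d → ℝ, v ⬝ᵥ M *ᵥ v ≤ b * (v ⬝ᵥ v)) (s : Fin d → ℝ) :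
    (s ⬝ᵥ s) / b ≤ s ⬝ᵥ M⁻¹ *ᵥ s := by
  have := inv_quad_le_of_quad_le (N := 1) hM PosDef.one hb.le (by simpa using h) s
  rw [inv_one, one_mulVec] at this
  rw [div_le_iff₀ hb]; linarith

/-- A basis that is orthonormal for a positive definite form. -/
theorem exists_whitening {M : Matrix (Fin d) (Fin d) ℝ} (hM : M.PosDef) :
    ∃ g : Fin d → Fin d → ℝ, (∀ j, g j ⬝ᵥ M *ᵥ g j = 1) ∧
      ∀ s : Fin d → ℝ, s ⬝ᵥ M⁻¹ *ᵥ s = ∑ j, (g j ⬝ᵥ s) ^ 2 := by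
  obtain ⟨B, hB, rfl⟩ := exists_transpose_mul_self hM
  -- The columns of $B^{-1}$, which $B$ maps to the standard basis.
  refine ⟨fun j => (B⁻¹)ᵀ j, fun j => ?_, fun s => ?_⟩
  · have : B *ᵥ ((B⁻¹)ᵀ j) = Pi.single j 1 := by
      ext i
      have := congrFun (congrFun (mul_nonsing_inv B hB) i) j
      rw [mul_apply] at this
      simpa [mulVec, dotProduct, one_apply, Pi.single_apply] using this
    rw [quad_eq, this]; simp
  · rw [inv_quad_eq]
    simp [dotProduct, mulVec, pow_two]

theorem wnorm_nonneg (Λ : Matrix (Fin d) (Fin d) ℝ) (u : Fin d → ℝ) : 0 ≤ wnorm Λ u :=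
  Real.sqrt_nonneg _

theorem abs_inv_quad_le_wnorm {M : Matrix (Fin d) (Fin d) ℝ} (hM : M.PosDef) (u s : Fin d → ℝ) :
    |u ⬝ᵥ M⁻¹ *ᵥ s| ≤ wnorm M⁻¹ u * wnorm M⁻¹ s := by
  rw [wnorm, wnorm, ← Real.sqrt_mul (PosDef.inv_quad_nonneg hM u)]
  exact Real.abs_le_sqrt (PosDef.inv_cauchySchwarz hM u s)

section Gram

variable {H K : ℕ} {S A B : Type*} (φ : S × A × B → Fin d → ℝ) (lam : ℝ)
  (D : Fin K → Episode H S A B) (I : Finset (Fin K)) (w : S × A × B → ℝ) (h : Fin H)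

theorem gram_mulVec (v : Fin d → ℝ) : gram φ lam D I w h *ᵥ v =
    ∑ τ ∈ I, ((φ (D τ h).1 ⬝ᵥ v) / w (D τ h).1) • φ (D τ h).1 + lam • v := by
  rw [gram, add_mulVec, sum_mulVec, smul_mulVec, one_mulVec]
  congr 1
  refine Finset.sum_congr rfl fun τ _ => ?_
  rw [smul_mulVec, vecMulVec_mulVec]
  ext i
  simp [div_eq_inv_mul]
  ring

theorem quad_gram (v : Fin d → ℝ) : v ⬝ᵥ gram φ lam D I w h *ᵥ v =
    ∑ τ ∈ I, (w (D τ h).1)⁻¹ * (φ (D τ h).1 ⬝ᵥ v) ^ 2 + lam * (v ⬝ᵥ v) := by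
  rw [gram_mulVec, dotProduct_add, dotProduct_sum, dotProduct_smul, smul_eq_mul]
  congr 1
  refine Finset.sum_congr rfl fun τ _ => ?_
  rw [dotProduct_smul, smul_eq_mul, dotProduct_comm v]
  ring

theorem gram_isHermitian : (gram φ lam D I w h).IsHermitian := by
  unfold gram
  ext i j
  simp only [conjTranspose_apply, Matrix.add_apply, Matrix.sum_apply, Matrix.smul_apply,
    vecMulVec_apply, star_trivial, smul_eq_mul, one_apply]
  congr 1
  · exact Finset.sum_congr rfl fun τ _ => by ring
  · simp [eq_comm]

theorem gram_posDef (hlam : 0 < lam) (hw : ∀ z, 0 ≤ w z) : (gram φ lam D I w h).PosDef := by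
  refine .of_dotProduct_mulVec_pos (gram_isHermitian φ lam D I w h) fun v hv => ?_
  rw [star_trivial, quad_gram]
  have h1 : 0 < v ⬝ᵥ v := by
    refine lt_of_le_of_ne (dotProduct_self_nonneg' v) fun h0 => hv ?_
    exact dotProduct_self_eq_zero.1 h0.symm
  have h2 : 0 ≤ ∑ τ ∈ I, (w (D τ h).1)⁻¹ * (φ (D τ h).1 ⬝ᵥ v) ^ 2 :=
    Finset.sum_nonneg fun τ _ => mul_nonneg (inv_nonneg.2 (hw _)) (sq_nonneg _)
  positivity

/-- The error of ridge regression splits into a bias and a noise part. -/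
theorem ridge_error (hlam : 0 < lam) (hw : ∀ z, 0 ≤ w z) (y η : Transition S A B → ℝ)
    (w₀ : Fin d → ℝ) (hy : ∀ t, y t = φ t.1 ⬝ᵥ w₀ + η t) (u : Fin d → ℝ) :
    |u ⬝ᵥ ridge φ lam D I w y h - u ⬝ᵥ w₀| ≤
      wnorm (gram φ lam D I w h)⁻¹ u * (lam * wnorm (gram φ lam D I w h)⁻¹ w₀ +
        wnorm (gram φ lam D I w h)⁻¹ (∑ τ ∈ I, (η (D τ h) / w (D τ h).1) • φ (D τ h).1)) := by
  have hpd := gram_posDef φ lam D I w h hlam hw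
  set Z := gram φ lam D I w h with hZ
  set s := ∑ τ ∈ I, (η (D τ h) / w (D τ h).1) • φ (D τ h).1 with hs
  have key : ∑ τ ∈ I, (y (D τ h) / w (D τ h).1) • φ (D τ h).1 = Z *ᵥ w₀ - lam • w₀ + s := by
    rw [hZ, gram_mulVec, add_sub_cancel_right, hs, ← Finset.sum_add_distrib]
    refine Finset.sum_congr rfl fun τ _ => ?_
    rw [hy, add_div, add_smul]
  have : ridge φ lam D I w y h = w₀ - lam • (Z⁻¹ *ᵥ w₀) + Z⁻¹ *ᵥ s := by
    rw [ridge, key, ← hZ, mulVec_add, mulVec_sub, mulVec_mulVec,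
      nonsing_inv_mul _ ((isUnit_iff_isUnit_det _).1 hpd.isUnit), one_mulVec, mulVec_smul]
  rw [this, dotProduct_add, dotProduct_sub, dotProduct_smul, smul_eq_mul]
  have h1 := abs_le.1 (abs_inv_quad_le_wnorm hpd u w₀)
  have h2 := abs_le.1 (abs_inv_quad_le_wnorm hpd u s)
  rw [abs_le]
  constructor <;> nlinarith

end Gram

end LinearAlgebra

/-! ### Values of matrix games -/

section MatrixGame

variable {A B : Type*} [Fintype A] [Fintype B]

/-- The max-min value of a matrix game. -/
def gameValue (Q : A → B → ℝ) : ℝ :=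
  ⨆ p : stdSimplex ℝ A, ⨅ q : stdSimplex ℝ B, payoff Q p q

theorem payoff_mono {Q Q' : A → B → ℝ} {p : A → ℝ} {q : B → ℝ} (hp : p ∈ stdSimplex ℝ A)
    (hq : q ∈ stdSimplex ℝ B) (h : ∀ a b, Q a b ≤ Q' a b) : payoff Q p q ≤ payoff Q' p q :=
  Finset.sum_le_sum fun a _ => Finset.sum_le_sum fun b _ =>
    mul_le_mul_of_nonneg_left (h a b) (mul_nonneg (hp.1 a) (hq.1 b))

theorem payoff_const {p : A → ℝ} {q : B → ℝ} (hp : p ∈ stdSimplex ℝ A)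
    (hq : q ∈ stdSimplex ℝ B) (c : ℝ) : payoff (fun _ _ => c) p q = c := by
  simp only [payoff, ← Finset.sum_mul, ← Finset.mul_sum, hp.2, hq.2, one_mul]

theorem payoff_add (Q Q' : A → B → ℝ) (p : A → ℝ) (q : B → ℝ) :
    payoff (fun a b => Q a b + Q' a b) p q = payoff Q p q + payoff Q' p q := by
  simp only [payoff, mul_add, Finset.sum_add_distrib]

theorem payoff_le {Q : A → B → ℝ} {p : A → ℝ} {q : B → ℝ} (hp : p ∈ stdSimplex ℝ A)
    (hq : q ∈ stdSimplex ℝ B) {c : ℝ} (h : ∀ a b, Q a b ≤ c) : payoff Q p q ≤ c :=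
  (payoff_mono hp hq h).trans_eq (payoff_const hp hq c)

theorem le_payoff {Q : A → B → ℝ} {p : A → ℝ} {q : B → ℝ} (hp : p ∈ stdSimplex ℝ A)
    (hq : q ∈ stdSimplex ℝ B) {c : ℝ} (h : ∀ a b, c ≤ Q a b) : c ≤ payoff Q p q :=
  (payoff_const hp hq c).symm.trans_le (payoff_mono hp hq h)

theorem exists_matrix_bound (Q : A → B → ℝ) : ∃ c, ∀ a b, |Q a b| ≤ c :=
  ⟨‖Q‖, fun a b => (norm_le_pi_norm (Q a) b).trans (norm_le_pi_norm Q a)⟩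

theorem payoff_bddBelow (Q : A → B → ℝ) (p : stdSimplex ℝ A) :
    BddBelow (Set.range fun q : stdSimplex ℝ B => payoff Q p q) := by
  obtain ⟨c, hc⟩ := exists_matrix_bound Q
  refine ⟨-c, ?_⟩
  rintro _ ⟨q, rfl⟩
  exact le_payoff p.2 q.2 fun a b => (abs_le.1 (hc a b)).1

variable [Nonempty B]

theorem minPayoff_bddAbove (Q : A → B → ℝ) :
    BddAbove (Set.range fun p : stdSimplex ℝ A => ⨅ q : stdSimplex ℝ B, payoff Q p q) := by
  obtain ⟨c, hc⟩ := exists_matrix_bound Q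
  refine ⟨c, ?_⟩
  rintro _ ⟨p, rfl⟩
  let q : stdSimplex ℝ B := Classical.arbitrary _
  exact (ciInf_le (payoff_bddBelow Q p) q).trans
    (payoff_le p.2 q.2 fun a b => (abs_le.1 (hc a b)).2)

variable [Nonempty A]

theorem gameValue_le_add {Q Q' : A → B → ℝ} {c : ℝ} (h : ∀ a b, Q a b ≤ Q' a b + c) :
    gameValue Q ≤ gameValue Q' + c := by
  refine ciSup_le fun p => ?_
  rw [← sub_le_iff_le_add]
  refine le_trans ?_ (le_ciSup (minPayoff_bddAbove Q') p)
  refine le_ciInf fun q => ?_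
  rw [sub_le_iff_le_add]
  refine (ciInf_le (payoff_bddBelow Q p) q).trans ?_
  refine (payoff_mono p.2 q.2 h).trans_eq ?_
  rw [payoff_add, payoff_const p.2 q.2]
  rfl

/-- Used only for continuity: it makes the value estimates measurable in the data without any
measurable selection of equilibria. -/
theorem lipschitzWith_gameValue : LipschitzWith 1 (gameValue : (A → B → ℝ) → ℝ) := by
  refine LipschitzWith.of_le_add fun Q Q' => gameValue_le_add fun a b => ?_
  have h1 : dist (Q a b) (Q' a b) ≤ dist Q Q' :=
    (dist_le_pi_dist (Q a) (Q' a) b).trans (dist_le_pi_dist Q Q' a)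
  rw [Real.dist_eq] at h1
  linarith [le_abs_self (Q a b - Q' a b)]

theorem measurable_gameValue : Measurable (gameValue : (A → B → ℝ) → ℝ) :=
  lipschitzWith_gameValue.continuous.measurable

theorem gameValue_mem_Icc {Q : A → B → ℝ} {m M : ℝ} (h : ∀ a b, Q a b ∈ Set.Icc m M) :
    gameValue Q ∈ Set.Icc m M := by
  let p : stdSimplex ℝ A := Classical.arbitrary _
  let q : stdSimplex ℝ B := Classical.arbitrary _
  constructor
  · refine le_trans ?_ (le_ciSup (minPayoff_bddAbove Q) p)
    exact le_ciInf fun q => le_payoff p.2 q.2 fun a b => (h a b).1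
  · refine ciSup_le fun p => ?_
    exact (ciInf_le (payoff_bddBelow Q p) q).trans (payoff_le p.2 q.2 fun a b => (h a b).2)

/-- The payoff of a Nash equilibrium is the max-min value. -/
theorem IsMatrixNash.payoff_eq {Q : A → B → ℝ} {p : A → ℝ} {q : B → ℝ}
    (h : IsMatrixNash Q p q) : payoff Q p q = gameValue Q := by
  obtain ⟨hp, hq, h1, h2⟩ := h
  apply le_antisymm
  · refine le_trans ?_ (le_ciSup (minPayoff_bddAbove Q) ⟨p, hp⟩)
    exact le_ciInf fun q' => h2 q' q'.2
  · refine ciSup_le fun p' => ?_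
    exact (ciInf_le (payoff_bddBelow Q p') ⟨q, hq⟩).trans (h1 p' p'.2)

end MatrixGame

/-! ### Backward sweeps as functions of the data -/

section Sweep

variable {H : ℕ} {S A B : Type*} [Fintype A] [Fintype B]

/-- The value functions of a backward sweep with the `Q`-estimates `Q h V`. -/
def sweepValue (Q : Fin H → (S → ℝ) → S → A → B → ℝ) : Fin (H + 1) → S → ℝ :=
  Fin.reverseInduction (motive := fun _ => S → ℝ) 0 fun h V x => gameValue (Q h V x)

@[simp]
theorem sweepValue_last (Q : Fin H → (S → ℝ) → S → A → B → ℝ) :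
    sweepValue Q (Fin.last H) = 0 :=
  Fin.reverseInduction_last

theorem sweepValue_castSucc (Q : Fin H → (S → ℝ) → S → A → B → ℝ) (h : Fin H) :
    sweepValue Q h.castSucc = fun x => gameValue (Q h (sweepValue Q h.succ) x) :=
  Fin.reverseInduction_castSucc h

/-- The value at step $k$ involves only the estimates of the steps from $k$ on. Combined with the
folds, this gives the independence that the concentration bounds need. -/
theorem sweepValue_congr {Q Q' : Fin H → (S → ℝ) → S → A → B → ℝ} (k : Fin (H + 1))
    (hQ : ∀ h : Fin H, k ≤ h.castSucc → Q h = Q' h) : sweepValue Q k = sweepValue Q' k := by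
  induction k using Fin.reverseInduction with
  | last => simp
  | cast h ih =>
    rw [sweepValue_castSucc, sweepValue_castSucc, hQ h le_rfl,
      ih fun h' hh => hQ h' ((Fin.castSucc_lt_succ).le.trans hh)]

variable [Nonempty A] [Nonempty B]

theorem sweepValue_mem_Icc {Q : Fin H → (S → ℝ) → S → A → B → ℝ}
    (hQ : ∀ (h : Fin H) V x a b, Q h V x a b ∈ Set.Icc (0 : ℝ) ((H : ℝ) - h)) (k : Fin (H + 1)) (x : S) :
    sweepValue Q k x ∈ Set.Icc (0 : ℝ) ((H : ℝ) - k) := by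
  induction k using Fin.reverseInduction with
  | last => simp
  | cast h ih =>
    rw [sweepValue_castSucc]
    exact gameValue_mem_Icc fun a b => hQ h _ x a b

variable [MeasurableSpace S]

/-- All equilibria of a matrix game have the same payoff, so the value estimates depend on the data
alone, whichever equilibria a run picks. Events can thus be defined before the output policies are
known. -/
theorem IsSweep.eq_sweepValue {Qlo Qup : Fin H → (S → ℝ) → S → A → B → ℝ}
    {πhat : Policy H S A} {ν' : Policy H S B} {π' : Policy H S A} {νhat : Policy H S B}
    {Vlo Vup : Fin (H + 1) → S → ℝ} (hs : IsSweep Qlo Qup πhat ν' π' νhat Vlo Vup) :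
    Vlo = sweepValue Qlo ∧ Vup = sweepValue Qup := by
  constructor
  · funext h
    induction h using Fin.reverseInduction with
    | last => rw [hs.lo_last, sweepValue_last]
    | cast h ih =>
      rw [sweepValue_castSucc, ← ih]
      funext x
      rw [hs.lo_value, (hs.lo_nash h x).payoff_eq]
  · funext h
    induction h using Fin.reverseInduction with
    | last => rw [hs.up_last, sweepValue_last]
    | cast h ih =>
      rw [sweepValue_castSucc, ← ih]
      funext x
      rw [hs.up_value, (hs.up_nash h x).payoff_eq]

/-- Joint measurability of a data-dependent sweep. -/
theorem measurable_sweepValue {Ω : Type*} [MeasurableSpace Ω]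
    (Q : Ω → Fin H → (S → ℝ) → S → A → B → ℝ)
    (hQ : ∀ (V : Ω → S → ℝ) (h : Fin H) (a : A) (b : B), Measurable (fun p : Ω × S => V p.1 p.2) →
      Measurable fun p : Ω × S => Q p.1 h (V p.1) p.2 a b) (h : Fin (H + 1)) :
    Measurable fun p : Ω × S => sweepValue (Q p.1) h p.2 := by
  induction h using Fin.reverseInduction with
  | last => simp
  | cast h ih =>
    simp only [sweepValue_castSucc]
    refine measurable_gameValue.comp (measurable_pi_lambda _ fun a =>
      measurable_pi_lambda _ fun b => hQ (fun ω => sweepValue (Q ω) h.succ) h a b ih)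

end Sweep

/-! ### Rollouts, the Bellman equation and the law of a transition -/

section Kernels

variable {H : ℕ} {S A B : Type*} [MeasurableSpace S] [MeasurableSpace A] [MeasurableSpace B]
  [Fintype A] [Fintype B] (G : Game H S A B) (σ : Policy H S (A × B))

instance (h : Fin H) : IsMarkovKernel (G.trans h) := G.markov h

instance (h : Fin H) : IsMarkovKernel (σ.kernel h) := by
  refine ⟨fun x => ⟨?_⟩⟩
  change (∑ c, ENNReal.ofReal (σ.prob h x c) • Measure.dirac c) Set.univ = 1
  simp only [Measure.coe_finsetSum, Measure.coe_smul, Finset.sum_apply, Pi.smul_apply,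
    measure_univ, smul_eq_mul, mul_one]
  rw [← ENNReal.ofReal_sum_of_nonneg fun c _ => (σ.mem_simplex h x).1 c, (σ.mem_simplex h x).2,
    ENNReal.ofReal_one]

instance (h : Fin H) : IsMarkovKernel (G.step σ h) := by
  unfold Game.step; infer_instance

theorem measurable_finCons (n : ℕ) : Measurable fun p : Transition S A B × (Fin n → Transition S A B) =>
    (Fin.cons p.1 p.2 : Fin (n + 1) → Transition S A B) := by
  refine measurable_pi_lambda _ fun i => ?_
  refine Fin.cases ?_ (fun i => ?_) i
  · exact measurable_fst
  · exact (measurable_pi_apply i).comp measurable_snd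

theorem isMarkovKernel_rollout (n h : ℕ) (e : h + n = H) :
    IsMarkovKernel (G.rollout σ n h e) := by
  induction n generalizing h with
  | zero => unfold Game.rollout; infer_instance
  | succ n ih =>
    have := ih (h + 1) (by omega)
    unfold Game.rollout
    exact Kernel.IsMarkovKernel.map _ (measurable_finCons n)

instance (n h : ℕ) (e : h + n = H) : IsMarkovKernel (G.rollout σ n h e) :=
  isMarkovKernel_rollout G σ n h e

variable [MeasurableSingletonClass A] [MeasurableSingletonClass B]

theorem integral_policy_kernel (h : Fin H) (x : S) (g : A × B → ℝ) :
    ∫ c, g c ∂(σ.kernel h x) = ∑ c, σ.prob h x c * g c := by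
  change ∫ c, g c ∂(∑ c, ENNReal.ofReal (σ.prob h x c) • Measure.dirac c) = _
  rw [integral_finsetSum_measure fun c _ => (integrable_dirac (by simp)).smul_measure (by simp)]
  refine Finset.sum_congr rfl fun c _ => ?_
  rw [integral_smul_measure, integral_dirac, ENNReal.toReal_ofReal ((σ.mem_simplex h x).1 c),
    smul_eq_mul]

theorem integral_step (h : Fin H) (x : S) {g : Transition S A B → ℝ} (hg : Measurable g)
    {M : ℝ} (hM : ∀ t, |g t| ≤ M) :
    ∫ t, g t ∂(G.step σ h x) =
      ∑ c, σ.prob h x c * ∫ x', g ((x, c), x') ∂(G.trans h (x, c)) := by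
  have hinteg : Integrable g (G.step σ h x) :=
    Integrable.of_bound hg.aestronglyMeasurable M (.of_forall hM)
  unfold Game.step at hinteg ⊢
  rw [integral_compProd hinteg, Kernel.prod_apply, Kernel.id_apply, Measure.dirac_prod,
    integral_map measurable_prodMk_left.aemeasurable, integral_policy_kernel]
  · rfl
  · refine StronglyMeasurable.aestronglyMeasurable ?_
    have : StronglyMeasurable fun z : S × A × B =>
        ∫ x', g (z, x') ∂(G.trans h z) := hg.stronglyMeasurable.integral_kernel_prod_right'
    exact this

/-- `G.expect` with the number of remaining steps as an index. -/
def tailExpect (f : Fin H → S × A × B → ℝ) (n h : ℕ) (e : h + n = H) (x : S) : ℝ :=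
  ∫ ep, ∑ i : Fin n, f ⟨h + i, by omega⟩ (ep i).1 ∂(G.rollout σ n h e x)

theorem expect_eq_tailExpect (f : Fin H → S × A × B → ℝ) (n h : ℕ) (e : h + n = H)
    (hh : h < H + 1) (x : S) :
    G.expect σ f ⟨h, hh⟩ x = tailExpect G σ f n h e x := by
  obtain rfl : n = H - h := by omega
  rfl

variable {f : Fin H → S × A × B → ℝ} {M : ℝ}

theorem measurable_tailExpect (hf : ∀ h, Measurable (f h)) (n h : ℕ) (e : h + n = H) :
    Measurable (tailExpect G σ f n h e) := by
  have : StronglyMeasurable fun ep : Fin n → Transition S A B =>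
      ∑ i : Fin n, f ⟨h + i, by omega⟩ (ep i).1 :=
    (Finset.measurable_sum _ fun i _ => (hf _).comp (by fun_prop)).stronglyMeasurable
  exact this.integral_kernel.measurable

theorem abs_tailExpect_le (hM : ∀ h z, |f h z| ≤ M) (n h : ℕ) (e : h + n = H) (x : S) :
    |tailExpect G σ f n h e x| ≤ n * M := by
  have := norm_integral_le_of_norm_le_const (μ := G.rollout σ n h e x)
    (f := fun ep => ∑ i : Fin n, f ⟨h + i, by omega⟩ (ep i).1) (C := n * M)
    (.of_forall fun ep => by
      refine (norm_sum_le _ _).trans ((Finset.sum_le_sum fun i _ => hM _ _).trans_eq ?_)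
      simp)
  simpa [tailExpect] using this

theorem tailExpect_succ (hf : ∀ h, Measurable (f h)) (hM : ∀ h z, |f h z| ≤ M)
    (n h : ℕ) (e : h + (n + 1) = H) (x : S) :
    tailExpect G σ f (n + 1) h e x = ∑ c, σ.prob ⟨h, by omega⟩ x c *
      (f ⟨h, by omega⟩ (x, c) + ∫ x', tailExpect G σ f n (h + 1) (by omega) x'
        ∂(G.trans ⟨h, by omega⟩ (x, c))) := by
  have hmeas : Measurable fun ep : Fin n → Transition S A B =>
      ∑ i : Fin n, f ⟨h + 1 + i, by omega⟩ (ep i).1 :=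
    Finset.measurable_sum _ fun i _ => (hf _).comp (by fun_prop)
  have hb : ∀ ep : Fin n → Transition S A B,
      |∑ i : Fin n, f ⟨h + 1 + i, by omega⟩ (ep i).1| ≤ n * M := fun ep => by
    refine (Finset.abs_sum_le_sum_abs _ _).trans ((Finset.sum_le_sum fun i _ => hM _ _).trans_eq ?_)
    simp
  have h1 : tailExpect G σ f (n + 1) h e x = ∫ t, (f ⟨h, by omega⟩ t.1 +
      tailExpect G σ f n (h + 1) (by omega) t.2) ∂(G.step σ ⟨h, by omega⟩ x) := by
    unfold tailExpect
    rw [Game.rollout]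
    rw [Kernel.map_apply _ (measurable_finCons n), integral_map (measurable_finCons n).aemeasurable
      (by
        refine Measurable.aestronglyMeasurable ?_
        exact Finset.measurable_sum _ fun i _ => (hf _).comp (by fun_prop))]
    have h2 : ∀ p : Transition S A B × (Fin n → Transition S A B),
        ∑ i : Fin (n + 1), f ⟨h + i, by omega⟩
          ((Fin.cons p.1 p.2 : Fin (n + 1) → Transition S A B) i).1 =
        f ⟨h, by omega⟩ p.1.1 + ∑ i : Fin n, f ⟨h + 1 + i, by omega⟩ (p.2 i).1 := by
      intro p
      rw [Fin.sum_univ_succ]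
      congr 1
      refine Finset.sum_congr rfl fun i _ => ?_
      simp only [Fin.cons_succ, Fin.val_succ]
      congr 2
      omega
    simp only [h2]
    have hinteg : Integrable (fun p : Transition S A B × (Fin n → Transition S A B) =>
        f ⟨h, by omega⟩ p.1.1 + ∑ i : Fin n, f ⟨h + 1 + i, by omega⟩ (p.2 i).1)
        ((G.step σ ⟨h, by omega⟩ ⊗ₖ (G.rollout σ n (h + 1) (by omega)).comap
        (fun p : S × Transition S A B => p.2.2) (by fun_prop)) x) := by
      refine Integrable.of_bound (C := M + n * M) (Measurable.aestronglyMeasurable ?_)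
        (.of_forall fun p => ?_)
      · exact ((hf _).comp (by fun_prop)).add (hmeas.comp measurable_snd)
      · exact (norm_add_le _ _).trans (add_le_add (hM _ _) (hb _))
    rw [integral_compProd hinteg]
    refine integral_congr_ae (.of_forall fun t => ?_)
    simp only [Kernel.comap_apply]
    rw [integral_add (integrable_const _)
      (Integrable.of_bound hmeas.aestronglyMeasurable (n * M) (.of_forall hb))]
    simp
  have hm := measurable_tailExpect G σ hf n (h + 1) (by omega)
  have hb' := abs_tailExpect_le G σ hM n (h + 1) (by omega)
  have hg : Measurable fun t : Transition S A B =>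
      f ⟨h, by omega⟩ t.1 + tailExpect G σ f n (h + 1) (by omega) t.2 :=
    ((hf _).comp measurable_fst).add (hm.comp measurable_snd)
  rw [h1, integral_step G σ ⟨h, by omega⟩ x hg (M := M + n * M)
    fun t => (abs_add_le _ _).trans (add_le_add (hM _ _) (hb' _))]
  refine Finset.sum_congr rfl fun c _ => ?_
  congr 1
  dsimp only
  rw [integral_add (integrable_const _)
    (Integrable.of_bound hm.aestronglyMeasurable (n * M) (.of_forall hb'))]
  simp

theorem measurable_expect (hf : ∀ h, Measurable (f h)) (h : Fin (H + 1)) :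
    Measurable (G.expect σ f h) := by
  have : G.expect σ f h = tailExpect G σ f (H - h) h (by omega) :=
    funext fun x => expect_eq_tailExpect G σ f (H - h) h (by omega) h.2 x
  rw [this]
  exact measurable_tailExpect G σ hf _ _ _

theorem abs_expect_le (hM : ∀ h z, |f h z| ≤ M) (h : Fin (H + 1)) (x : S) :
    |G.expect σ f h x| ≤ ((H : ℝ) - h) * M := by
  have h1 := abs_tailExpect_le G σ hM (H - h) h (by omega) x
  rw [Nat.cast_sub (by omega)] at h1
  exact h1

@[simp]
theorem expect_last (f : Fin H → S × A × B → ℝ) (x : S) : G.expect σ f (Fin.last H) x = 0 := by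
  rw [Fin.last, expect_eq_tailExpect G σ f 0 H rfl (Nat.lt_succ_self H) x]
  simp [tailExpect]

/-- The Bellman equation. -/
theorem expect_castSucc (hf : ∀ h, Measurable (f h)) (hM : ∀ h z, |f h z| ≤ M) (h : Fin H)
    (x : S) : G.expect σ f h.castSucc x = ∑ c, σ.prob h x c *
      (f h (x, c) + ∫ x', G.expect σ f h.succ x' ∂(G.trans h (x, c))) := by
  obtain ⟨h, hh⟩ := h
  obtain ⟨n, hn⟩ : ∃ n, h + (n + 1) = H := ⟨H - h - 1, by omega⟩
  have h1 := expect_eq_tailExpect G σ f (n + 1) h hn (by omega) x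
  have h2 : G.expect σ f ⟨h + 1, by omega⟩ = tailExpect G σ f n (h + 1) (by omega) :=
    funext fun x => expect_eq_tailExpect G σ f n (h + 1) (by omega) (by omega) x
  change G.expect σ f ⟨h, by omega⟩ x = ∑ c, σ.prob ⟨h, hh⟩ x c *
    (f ⟨h, hh⟩ (x, c) + ∫ x', G.expect σ f ⟨h + 1, by omega⟩ x' ∂(G.trans ⟨h, hh⟩ (x, c)))
  rw [h1, h2, tailExpect_succ G σ hf hM]

/-- A bounded measurable function is integrable for a transition law. -/
theorem integrable_trans {V : S → ℝ} (hV : Measurable V) {C : ℝ} (hC : ∀ x, |V x| ≤ C)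
    (h : Fin H) (z : S × A × B) : Integrable V (G.trans h z) :=
  Integrable.of_bound hV.aestronglyMeasurable C (.of_forall hC)

/-- Subsolutions of the Bellman recursion lie below the expected total reward. -/
theorem le_expect_of_le_bellman (hf : ∀ h, Measurable (f h)) (hM : ∀ h z, |f h z| ≤ M)
    {U : Fin (H + 1) → S → ℝ} (hU : ∀ h, Measurable (U h)) {C : ℝ} (hC : ∀ h x, |U h x| ≤ C)
    (hlast : ∀ x, U (Fin.last H) x ≤ 0) (k : Fin (H + 1))
    (hstep : ∀ h : Fin H, k ≤ h.castSucc → ∀ x, U h.castSucc x ≤ ∑ c, σ.prob h x c *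
      (f h (x, c) + ∫ x', U h.succ x' ∂(G.trans h (x, c)))) (x : S) :
    U k x ≤ G.expect σ f k x := by
  induction k using Fin.reverseInduction generalizing x with
  | last => simpa using hlast x
  | cast h ih =>
    rw [expect_castSucc G σ hf hM]
    refine (hstep h le_rfl x).trans (Finset.sum_le_sum fun c _ =>
      mul_le_mul_of_nonneg_left ?_ ((σ.mem_simplex h x).1 c))
    gcongr
    · exact integrable_trans G (hU _) (hC _) h _
    · exact integrable_trans G (measurable_expect G σ hf _) (abs_expect_le G σ hM _) h _
    · exact ih fun h' hh => hstep h' (Fin.castSucc_lt_succ.le.trans hh)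

theorem expect_neg (f : Fin H → S × A × B → ℝ) (h : Fin (H + 1)) (x : S) :
    G.expect σ (fun h z => - f h z) h x = - G.expect σ f h x := by
  simp only [Game.expect, Finset.sum_neg_distrib, integral_neg]

/-- Supersolutions of the Bellman recursion lie above the expected total reward. -/
theorem expect_le_of_bellman_le (hf : ∀ h, Measurable (f h)) (hM : ∀ h z, |f h z| ≤ M)
    {U : Fin (H + 1) → S → ℝ} (hU : ∀ h, Measurable (U h)) {C : ℝ} (hC : ∀ h x, |U h x| ≤ C)
    (hlast : ∀ x, 0 ≤ U (Fin.last H) x) (k : Fin (H + 1))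
    (hstep : ∀ h : Fin H, k ≤ h.castSucc → ∀ x, ∑ c, σ.prob h x c *
      (f h (x, c) + ∫ x', U h.succ x' ∂(G.trans h (x, c))) ≤ U h.castSucc x) (x : S) :
    G.expect σ f k x ≤ U k x := by
  have := le_expect_of_le_bellman G σ (f := fun h z => - f h z) (M := M)
    (U := fun h x => - U h x) (fun h => (hf h).neg) (by simpa using hM) (fun h => (hU h).neg)
    (C := C) (by simpa using hC) (by simpa using hlast) k (fun h hk x => by
      refine (neg_le_neg (hstep h hk x)).trans_eq ?_
      rw [← Finset.sum_neg_distrib]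
      refine Finset.sum_congr rfl fun c _ => ?_
      rw [integral_neg]
      ring) x
  rw [expect_neg] at this
  linarith

theorem expect_add {g : Fin H → S × A × B → ℝ} (hf : ∀ h, Measurable (f h))
    (hM : ∀ h z, |f h z| ≤ M) (hg : ∀ h, Measurable (g h)) {M' : ℝ} (hM' : ∀ h z, |g h z| ≤ M')
    (h : Fin (H + 1)) (x : S) :
    G.expect σ (fun h z => f h z + g h z) h x = G.expect σ f h x + G.expect σ g h x := by
  have key : ∀ {f : Fin H → S × A × B → ℝ} {M : ℝ}, (∀ h, Measurable (f h)) →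
      (∀ h z, |f h z| ≤ M) → Integrable (fun ep : Fin (H - h) → Transition S A B =>
        ∑ i : Fin (H - h), f ⟨h + i, by omega⟩ (ep i).1) (G.rollout σ (H - h) h (by omega) x) := by
    intro f M hf hM
    refine integrable_finsetSum _ fun i _ => Integrable.of_bound (C := M)
      (Measurable.aestronglyMeasurable ((hf _).comp (by fun_prop))) (.of_forall fun ep => hM _ _)
  simp only [Game.expect, Finset.sum_add_distrib]
  rw [integral_add (key hf hM) (key hg hM')]

theorem expect_const_mul (f : Fin H → S × A × B → ℝ) (c : ℝ) (h : Fin (H + 1)) (x : S) :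
    G.expect σ (fun h z => c * f h z) h x = c * G.expect σ f h x := by
  simp only [Game.expect, ← Finset.mul_sum, integral_const_mul]

theorem lintegral_step (h : Fin H) (x : S) {g : Transition S A B → ENNReal} (hg : Measurable g)
    {m : S × A × B → ENNReal} (hm : Measurable m)
    (hgm : ∀ z, ∫⁻ x', g (z, x') ∂(G.trans h z) = m z) :
    ∫⁻ t, g t ∂(G.step σ h x) = ∫⁻ t, m t.1 ∂(G.step σ h x) := by
  unfold Game.step
  rw [Kernel.lintegral_compProd _ _ _ hg, Kernel.lintegral_compProd _ _ _ (by fun_prop)]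
  refine lintegral_congr fun z => ?_
  simp [Kernel.prodMkLeft_apply, hgm]

/-- Induction on the number of remaining steps, peeling off the first transition. With nonnegative
integrands no integrability is needed on the way to the disintegration `transitionLaw_eq`. -/
theorem lintegral_rollout_apply {g : Transition S A B → ENNReal} (hg : Measurable g)
    {m : Fin H → S × A × B → ENNReal} (hm : ∀ k, Measurable (m k))
    (hgm : ∀ k z, ∫⁻ x', g (z, x') ∂(G.trans k z) = m k z)
    (n h : ℕ) (e : h + n = H) (i : Fin n) (x : S) :
    ∫⁻ ep, g (ep i) ∂(G.rollout σ n h e x) =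
      ∫⁻ ep, m ⟨h + i, by omega⟩ (ep i).1 ∂(G.rollout σ n h e x) := by
  induction n generalizing h x with
  | zero => exact i.elim0
  | succ n ih =>
    rw [Game.rollout, Kernel.map_apply _ (measurable_finCons n),
      lintegral_map (by fun_prop) (measurable_finCons n),
      lintegral_map (by fun_prop) (measurable_finCons n)]
    refine Fin.cases ?_ (fun i => ?_) i
    · simp only [Fin.cons_zero]
      rw [Kernel.lintegral_compProd _ _ _ (by fun_prop),
        Kernel.lintegral_compProd _ _ _ (by fun_prop)]
      simp only [lintegral_const, measure_univ, mul_one]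
      exact lintegral_step G σ _ x hg (hm _) (hgm _)
    · simp only [Fin.cons_succ]
      rw [Kernel.lintegral_compProd _ _ _ (by fun_prop),
        Kernel.lintegral_compProd _ _ _ (by fun_prop)]
      refine lintegral_congr fun t => ?_
      simp only [Kernel.comap_apply]
      rw [ih (h + 1) (by omega) i]
      refine lintegral_congr fun ep => ?_
      have : (⟨h + 1 + (i : ℕ), by omega⟩ : Fin H) = ⟨h + (i.succ : ℕ), by simp; omega⟩ := by
        ext; simp; omega
      rw [this]

variable (ρ : Measure S) [IsProbabilityMeasure ρ]

instance : IsProbabilityMeasure (G.episodeLaw ρ σ) := by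
  unfold Game.episodeLaw
  infer_instance

/-- The law of the `h`-th transition of an episode. -/
def transitionLaw (h : Fin H) : Measure (Transition S A B) :=
  (G.episodeLaw ρ σ).map fun ep => ep h

instance (h : Fin H) : IsProbabilityMeasure (transitionLaw G σ ρ h) :=
  Measure.isProbabilityMeasure_map (measurable_pi_apply h).aemeasurable

/-- Given `(x_h, a_h, b_h)`, the next state is drawn from the transition kernel. -/
theorem transitionLaw_eq (h : Fin H) :
    transitionLaw G σ ρ h = (transitionLaw G σ ρ h).fst ⊗ₘ G.trans h := by
  refine Measure.ext_of_lintegral _ fun g hg => ?_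
  obtain ⟨m, hgm⟩ : ∃ m : Fin H → S × A × B → ENNReal,
    ∀ k z, ∫⁻ x', g (z, x') ∂(G.trans k z) = m k z := ⟨_, fun _ _ => rfl⟩
  have hm : ∀ k, Measurable (m k) := fun k => by
    have : Measurable fun z : S × A × B => ∫⁻ x', g (z, x') ∂(G.trans k z) :=
      hg.lintegral_kernel_prod_right'
    simpa only [hgm] using this
  rw [Measure.lintegral_compProd hg]
  simp only [hgm]
  rw [Measure.fst, lintegral_map (hm h) measurable_fst, transitionLaw,
    lintegral_map hg (measurable_pi_apply h), lintegral_map (by fun_prop) (measurable_pi_apply h),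
    Game.episodeLaw, Measure.lintegral_bind (Kernel.aemeasurable _) (Measurable.aemeasurable (by fun_prop)),
    Measure.lintegral_bind (Kernel.aemeasurable _) (Measurable.aemeasurable (by fun_prop))]
  refine lintegral_congr fun x => ?_
  have := lintegral_rollout_apply G σ hg hm hgm H 0 (Nat.zero_add H) h x
  simpa using this

theorem integral_transitionLaw (h : Fin H) {g : Transition S A B → ℝ} (hg : Measurable g)
    {M : ℝ} (hM : ∀ t, |g t| ≤ M) :
    ∫ t, g t ∂(transitionLaw G σ ρ h) =
      ∫ t, ∫ x', g (t.1, x') ∂(G.trans h t.1) ∂(transitionLaw G σ ρ h) := by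
  have hinteg : Integrable g ((transitionLaw G σ ρ h).fst ⊗ₘ G.trans h) :=
    Integrable.of_bound hg.aestronglyMeasurable M (.of_forall hM)
  have hm : StronglyMeasurable fun z : S × A × B => ∫ x', g (z, x') ∂(G.trans h z) :=
    hg.stronglyMeasurable.integral_kernel_prod_right'
  conv_lhs => rw [transitionLaw_eq]
  rw [Measure.integral_compProd hinteg, Measure.fst,
    integral_map measurable_fst.aemeasurable hm.aestronglyMeasurable]

end Kernels

/-! ### Consequences of linearity and coverage -/

section Linear

open Matrix

variable {H d : ℕ} {S A B : Type*} [MeasurableSpace S] [MeasurableSpace A] [MeasurableSpace B]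
  [Fintype A] [Fintype B] {G : Game H S A B} {φ : S × A × B → Fin d → ℝ}

theorem dotProduct_self_eq_norm_sq (u : Fin d → ℝ) : u ⬝ᵥ u = ‖WithLp.toLp 2 u‖ ^ 2 := by
  rw [EuclideanSpace.real_norm_sq_eq]
  simp [dotProduct, pow_two]

theorem Game.IsLinear.measurable_feature (hG : G.IsLinear φ) : Measurable φ := hG.1

theorem Game.IsLinear.feature_sq_le (hG : G.IsLinear φ) (z : S × A × B) : φ z ⬝ᵥ φ z ≤ 1 := by
  rw [dotProduct_self_eq_norm_sq]
  exact pow_le_one₀ (norm_nonneg _) (hG.2.1 z)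

theorem abs_apply_le_of_sq_le {u : Fin d → ℝ} {c : ℝ} (hc : 0 ≤ c) (hu : u ⬝ᵥ u ≤ c ^ 2)
    (i : Fin d) : |u i| ≤ c := by
  refine abs_le_of_sq_le_sq (le_trans ?_ hu) hc
  have := Finset.single_le_sum (f := fun i => u i * u i) (fun i _ => mul_self_nonneg _)
    (Finset.mem_univ i)
  simpa [dotProduct, pow_two] using this

theorem Game.IsLinear.abs_feature_le (hG : G.IsLinear φ) (z : S × A × B) (i : Fin d) :
    |φ z i| ≤ 1 :=
  abs_apply_le_of_sq_le zero_le_one (by simpa using hG.feature_sq_le z) i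

/-- The transition law has total mass one, so $1=\langle\phi,\mu_h(\mathcal S)\rangle\le\sqrt
d\,\|\phi\|_2$. Features are therefore never too short, which later lets the uncertainty term absorb
lower-order terms. -/
theorem Game.IsLinear.one_le_feature_sq (hG : G.IsLinear φ) (h : Fin H) (z : S × A × B) :
    1 ≤ d * (φ z ⬝ᵥ φ z) := by
  obtain ⟨μ, θ, h1, -, h3, -⟩ := hG.2.2 h
  have h4 := h1 z Set.univ MeasurableSet.univ
  rw [probReal_univ] at h4
  have h5 := dotProduct_sq_le (φ z) (fun i => μ i Set.univ)
  have h6 : (fun i => μ i Set.univ) ⬝ᵥ (fun i => μ i Set.univ) ≤ (d : ℝ) := by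
    rw [dotProduct_self_eq_norm_sq, ← Real.sq_sqrt (Nat.cast_nonneg d)]
    exact pow_le_pow_left₀ (norm_nonneg _) h3 2
  change 1 = φ z ⬝ᵥ (fun i => μ i Set.univ) at h4
  rw [← h4, one_pow] at h5
  nlinarith [dotProduct_self_nonneg' (φ z)]

/-- Conditional expectations of functions of the next state are linear in the features. -/
theorem Game.IsLinear.exists_weight (hG : G.IsLinear φ) (h : Fin H) {V : S → ℝ}
    (hV : Measurable V) {C : ℝ} (hC : ∀ x, |V x| ≤ C) :
    ∃ w : Fin d → ℝ, ∀ z, ∫ x', V x' ∂(G.trans h z) = φ z ⬝ᵥ w := by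
  obtain ⟨μ, θ, h1, -, -, -⟩ := hG.2.2 h
  let p : Fin d → Measure S := fun i => (μ i).toJordanDecomposition.posPart
  let n : Fin d → Measure S := fun i => (μ i).toJordanDecomposition.negPart
  have hp : ∀ i, IsFiniteMeasure (p i) := fun i => (μ i).toJordanDecomposition.posPart_finite
  have hn : ∀ i, IsFiniteMeasure (n i) := fun i => (μ i).toJordanDecomposition.negPart_finite
  have hinteg : ∀ (m : Measure S) [IsFiniteMeasure m], Integrable V m := fun m _ =>
    Integrable.of_bound hV.aestronglyMeasurable C (.of_forall hC)
  have hμ : ∀ i E, MeasurableSet E → μ i E = (p i).real E - (n i).real E := fun i E hE => by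
    conv_lhs => rw [← SignedMeasure.toSignedMeasure_toJordanDecomposition (μ i)]
    rw [JordanDecomposition.toSignedMeasure, Measure.toSignedMeasure_sub_apply hE]
  refine ⟨fun i => ∫ x, V x ∂(p i) - ∫ x, V x ∂(n i), fun z => ?_⟩
  let a : Fin d → NNReal := fun i => (φ z i).toNNReal
  let b : Fin d → NNReal := fun i => (-φ z i).toNNReal
  have hab : ∀ i, φ z i = a i - b i := fun i => by
    simp only [a, b, Real.coe_toNNReal']
    rcases le_total 0 (φ z i) with h | h
    · rw [max_eq_left h, max_eq_right (by linarith)]; ring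
    · rw [max_eq_right h, max_eq_left (by linarith)]; ring
  -- The linear identity for signed measures is rearranged, using Jordan parts and the signs of the
  -- coordinates of $\phi$, so that both sides are finite positive measures. It can then be
  -- integrated against $V$.
  have key : G.trans h z + ∑ i, (b i • p i + a i • n i) = ∑ i, (a i • p i + b i • n i) := by
    refine Measure.ext fun E hE => ?_
    rw [← ENNReal.toReal_eq_toReal_iff' (measure_ne_top _ _) (measure_ne_top _ _)]
    change Measure.real _ E = Measure.real _ E
    have hsum : ∀ f g : Fin d → NNReal, (∑ i, (f i • p i + g i • n i)).real E =
        ∑ i, ((f i : ℝ) * (p i).real E + g i * (n i).real E) := fun f g => by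
      rw [measureReal_def, Measure.coe_finsetSum, Finset.sum_apply,
        ENNReal.toReal_sum fun i _ => measure_ne_top _ _]
      refine Finset.sum_congr rfl fun i _ => ?_
      rw [← measureReal_def, measureReal_add_apply]
      simp [measureReal_nnreal_smul_apply]
    rw [measureReal_add_apply, hsum, hsum, h1 z E hE, ← Finset.sum_add_distrib]
    refine Finset.sum_congr rfl fun i _ => ?_
    rw [hμ i E hE, hab i]
    ring
  have h2 := congrArg (fun m => ∫ x, V x ∂m) key
  have hsum : ∀ f g : Fin d → NNReal, ∫ x, V x ∂(∑ i, (f i • p i + g i • n i)) =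
      ∑ i, ((f i : ℝ) * ∫ x, V x ∂(p i) + g i * ∫ x, V x ∂(n i)) := fun f g => by
    rw [integral_finsetSum_measure fun i _ => hinteg _]
    refine Finset.sum_congr rfl fun i _ => ?_
    rw [integral_add_measure (hinteg _) (hinteg _), integral_smul_nnreal_measure,
      integral_smul_nnreal_measure]
    rfl
  rw [integral_add_measure (hinteg _) (hinteg _), hsum, hsum] at h2
  rw [eq_sub_of_add_eq h2, ← Finset.sum_sub_distrib, dotProduct]
  refine Finset.sum_congr rfl fun i _ => ?_
  rw [hab i]
  ring

theorem Game.IsLinear.exists_reward_weight (hG : G.IsLinear φ) (h : Fin H) {V : S → ℝ}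
    (hV : Measurable V) {C : ℝ} (hC : ∀ x, |V x| ≤ C) :
    ∃ w : Fin d → ℝ, ∀ z, G.reward h z + ∫ x', V x' ∂(G.trans h z) = φ z ⬝ᵥ w := by
  obtain ⟨w, hw⟩ := hG.exists_weight h hV hC
  obtain ⟨μ, θ, -, h2, -, -⟩ := hG.2.2 h
  exact ⟨θ + w, fun z => by rw [hw, h2, dotProduct_add]⟩

variable [MeasurableSingletonClass A] [MeasurableSingletonClass B]
  {σ : Policy H S (A × B)} {ρ : Measure S} [IsProbabilityMeasure ρ]

theorem Game.IsLinear.integrable_feature_mul (hG : G.IsLinear φ) (h : Fin H) (i j : Fin d) :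
    Integrable (fun t => φ t.1 i * φ t.1 j) (transitionLaw G σ ρ h) := by
  have := hG.measurable_feature
  refine Integrable.of_bound (C := 1) (Measurable.aestronglyMeasurable (by fun_prop))
    (.of_forall fun t => ?_)
  rw [Real.norm_eq_abs, abs_mul]
  exact mul_le_one₀ (hG.abs_feature_le _ _) (abs_nonneg _) (hG.abs_feature_le _ _)

theorem Game.IsLinear.featureCov_apply (hG : G.IsLinear φ) (h : Fin H) (i j : Fin d) :
    G.featureCov ρ σ φ h i j = ∫ t, φ t.1 i * φ t.1 j ∂(transitionLaw G σ ρ h) := by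
  have := hG.measurable_feature
  rw [transitionLaw, integral_map (measurable_pi_apply h).aemeasurable
    (Measurable.aestronglyMeasurable (by fun_prop))]
  rfl

theorem Game.IsLinear.quad_featureCov (hG : G.IsLinear φ) (h : Fin H) (v : Fin d → ℝ) :
    v ⬝ᵥ G.featureCov ρ σ φ h *ᵥ v = ∫ t, (φ t.1 ⬝ᵥ v) ^ 2 ∂(transitionLaw G σ ρ h) := by
  have h1 : ∀ t : Transition S A B, (φ t.1 ⬝ᵥ v) ^ 2 =
      ∑ i, ∑ j, v i * v j * (φ t.1 i * φ t.1 j) := fun t => by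
    rw [pow_two, dotProduct, Finset.sum_mul_sum]
    exact Finset.sum_congr rfl fun i _ => Finset.sum_congr rfl fun j _ => by ring
  simp only [h1]
  rw [integral_finsetSum _ fun i _ => integrable_finsetSum _ fun j _ =>
    (hG.integrable_feature_mul h i j).const_mul _]
  simp only [dotProduct, mulVec, Finset.mul_sum]
  refine Finset.sum_congr rfl fun i _ => ?_
  rw [integral_finsetSum _ fun j _ => (hG.integrable_feature_mul h i j).const_mul _]
  refine Finset.sum_congr rfl fun j _ => ?_
  rw [integral_const_mul, hG.featureCov_apply]
  ring

theorem featureCov_isHermitian (h : Fin H) : (G.featureCov ρ σ φ h).IsHermitian := by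
  ext i j
  simp [Game.featureCov, mul_comm]

/-- Subtracting $\kappa I$ shifts the spectrum, and every shifted eigenvalue is nonnegative since
$\kappa$ is at most the least one. -/
theorem Game.IsLinear.coverage_quad_le (hG : G.IsLinear φ) (h : Fin H) (v : Fin d → ℝ) :
    G.coverage ρ σ φ * (v ⬝ᵥ v) ≤ ∫ t, (φ t.1 ⬝ᵥ v) ^ 2 ∂(transitionLaw G σ ρ h) := by
  set C := G.featureCov ρ σ φ h with hC
  have hκ : G.coverage ρ σ φ ≤ sInf (spectrum ℝ C) :=
    ciInf_le (Set.finite_range _).bddBelow h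
  have hfin : (spectrum ℝ C).Finite := by
    rw [(featureCov_isHermitian (G := G) (φ := φ) h).spectrum_real_eq_range_eigenvalues]
    exact Set.finite_range _
  set κ := G.coverage ρ σ φ
  have hps : (C - algebraMap ℝ _ κ).PosSemidef := by
    rw [posSemidef_iff_isHermitian_and_spectrum_nonneg]
    refine ⟨(featureCov_isHermitian h).sub ?_, ?_⟩
    · rw [Algebra.algebraMap_eq_smul_one]
      exact isHermitian_one.smul (IsSelfAdjoint.all κ)
    · rw [← spectrum.sub_singleton_eq]
      rintro _ ⟨a, ha, _, rfl, rfl⟩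
      exact sub_nonneg.2 (hκ.trans (csInf_le hfin.bddBelow ha))
  have := hps.dotProduct_mulVec_nonneg v
  rw [star_trivial, sub_mulVec, dotProduct_sub, hG.quad_featureCov,
    Algebra.algebraMap_eq_smul_one, smul_mulVec, one_mulVec, dotProduct_smul, smul_eq_mul] at this
  linarith

/-- An infimum over an empty set of reals is zero by convention, so positive coverage excludes $H=0$
here and, through the empty spectrum, $d=0$ in `dim_pos`. -/
theorem horizon_pos (hκ : 0 < G.coverage ρ σ φ) : 0 < H := by
  rcases Nat.eq_zero_or_pos H with rfl | h
  · simp [Game.coverage, Real.iInf_of_isEmpty] at hκ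
  · exact h

theorem dim_pos (hκ : 0 < G.coverage ρ σ φ) : 0 < d := by
  rcases Nat.eq_zero_or_pos d with rfl | h
  · simp [Game.coverage] at hκ
  · exact h

/-- The trace of the feature covariance is at least $d\kappa$, and at most one because
$\|\phi\|_2\le1$. This trades powers of $d$ for powers of $1/\kappa$ in the sample size and in the
union bound. -/
theorem Game.IsLinear.dim_mul_coverage_le (hG : G.IsLinear φ) (hκ : 0 < G.coverage ρ σ φ) :
    d * G.coverage ρ σ φ ≤ 1 := by
  let h : Fin H := ⟨0, horizon_pos hκ⟩
  have h1 : ∀ i : Fin d, G.coverage ρ σ φ ≤ ∫ t, φ t.1 i * φ t.1 i ∂(transitionLaw G σ ρ h) := by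
    intro i
    have := hG.coverage_quad_le (σ := σ) (ρ := ρ) h (Pi.single i 1)
    simpa [pow_two] using this
  have h2 := Finset.sum_le_sum fun i (_ : i ∈ Finset.univ) => h1 i
  rw [← integral_finsetSum _ fun i _ => hG.integrable_feature_mul h i i] at h2
  simp only [Finset.sum_const, Finset.card_univ, Fintype.card_fin, nsmul_eq_mul] at h2
  refine h2.trans ?_
  have h3 := integral_mono (μ := transitionLaw G σ ρ h)
    (integrable_finsetSum _ fun i _ => hG.integrable_feature_mul h i i) (integrable_const 1)
    fun t => hG.feature_sq_le t.1
  simpa using h3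

/-- $\kappa\|w\|^2\le\mathbb E(\phi\cdot w)^2\le M^2$. The size of a regression weight is thus read
off from the range of the function it represents, whichever representing weight was chosen. -/
theorem Game.IsLinear.coverage_mul_weight_sq_le (hG : G.IsLinear φ) (h : Fin H)
    {w : Fin d → ℝ} {M : ℝ} (hw : ∀ z, |φ z ⬝ᵥ w| ≤ M) :
    G.coverage ρ σ φ * (w ⬝ᵥ w) ≤ M ^ 2 := by
  refine (hG.coverage_quad_le h w).trans ?_
  have h1 : ∀ t : Transition S A B, ‖(φ t.1 ⬝ᵥ w) ^ 2‖ ≤ M ^ 2 := fun t => by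
    rw [norm_pow]
    exact pow_le_pow_left₀ (norm_nonneg _) (hw _) 2
  have := norm_integral_le_of_norm_le_const (μ := transitionLaw G σ ρ h) (.of_forall h1)
  simp only [probReal_univ, mul_one] at this
  exact (le_abs_self _).trans this

end Linear

/-! ### Bernstein's inequality and concentration of Gram matrices -/

section Concentration

/-- One-sided Bernstein inequality for i.i.d. variables of total variance at most one. -/
theorem bernstein_one_sided {E : Type*} [MeasurableSpace E] (P : Measure E) [IsProbabilityMeasure P]
    {K : ℕ} (I : Finset (Fin K)) {g : E → ℝ} (hg : Measurable g) (hb : ∀ e, |g e| ≤ 1)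
    (h0 : ∫ e, g e ∂P = 0) (hv : I.card * ∫ e, g e ^ 2 ∂P ≤ 1) (t : ℝ) :
    (Measure.pi fun _ : Fin K => P).real {D | 1 + t ≤ ∑ τ ∈ I, g (D τ)} ≤ Real.exp (-t) := by
  set μ := Measure.pi fun _ : Fin K => P with hμ
  have hind : iIndepFun (fun (τ : Fin K) (D : Fin K → E) => g (D τ)) μ :=
    iIndepFun_pi fun _ => hg.aemeasurable
  have hmeas : ∀ τ : Fin K, Measurable fun D : Fin K → E => g (D τ) := fun τ =>
    hg.comp (measurable_pi_apply τ)
  have hexp : Integrable (fun e => Real.exp (g e)) P :=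
    Integrable.of_bound (C := Real.exp 1) (Measurable.aestronglyMeasurable (by fun_prop))
      (.of_forall fun e => by
        rw [Real.norm_eq_abs, Real.abs_exp]
        exact Real.exp_le_exp.2 (abs_le.1 (hb e)).2)
  have hgi : Integrable g P :=
    Integrable.of_bound hg.aestronglyMeasurable 1 (.of_forall hb)
  have hgi2 : Integrable (fun e => g e ^ 2) P :=
    Integrable.of_bound (C := 1) (Measurable.aestronglyMeasurable (by fun_prop))
      (.of_forall fun e => by
        rw [norm_pow]; exact pow_le_one₀ (norm_nonneg _) (hb e))
  have hmgf : ∀ τ : Fin K, mgf (fun D : Fin K → E => g (D τ)) μ 1 ≤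
      Real.exp (∫ e, g e ^ 2 ∂P) := fun τ => by
    have h1 : mgf (fun D : Fin K → E => g (D τ)) μ 1 = ∫ e, Real.exp (g e) ∂P := by
      simp only [mgf, one_mul]
      have hmp : MeasurePreserving (fun D : Fin K → E => D τ) μ P :=
        measurePreserving_eval (fun _ : Fin K => P) τ
      rw [← hmp.map_eq, integral_map (measurable_pi_apply τ).aemeasurable
        (Measurable.aestronglyMeasurable (by fun_prop))]
    rw [h1]
    -- For $|g|\le1$ one has $e^g\le1+g+g^2$. The moment generating function is needed only at $1$,
    -- because the variables are normalized in advance to range and total variance at most one.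
    have h2 : ∫ e, Real.exp (g e) ∂P ≤ ∫ e, (1 + g e + g e ^ 2) ∂P := by
      refine integral_mono hexp (((integrable_const _).add hgi).add hgi2) fun e => ?_
      have := abs_le.1 (Real.abs_exp_sub_one_sub_id_le (hb e))
      dsimp only
      linarith
    rw [integral_add (f := fun e => 1 + g e) ((integrable_const _).add hgi) hgi2,
      integral_add (integrable_const _) hgi, h0] at h2
    simp only [integral_const, probReal_univ, smul_eq_mul, mul_one, add_zero] at h2
    linarith [Real.add_one_le_exp (∫ e, g e ^ 2 ∂P)]
  have hsum : mgf (∑ τ ∈ I, fun D : Fin K → E => g (D τ)) μ 1 ≤ Real.exp 1 := by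
    rw [hind.mgf_sum hmeas]
    calc ∏ τ ∈ I, mgf (fun D : Fin K → E => g (D τ)) μ 1
        ≤ ∏ τ ∈ I, Real.exp (∫ e, g e ^ 2 ∂P) :=
          Finset.prod_le_prod (fun _ _ => mgf_nonneg) fun τ _ => hmgf τ
      _ = Real.exp (I.card * ∫ e, g e ^ 2 ∂P) := by
          rw [Finset.prod_const, ← Real.exp_nat_mul]
      _ ≤ Real.exp 1 := Real.exp_le_exp.2 hv
  have hinteg : Integrable (fun D => Real.exp (1 * (∑ τ ∈ I, fun D : Fin K → E => g (D τ)) D)) μ := by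
    refine Integrable.of_bound (C := Real.exp I.card)
      (Measurable.aestronglyMeasurable ?_) (.of_forall fun D => ?_)
    · simp only [Finset.sum_apply]
      fun_prop
    · rw [Real.norm_eq_abs, Real.abs_exp, one_mul, Finset.sum_apply]
      refine Real.exp_le_exp.2 ((Finset.sum_le_sum fun τ _ => (abs_le.1 (hb (D τ))).2).trans_eq ?_)
      simp
  have := measure_ge_le_exp_mul_mgf (X := ∑ τ ∈ I, fun D : Fin K → E => g (D τ)) (μ := μ)
    (1 + t) zero_le_one hinteg
  simp only [Finset.sum_apply] at this
  refine this.trans ((mul_le_mul_of_nonneg_left hsum (Real.exp_pos _).le).trans_eq ?_)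
  rw [← Real.exp_add]
  congr 1
  ring

theorem bernstein {E : Type*} [MeasurableSpace E] (P : Measure E) [IsProbabilityMeasure P]
    {K : ℕ} (I : Finset (Fin K)) {g : E → ℝ} (hg : Measurable g) (hb : ∀ e, |g e| ≤ 1)
    (h0 : ∫ e, g e ∂P = 0) (hv : I.card * ∫ e, g e ^ 2 ∂P ≤ 1) (t : ℝ) :
    (Measure.pi fun _ : Fin K => P).real {D | 1 + t ≤ |∑ τ ∈ I, g (D τ)|} ≤
      2 * Real.exp (-t) := by
  have h1 := bernstein_one_sided P I hg hb h0 hv t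
  have h2 := bernstein_one_sided P I (g := fun e => - g e) hg.neg (by simpa using hb)
    (by rw [integral_neg, h0, neg_zero]) (by simpa using hv) t
  have h3 : {D : Fin K → E | 1 + t ≤ |∑ τ ∈ I, g (D τ)|} ⊆
      {D | 1 + t ≤ ∑ τ ∈ I, g (D τ)} ∪ {D | 1 + t ≤ ∑ τ ∈ I, - g (D τ)} := by
    intro D hD
    rw [Set.mem_ofPred_eq, le_abs] at hD
    simpa [Finset.sum_neg_distrib] using hD
  have h4 := (measureReal_mono (μ := Measure.pi fun _ : Fin K => P) h3).trans
    (measureReal_union_le _ _)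
  linarith

open Matrix

variable {H K d : ℕ} {S A B : Type*} [MeasurableSpace S] [MeasurableSpace A] [MeasurableSpace B]
  [Fintype A] [Fintype B] [MeasurableSingletonClass A] [MeasurableSingletonClass B]
  {G : Game H S A B} {φ : S × A × B → Fin d → ℝ} {σ : Policy H S (A × B)} {ρ : Measure S}
  [IsProbabilityMeasure ρ]

variable (G σ ρ K) in
/-- The law of a dataset of `K` episodes. -/
abbrev datasetLaw : Measure (Fin K → Episode H S A B) :=
  Measure.pi fun _ : Fin K => G.episodeLaw ρ σ

theorem bernstein_transition (h : Fin H) (I : Finset (Fin K)) {g : Transition S A B → ℝ}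
    (hg : Measurable g) (hb : ∀ e, |g e| ≤ 1) (h0 : ∫ t, g t ∂(transitionLaw G σ ρ h) = 0)
    (hv : I.card * ∫ t, g t ^ 2 ∂(transitionLaw G σ ρ h) ≤ 1) (ι : ℝ) :
    (datasetLaw K G σ ρ).real {D | ι ≤ |∑ τ ∈ I, g (D τ h)|} ≤ 2 * Real.exp (1 - ι) := by
  have hm : ∀ f : Transition S A B → ℝ, Measurable f →
      ∫ ep, f (ep h) ∂(G.episodeLaw ρ σ) = ∫ t, f t ∂(transitionLaw G σ ρ h) := fun f hf => by
    rw [transitionLaw, integral_map (measurable_pi_apply h).aemeasurable hf.aestronglyMeasurable]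
  have := bernstein (G.episodeLaw ρ σ) I (g := fun ep => g (ep h)) (by fun_prop)
    (fun ep => hb _) ((hm g hg).trans h0) (by rw [hm (fun t => g t ^ 2) (by fun_prop)]; exact hv)
    (ι - 1)
  simpa using this

/-- Centered product of two features, weighted by `1 / w`. -/
def gramDeviation (G : Game H S A B) (φ : S × A × B → Fin d → ℝ) (σ : Policy H S (A × B))
    (ρ : Measure S) (h : Fin H) (w : S × A × B → ℝ) (i j : Fin d) (t : Transition S A B) : ℝ :=
  (w t.1)⁻¹ * (φ t.1 i * φ t.1 j) -
    ∫ t, (w t.1)⁻¹ * (φ t.1 i * φ t.1 j) ∂(transitionLaw G σ ρ h)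

theorem inv_weight_mem {w : S × A × B → ℝ} (hw : ∀ z, 1 ≤ w z) (z : S × A × B) :
    0 ≤ (w z)⁻¹ ∧ (w z)⁻¹ ≤ 1 :=
  ⟨inv_nonneg.2 (zero_le_one.trans (hw z)), inv_le_one_of_one_le₀ (hw z)⟩

theorem Game.IsLinear.abs_weighted_feature_mul_le (hG : G.IsLinear φ) {w : S × A × B → ℝ}
    (hw : ∀ z, 1 ≤ w z) (i j : Fin d) (z : S × A × B) : |(w z)⁻¹ * (φ z i * φ z j)| ≤ 1 := by
  rw [abs_mul, abs_mul, abs_of_nonneg (inv_weight_mem hw z).1]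
  exact mul_le_one₀ (inv_weight_mem hw z).2 (by positivity)
    (mul_le_one₀ (hG.abs_feature_le _ _) (abs_nonneg _) (hG.abs_feature_le _ _))

theorem Game.IsLinear.integrable_weighted_feature_mul (hG : G.IsLinear φ) {w : S × A × B → ℝ}
    (hwm : Measurable w) (hw : ∀ z, 1 ≤ w z) (h : Fin H) (i j : Fin d) :
    Integrable (fun t => (w t.1)⁻¹ * (φ t.1 i * φ t.1 j)) (transitionLaw G σ ρ h) := by
  have := hG.measurable_feature
  exact Integrable.of_bound (C := 1) (Measurable.aestronglyMeasurable (by fun_prop))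
    (.of_forall fun t => hG.abs_weighted_feature_mul_le hw i j t.1)

/-- Bernstein's inequality for the deviation divided by $\sqrt n$, whose total variance is then at
most one. -/
theorem gram_entry_concentration (hG : G.IsLinear φ) {w : S × A × B → ℝ} (hwm : Measurable w)
    (hw : ∀ z, 1 ≤ w z) (h : Fin H) (I : Finset (Fin K)) (hI : 4 ≤ I.card) (i j : Fin d) (ι : ℝ) :
    (datasetLaw K G σ ρ).real
      {D | √(I.card : ℝ) * ι ≤ |∑ τ ∈ I, gramDeviation G φ σ ρ h w i j (D τ h)|} ≤
      2 * Real.exp (1 - ι) := by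
  have hφ := hG.measurable_feature
  have hn : (4 : ℝ) ≤ I.card := by exact_mod_cast hI
  -- The centered product has range at most $2$; this is where at least four episodes are required.
  have hs : 2 ≤ √(I.card : ℝ) := by
    rw [show (2 : ℝ) = √4 by rw [show (4 : ℝ) = 2 ^ 2 by norm_num, Real.sqrt_sq (by norm_num)]]
    exact Real.sqrt_le_sqrt hn
  set s := √(I.card : ℝ) with hsdef
  have hss : s ^ 2 = I.card := Real.sq_sqrt (Nat.cast_nonneg _)
  set f : Transition S A B → ℝ := fun t => (w t.1)⁻¹ * (φ t.1 i * φ t.1 j) with hf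
  have hfm : Measurable f := by fun_prop
  have hfb : ∀ t, |f t| ≤ 1 := fun t => hG.abs_weighted_feature_mul_le hw i j t.1
  have hfi : Integrable f (transitionLaw G σ ρ h) :=
    hG.integrable_weighted_feature_mul hwm hw h i j
  set m := ∫ t, f t ∂(transitionLaw G σ ρ h) with hm
  have hmb : |m| ≤ 1 := by
    have := norm_integral_le_of_norm_le_const (μ := transitionLaw G σ ρ h) (f := f) (.of_forall hfb)
    simpa using this
  have hdev : ∀ t, gramDeviation G φ σ ρ h w i j t = f t - m := fun t => rfl
  have h0 : ∫ t, (f t - m) / s ∂(transitionLaw G σ ρ h) = 0 := by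
    rw [integral_div, integral_sub hfi (integrable_const _)]
    simp [← hm]
  have hf2 : Integrable (fun t => f t ^ 2) (transitionLaw G σ ρ h) :=
    Integrable.of_bound (C := 1) (Measurable.aestronglyMeasurable (by fun_prop))
      (.of_forall fun t => by rw [norm_pow]; exact pow_le_one₀ (norm_nonneg _) (hfb t))
  have h2 : I.card * ∫ t, ((f t - m) / s) ^ 2 ∂(transitionLaw G σ ρ h) ≤ 1 := by
    have h3 : ∫ t, (f t - m) ^ 2 ∂(transitionLaw G σ ρ h) ≤ 1 := by
      have h4 : ∀ t, (f t - m) ^ 2 = f t ^ 2 - 2 * m * f t + m ^ 2 := fun t => by ring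
      simp only [h4]
      rw [integral_add (f := fun t => f t ^ 2 - 2 * m * f t) (hf2.sub (hfi.const_mul _))
          (integrable_const _),
        integral_sub hf2 (hfi.const_mul _), integral_const_mul, ← hm]
      have h5 : ∫ t, f t ^ 2 ∂(transitionLaw G σ ρ h) ≤ 1 := by
        have := integral_mono hf2 (integrable_const (1 : ℝ)) fun t =>
          (sq_le_one_iff_abs_le_one _).2 (hfb t)
        simpa using this
      simp only [integral_const, probReal_univ, smul_eq_mul]
      nlinarith [sq_nonneg m]
    simp only [div_pow]
    rw [integral_div, hss, mul_div_cancel₀ _ (by positivity)]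
    exact h3
  have := bernstein_transition (G := G) (σ := σ) (ρ := ρ) h I
    (g := fun t => (f t - m) / s) (by fun_prop) (fun t => by
      rw [abs_div, abs_of_pos (by linarith : 0 < s), div_le_one (by linarith)]
      linarith [abs_sub (f t) m, hfb t]) h0 h2 ι
  refine (measureReal_mono fun D hD => ?_).trans this
  simp only [Set.mem_ofPred_eq, hdev] at hD ⊢
  rw [← Finset.sum_div, abs_div, abs_of_pos (by linarith : 0 < s), le_div_iff₀ (by linarith)]
  linarith

/-- The event that every entry of the Gram matrix is close to its mean. -/
def gramGood (G : Game H S A B) (φ : S × A × B → Fin d → ℝ) (σ : Policy H S (A × B))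
    (ρ : Measure S) (h : Fin H) (I : Finset (Fin K)) (w : S × A × B → ℝ) (ι : ℝ) :
    Set (Fin K → Episode H S A B) :=
  {D | ∀ i j, |∑ τ ∈ I, gramDeviation G φ σ ρ h w i j (D τ h)| < √(I.card : ℝ) * ι}

theorem gram_concentration (hG : G.IsLinear φ) {w : S × A × B → ℝ} (hwm : Measurable w)
    (hw : ∀ z, 1 ≤ w z) (h : Fin H) (I : Finset (Fin K)) (hI : 4 ≤ I.card) (ι : ℝ) :
    (datasetLaw K G σ ρ).real (gramGood G φ σ ρ h I w ι)ᶜ ≤ 2 * d ^ 2 * Real.exp (1 - ι) := by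
  have h1 : (gramGood G φ σ ρ h I w ι)ᶜ ⊆ ⋃ p : Fin d × Fin d,
      {D | √(I.card : ℝ) * ι ≤ |∑ τ ∈ I, gramDeviation G φ σ ρ h w p.1 p.2 (D τ h)|} := by
    intro D hD
    simp only [gramGood, Set.mem_compl_iff, Set.mem_ofPred_eq, not_forall, not_lt] at hD
    obtain ⟨i, j, hij⟩ := hD
    exact Set.mem_iUnion.2 ⟨(i, j), hij⟩
  refine (measureReal_mono h1).trans ((measureReal_iUnion_fintype_le _).trans
    ((Finset.sum_le_sum fun p _ => gram_entry_concentration hG hwm hw h I hI p.1 p.2 ι).trans_eq ?_))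
  simp
  ring

/-- The mean of `(φ ⬝ v) ^ 2 / w`. -/
def popQuad (G : Game H S A B) (φ : S × A × B → Fin d → ℝ) (σ : Policy H S (A × B))
    (ρ : Measure S) (h : Fin H) (w : S × A × B → ℝ) (v : Fin d → ℝ) : ℝ :=
  ∫ t, (w t.1)⁻¹ * (φ t.1 ⬝ᵥ v) ^ 2 ∂(transitionLaw G σ ρ h)

theorem sq_dotProduct_eq_sum (u v : Fin d → ℝ) :
    (u ⬝ᵥ v) ^ 2 = ∑ i, ∑ j, v i * v j * (u i * u j) := by
  rw [pow_two, dotProduct, Finset.sum_mul_sum]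
  exact Finset.sum_congr rfl fun i _ => Finset.sum_congr rfl fun j _ => by ring

theorem popQuad_eq_sum (hG : G.IsLinear φ) {w : S × A × B → ℝ} (hwm : Measurable w)
    (hw : ∀ z, 1 ≤ w z) (h : Fin H) (v : Fin d → ℝ) :
    popQuad G φ σ ρ h w v = ∑ i, ∑ j, v i * v j *
      ∫ t, (w t.1)⁻¹ * (φ t.1 i * φ t.1 j) ∂(transitionLaw G σ ρ h) := by
  have h1 : ∀ t : Transition S A B, (w t.1)⁻¹ * (φ t.1 ⬝ᵥ v) ^ 2 =
      ∑ i, ∑ j, v i * v j * ((w t.1)⁻¹ * (φ t.1 i * φ t.1 j)) := fun t => by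
    rw [sq_dotProduct_eq_sum, Finset.mul_sum]
    refine Finset.sum_congr rfl fun i _ => ?_
    rw [Finset.mul_sum]
    exact Finset.sum_congr rfl fun j _ => by ring
  simp only [popQuad, h1]
  rw [integral_finsetSum _ fun i _ => integrable_finsetSum _ fun j _ =>
    (hG.integrable_weighted_feature_mul hwm hw h i j).const_mul _]
  refine Finset.sum_congr rfl fun i _ => ?_
  rw [integral_finsetSum _ fun j _ =>
    (hG.integrable_weighted_feature_mul hwm hw h i j).const_mul _]
  exact Finset.sum_congr rfl fun j _ => integral_const_mul _ _

theorem Game.IsLinear.sq_feature_dot_le (hG : G.IsLinear φ) (z : S × A × B) (v : Fin d → ℝ) :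
    (φ z ⬝ᵥ v) ^ 2 ≤ v ⬝ᵥ v :=
  (dotProduct_sq_le _ _).trans
    (mul_le_of_le_one_left (dotProduct_self_nonneg' v) (hG.feature_sq_le z))

theorem integrable_popQuad (hG : G.IsLinear φ) {w : S × A × B → ℝ} (hwm : Measurable w)
    (hw : ∀ z, 1 ≤ w z) (h : Fin H) (v : Fin d → ℝ) :
    Integrable (fun t => (w t.1)⁻¹ * (φ t.1 ⬝ᵥ v) ^ 2) (transitionLaw G σ ρ h) := by
  have hφ := hG.measurable_feature
  have : Measurable fun t : Transition S A B => φ t.1 ⬝ᵥ v := by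
    unfold dotProduct; fun_prop
  refine Integrable.of_bound (C := v ⬝ᵥ v) (Measurable.aestronglyMeasurable (by fun_prop))
    (.of_forall fun t => ?_)
  rw [Real.norm_eq_abs, abs_of_nonneg (mul_nonneg (inv_weight_mem hw _).1 (sq_nonneg _))]
  exact (mul_le_of_le_one_left (sq_nonneg _) (inv_weight_mem hw _).2).trans
    (hG.sq_feature_dot_le _ _)

/-- A weight bounded by $L$ costs at most a factor $L$ in coverage. -/
theorem popQuad_ge (hG : G.IsLinear φ) {w : S × A × B → ℝ} (hwm : Measurable w)
    (hw : ∀ z, 1 ≤ w z) {L : ℝ} (hL : ∀ z, w z ≤ L) (hL0 : 0 < L) (h : Fin H) (v : Fin d → ℝ) :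
    G.coverage ρ σ φ / L * (v ⬝ᵥ v) ≤ popQuad G φ σ ρ h w v := by
  have h1 := hG.coverage_quad_le (σ := σ) (ρ := ρ) h v
  have h2 : L⁻¹ * ∫ t, (φ t.1 ⬝ᵥ v) ^ 2 ∂(transitionLaw G σ ρ h) ≤ popQuad G φ σ ρ h w v := by
    rw [← integral_const_mul]
    refine integral_mono ?_ (integrable_popQuad hG hwm hw h v) fun t => ?_
    · have := integrable_popQuad (σ := σ) (ρ := ρ) hG (w := fun _ => 1) measurable_const
        (fun _ => le_rfl) h v
      simp only [inv_one, one_mul] at this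
      exact this.const_mul _
    · exact mul_le_mul_of_nonneg_right
        (inv_anti₀ (lt_of_lt_of_le one_pos (hw _)) (hL _)) (sq_nonneg _)
  refine le_trans ?_ h2
  rw [div_mul_eq_mul_div, div_eq_inv_mul]
  exact mul_le_mul_of_nonneg_left h1 (inv_nonneg.2 hL0.le)

theorem sq_sum_abs_le (v : Fin d → ℝ) : (∑ i, |v i|) ^ 2 ≤ d * (v ⬝ᵥ v) := by
  have := sq_sum_le_card_mul_sum_sq (s := Finset.univ) (f := fun i => |v i|)
  simpa [dotProduct, pow_two] using this

/-- On the good event the Gram matrix dominates half of its mean. -/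
theorem half_pop_le_quad_gram (hG : G.IsLinear φ) {w : S × A × B → ℝ} (hwm : Measurable w)
    (hw : ∀ z, 1 ≤ w z) {L : ℝ} (hL : ∀ z, w z ≤ L) (hL0 : 0 < L) {lam : ℝ} (hlam : 0 < lam)
    {ι : ℝ} (h : Fin H) (I : Finset (Fin K))
    (hι : 2 * L * (d * (√(I.card : ℝ) * ι)) ≤ I.card * G.coverage ρ σ φ)
    {D : Fin K → Episode H S A B} (hD : D ∈ gramGood G φ σ ρ h I w ι) (v : Fin d → ℝ) :
    (I.card * popQuad G φ σ ρ h w v + lam * (v ⬝ᵥ v)) / 2 ≤ v ⬝ᵥ gram φ lam D I w h *ᵥ v := by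
  have hv := dotProduct_self_nonneg' v
  have h1 := popQuad_ge (σ := σ) (ρ := ρ) hG hwm hw hL hL0 h v
  have h2 : ∑ τ ∈ I, (w (D τ h).1)⁻¹ * (φ (D τ h).1 ⬝ᵥ v) ^ 2 - I.card * popQuad G φ σ ρ h w v =
      ∑ i, ∑ j, v i * v j * ∑ τ ∈ I, gramDeviation G φ σ ρ h w i j (D τ h) := by
    simp only [gramDeviation, Finset.sum_sub_distrib, Finset.sum_const, nsmul_eq_mul, mul_sub]
    rw [popQuad_eq_sum hG hwm hw, Finset.mul_sum]
    congr 1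
    · simp only [sq_dotProduct_eq_sum, Finset.mul_sum]
      rw [Finset.sum_comm]
      refine Finset.sum_congr rfl fun i _ => ?_
      rw [Finset.sum_comm]
      exact Finset.sum_congr rfl fun j _ => Finset.sum_congr rfl fun τ _ => by ring
    · refine Finset.sum_congr rfl fun i _ => ?_
      rw [Finset.mul_sum]
      exact Finset.sum_congr rfl fun j _ => by ring
  -- Entrywise deviations give a deviation of the quadratic form with a loss of $d$, from
  -- $(\sum_i|v_i|)^2\le d\,\|v\|^2$. The sample size affords this loss, so no matrix concentration
  -- inequality is required.
  have h3 : |∑ i, ∑ j, v i * v j * ∑ τ ∈ I, gramDeviation G φ σ ρ h w i j (D τ h)| ≤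
      (d * (√(I.card : ℝ) * ι)) * (v ⬝ᵥ v) := by
    rcases Nat.eq_zero_or_pos d with rfl | hd
    · simp
    have hpos : 0 ≤ √(I.card : ℝ) * ι := (abs_nonneg _).trans (hD ⟨0, hd⟩ ⟨0, hd⟩).le
    calc _ ≤ ∑ i, ∑ j, |v i| * |v j| * (√(I.card : ℝ) * ι) := by
          refine (Finset.abs_sum_le_sum_abs _ _).trans (Finset.sum_le_sum fun i _ =>
            (Finset.abs_sum_le_sum_abs _ _).trans (Finset.sum_le_sum fun j _ => ?_))
          rw [abs_mul, abs_mul]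
          exact mul_le_mul_of_nonneg_left (hD i j).le (by positivity)
      _ = (∑ i, |v i|) ^ 2 * (√(I.card : ℝ) * ι) := by
          rw [pow_two, Finset.sum_mul_sum, Finset.sum_mul]
          exact Finset.sum_congr rfl fun i _ => by rw [Finset.sum_mul]
      _ ≤ (d * (v ⬝ᵥ v)) * (√(I.card : ℝ) * ι) :=
          mul_le_mul_of_nonneg_right (sq_sum_abs_le v) hpos
      _ = _ := by ring
  rw [quad_gram]
  have h4 := (abs_le.1 h3).1
  rw [← h2] at h4
  -- By the assumption on $\iota$ the deviation is at most half of the mean.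
  have h5 : d * (√(I.card : ℝ) * ι) * (v ⬝ᵥ v) ≤ I.card * popQuad G φ σ ρ h w v / 2 := by
    have h6 : d * (√(I.card : ℝ) * ι) ≤ I.card * G.coverage ρ σ φ / (2 * L) := by
      rw [le_div_iff₀ (by positivity)]; linarith
    calc _ ≤ I.card * G.coverage ρ σ φ / (2 * L) * (v ⬝ᵥ v) := mul_le_mul_of_nonneg_right h6 hv
      _ = I.card * (G.coverage ρ σ φ / L * (v ⬝ᵥ v)) / 2 := by field_simp
      _ ≤ _ := by
        gcongr
  nlinarith

end Concentration

/-! ### Self-normalized bound for the regression noise -/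

section Noise

open Matrix

variable {H K d : ℕ} {S A B : Type*} [MeasurableSpace S] [MeasurableSpace A] [MeasurableSpace B]
  [Fintype A] [Fintype B] [MeasurableSingletonClass A] [MeasurableSingletonClass B]
  {G : Game H S A B} {φ : S × A × B → Fin d → ℝ} {σ : Policy H S (A × B)} {ρ : Measure S}
  [IsProbabilityMeasure ρ]

/-- The mean of the Gram matrix of `n` transitions. -/
def popGram (G : Game H S A B) (φ : S × A × B → Fin d → ℝ) (σ : Policy H S (A × B))
    (ρ : Measure S) (h : Fin H) (w : S × A × B → ℝ) (lam : ℝ) (n : ℕ) :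
    Matrix (Fin d) (Fin d) ℝ :=
  (n : ℝ) • (Matrix.of fun i j =>
    ∫ t, (w t.1)⁻¹ * (φ t.1 i * φ t.1 j) ∂(transitionLaw G σ ρ h)) + lam • 1

theorem quad_popGram (hG : G.IsLinear φ) {w : S × A × B → ℝ} (hwm : Measurable w)
    (hw : ∀ z, 1 ≤ w z) (h : Fin H) (lam : ℝ) (n : ℕ) (v : Fin d → ℝ) :
    v ⬝ᵥ popGram G φ σ ρ h w lam n *ᵥ v = n * popQuad G φ σ ρ h w v + lam * (v ⬝ᵥ v) := by
  rw [popGram, add_mulVec, smul_mulVec, smul_mulVec, one_mulVec, dotProduct_add, dotProduct_smul,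
    dotProduct_smul, smul_eq_mul, smul_eq_mul, popQuad_eq_sum hG hwm hw]
  congr 2
  simp only [dotProduct, mulVec, Finset.mul_sum, of_apply]
  exact Finset.sum_congr rfl fun i _ => Finset.sum_congr rfl fun j _ => by ring

theorem popQuad_nonneg {w : S × A × B → ℝ} (hw : ∀ z, 1 ≤ w z) (h : Fin H) (v : Fin d → ℝ) :
    0 ≤ popQuad G φ σ ρ h w v :=
  integral_nonneg fun _ => mul_nonneg (inv_weight_mem hw _).1 (sq_nonneg _)

theorem popGram_posDef (hG : G.IsLinear φ) {w : S × A × B → ℝ} (hwm : Measurable w)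
    (hw : ∀ z, 1 ≤ w z) (h : Fin H) {lam : ℝ} (hlam : 0 < lam) (n : ℕ) :
    (popGram G φ σ ρ h w lam n).PosDef := by
  refine .of_dotProduct_mulVec_pos ?_ fun v hv => ?_
  · ext i j
    simp [popGram, one_apply, mul_comm, eq_comm]
  · rw [star_trivial, quad_popGram hG hwm hw]
    have h1 : 0 < v ⬝ᵥ v :=
      lt_of_le_of_ne (dotProduct_self_nonneg' v) fun h0 => hv (dotProduct_self_eq_zero.1 h0.symm)
    have h2 := popQuad_nonneg (G := G) (φ := φ) (σ := σ) (ρ := ρ) hw h v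
    positivity

/-- The noise vector of weighted ridge regression. -/
def noiseVec (φ : S × A × B → Fin d → ℝ) (D : Fin K → Episode H S A B) (I : Finset (Fin K))
    (w : S × A × B → ℝ) (η : Transition S A B → ℝ) (h : Fin H) : Fin d → ℝ :=
  ∑ τ ∈ I, (η (D τ h) / w (D τ h).1) • φ (D τ h).1

/-- Self-normalized concentration of the noise of weighted ridge regression, for noise that is
conditionally centered with conditional variance at most the weight. -/
theorem noise_concentration (hG : G.IsLinear φ) {w : S × A × B → ℝ} (hwm : Measurable w)
    (hw : ∀ z, 1 ≤ w z) {L : ℝ} (hL : ∀ z, w z ≤ L) (hL0 : 0 < L) {lam : ℝ} (hlam : 0 < lam)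
    {ι : ℝ} (h : Fin H) (I : Finset (Fin K)) (hI : 4 ≤ I.card)
    (hι : 2 * L * (d * (√(I.card : ℝ) * ι)) ≤ I.card * G.coverage ρ σ φ)
    {η : Transition S A B → ℝ} (hη : Measurable η) {R : ℝ} (hR : ∀ t, |η t| ≤ R)
    (hRL : R ^ 2 * L ≤ I.card * G.coverage ρ σ φ)
    (hη0 : ∀ z, ∫ x', η (z, x') ∂(G.trans h z) = 0)
    (hη2 : ∀ z, ∫ x', η (z, x') ^ 2 ∂(G.trans h z) ≤ w z) :
    (datasetLaw K G σ ρ).real {D | 2 * (d * ι ^ 2) <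
        noiseVec φ D I w η h ⬝ᵥ (gram φ lam D I w h)⁻¹ *ᵥ noiseVec φ D I w η h} ≤
      4 * d ^ 2 * Real.exp (1 - ι) := by
  have hφ := hG.measurable_feature
  have hn : (4 : ℝ) ≤ I.card := by exact_mod_cast hI
  set κ := G.coverage ρ σ φ with hκdef
  have hpd := popGram_posDef (σ := σ) (ρ := ρ) hG hwm hw h hlam I.card
  obtain ⟨g, hg1, hg2⟩ := exists_whitening hpd
  have hquad := quad_popGram (σ := σ) (ρ := ρ) hG hwm hw h lam I.card
  -- The directions $g_j$ have unit length in the population form, which dominates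
  -- $(n\kappa/L)\,\|\cdot\|^2$, so they are short in Euclidean norm. This bounds the range of the
  -- scalar noise.
  have hgsq : ∀ j, I.card * κ / L * (g j ⬝ᵥ g j) ≤ 1 := fun j => by
    have h1 := hg1 j
    rw [hquad] at h1
    have h2 := popQuad_ge (σ := σ) (ρ := ρ) hG hwm hw hL hL0 h (g j)
    have h3 : I.card * κ / L * (g j ⬝ᵥ g j) = I.card * (κ / L * (g j ⬝ᵥ g j)) := by ring
    rw [h3]
    nlinarith [dotProduct_self_nonneg' (g j)]
  let X : Fin d → Transition S A B → ℝ := fun j t => (φ t.1 ⬝ᵥ g j) * (η t / w t.1)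
  have hdm : ∀ j, Measurable fun t : Transition S A B => φ t.1 ⬝ᵥ g j := fun j => by
    unfold dotProduct; fun_prop
  have hXm : ∀ j, Measurable (X j) := fun j =>
    (hdm j).mul (hη.div (hwm.comp measurable_fst))
  have hηw : ∀ t, |η t / w t.1| ≤ |η t| := fun t => by
    rw [abs_div, abs_of_pos (lt_of_lt_of_le one_pos (hw t.1))]
    exact div_le_self (abs_nonneg _) (hw _)
  have hXb : ∀ j t, |X j t| ≤ 1 := fun j t => by
    rw [← sq_le_one_iff_abs_le_one]
    have h1 := hG.sq_feature_dot_le t.1 (g j)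
    have h2 : (η t / w t.1) ^ 2 ≤ R ^ 2 := sq_le_sq' (by
      linarith [neg_abs_le (η t / w t.1), hηw t, hR t]) (by
      linarith [le_abs_self (η t / w t.1), hηw t, hR t])
    have h3 : (g j ⬝ᵥ g j) * R ^ 2 ≤ 1 := by
      refine le_trans ?_ (hgsq j)
      rw [mul_comm]
      refine mul_le_mul_of_nonneg_right ?_ (dotProduct_self_nonneg' _)
      rw [le_div_iff₀ hL0]
      exact hRL
    simp only [X, mul_pow]
    exact (mul_le_mul h1 h2 (sq_nonneg _) (dotProduct_self_nonneg' _)).trans h3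
  have hX0 : ∀ j, ∫ t, X j t ∂(transitionLaw G σ ρ h) = 0 := fun j => by
    rw [integral_transitionLaw G σ ρ h (hXm j) (hXb j)]
    have : ∀ t : Transition S A B, ∫ x', X j (t.1, x') ∂(G.trans h t.1) = 0 := fun t => by
      simp only [X]
      rw [integral_const_mul, integral_div, hη0]
      simp
    simp [this]
  -- Conditionally on the features, the variance bound $w$ against the factor $w^{-2}$ leaves
  -- $w^{-1}$. So $\mathbb E X_j^2$ is at most the population form at $g_j$, and the normalization
  -- of $g_j$ gives one.
  have hX2 : ∀ j, I.card * ∫ t, X j t ^ 2 ∂(transitionLaw G σ ρ h) ≤ 1 := fun j => by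
    have h1 : ∫ t, X j t ^ 2 ∂(transitionLaw G σ ρ h) ≤ popQuad G φ σ ρ h w (g j) := by
      have hb2 : ∀ t, |X j t ^ 2| ≤ 1 := fun t => by
        rw [abs_pow]; exact pow_le_one₀ (abs_nonneg _) (hXb j t)
      have hm2 : Measurable fun t => X j t ^ 2 := (hXm j).pow_const 2
      rw [integral_transitionLaw G σ ρ h hm2 hb2]
      have hsm : StronglyMeasurable fun z : S × A × B => ∫ x', X j (z, x') ^ 2 ∂(G.trans h z) :=
        hm2.stronglyMeasurable.integral_kernel_prod_right'
      refine integral_mono (Integrable.of_bound (C := 1)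
        (hsm.comp_measurable measurable_fst).aestronglyMeasurable (.of_forall fun t => ?_))
        (integrable_popQuad hG hwm hw h (g j)) fun t => ?_
      · have := norm_integral_le_of_norm_le_const (μ := G.trans h t.1)
          (f := fun x' => X j (t.1, x') ^ 2) (.of_forall fun x' => hb2 (t.1, x'))
        simpa using this
      · simp only [X, mul_pow, div_pow]
        rw [integral_const_mul, integral_div, mul_comm]
        refine mul_le_mul_of_nonneg_right ?_ (sq_nonneg _)
        have hwp := lt_of_lt_of_le one_pos (hw t.1)
        rw [div_le_iff₀ (by positivity), pow_two, inv_mul_cancel_left₀ hwp.ne']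
        exact hη2 t.1
    have h2 := hg1 j
    rw [hquad] at h2
    nlinarith [dotProduct_self_nonneg' (g j)]
  have hbern := fun j => bernstein_transition (G := G) (σ := σ) (ρ := ρ) h I (hXm j) (hXb j)
    (hX0 j) (hX2 j) ι
  -- Where the Gram matrix dominates half of its mean, its inverse form is at most twice
  -- $\sum_j(g_j\cdot s)^2$, a sum of $d$ terms each below $\iota^2$ unless a Bernstein event fails.
  have hsub : {D : Fin K → Episode H S A B | 2 * (d * ι ^ 2) <
        noiseVec φ D I w η h ⬝ᵥ (gram φ lam D I w h)⁻¹ *ᵥ noiseVec φ D I w η h} ⊆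
      (gramGood G φ σ ρ h I w ι)ᶜ ∪ ⋃ j, {D | ι ≤ |∑ τ ∈ I, X j (D τ h)|} := by
    intro D hD
    by_contra hcon
    simp only [Set.mem_union, Set.mem_compl_iff, Set.mem_iUnion, not_or, not_not, not_exists,
      Set.mem_ofPred_eq, not_le] at hcon
    obtain ⟨hgood, hnoise⟩ := hcon
    have hpdZ := gram_posDef φ lam D I w h hlam fun z => zero_le_one.trans (hw z)
    have h1 := inv_quad_le_of_quad_le hpd hpdZ zero_le_two (fun v => by
      have := half_pop_le_quad_gram hG hwm hw hL hL0 hlam h I hι hgood v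
      rw [hquad]
      linarith) (noiseVec φ D I w η h)
    rw [hg2] at h1
    have h2 : ∀ j, (g j ⬝ᵥ noiseVec φ D I w η h) ^ 2 ≤ ι ^ 2 := fun j => by
      have h3 : g j ⬝ᵥ noiseVec φ D I w η h = ∑ τ ∈ I, X j (D τ h) := by
        rw [noiseVec, dotProduct_sum]
        refine Finset.sum_congr rfl fun τ _ => ?_
        rw [dotProduct_smul, smul_eq_mul, dotProduct_comm, mul_comm]
      rw [h3, ← sq_abs]
      exact pow_le_pow_left₀ (abs_nonneg _) (hnoise j).le 2
    have h4 := Finset.sum_le_sum fun j (_ : j ∈ Finset.univ) => h2 j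
    simp only [Finset.sum_const, Finset.card_univ, Fintype.card_fin, nsmul_eq_mul] at h4
    have h5 : 2 * (d * ι ^ 2) < _ := hD
    linarith
  have h1 := (measureReal_mono (μ := datasetLaw K G σ ρ) hsub).trans (measureReal_union_le _ _)
  have h2 := gram_concentration (σ := σ) (ρ := ρ) hG hwm hw h I hI ι
  have h3 := (measureReal_iUnion_fintype_le (μ := datasetLaw K G σ ρ)
    fun j => {D : Fin K → Episode H S A B | ι ≤ |∑ τ ∈ I, X j (D τ h)|}).trans
    (Finset.sum_le_sum fun j _ => hbern j)
  simp only [Finset.sum_const, Finset.card_univ, Fintype.card_fin, nsmul_eq_mul] at h3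
  have h4 : (d : ℝ) ≤ d ^ 2 := by
    exact_mod_cast Nat.le_self_pow two_ne_zero d
  nlinarith [Real.exp_pos (1 - ι)]

end Noise

/-! ### Independence by overwriting some of the episodes -/

section Resampling

theorem MeasurePreserving.pi_prod {ι α : Type*} [Fintype ι] [MeasurableSpace α]
    {P : ι → Measure α} [∀ i, IsProbabilityMeasure (P i)] {m : ι → α × α → α}
    (hm : ∀ i, MeasurePreserving (m i) ((P i).prod (P i)) (P i)) :
    MeasurePreserving (fun (x : (ι → α) × (ι → α)) i => m i (x.1 i, x.2 i))
      ((Measure.pi P).prod (Measure.pi P)) (Measure.pi P) := by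
  have h1 := measurePreserving_arrowProdEquivProdArrow α α ι P P
  have h2 := measurePreserving_pi (fun i => (P i).prod (P i)) P hm
  exact h2.comp (h1.symm _)

variable {E : Type*} [MeasurableSpace E] {K : ℕ}

/-- Overwrite the episodes `I` of the `j`-th dataset. -/
def resample (j : Fin 4) (I : Finset (Fin K)) (D : Fin 4 → Fin K → E) (D' : Fin K → E) :
    Fin 4 → Fin K → E :=
  fun i τ => if i = j ∧ τ ∈ I then D' τ else D i τ

theorem resample_apply_mem {j : Fin 4} {I : Finset (Fin K)} (D : Fin 4 → Fin K → E)
    (D' : Fin K → E) {τ : Fin K} (hτ : τ ∈ I) : resample j I D D' j τ = D' τ := by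
  simp [resample, hτ]

theorem resample_apply_ne {i j : Fin 4} (hij : i ≠ j) (I : Finset (Fin K))
    (D : Fin 4 → Fin K → E) (D' : Fin K → E) : resample j I D D' i = D i := by
  funext τ
  simp [resample, hij]

theorem resample_apply_notMem (j i : Fin 4) {I : Finset (Fin K)} (D : Fin 4 → Fin K → E)
    (D' : Fin K → E) {τ : Fin K} (hτ : τ ∉ I) : resample j I D D' i τ = D i τ := by
  simp [resample, hτ]

variable (P : Measure E) [IsProbabilityMeasure P]

/-- Each coordinate of the result is a coordinate of one of two independent copies of the data, so
the result has the original product law. -/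
theorem measurePreserving_resample (j : Fin 4) (I : Finset (Fin K)) :
    MeasurePreserving
      (fun x : (Fin 4 → Fin K → E) × (Fin 4 → Fin K → E) => resample j I x.1 (x.2 j))
      ((Measure.pi fun _ : Fin 4 => Measure.pi fun _ : Fin K => P).prod
        (Measure.pi fun _ : Fin 4 => Measure.pi fun _ : Fin K => P))
      (Measure.pi fun _ : Fin 4 => Measure.pi fun _ : Fin K => P) := by
  have h0 : ∀ (i : Fin 4) (τ : Fin K),
      MeasurePreserving (fun p : E × E => if i = j ∧ τ ∈ I then p.2 else p.1) (P.prod P) P := by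
    intro i τ
    split_ifs
    · exact measurePreserving_snd
    · exact measurePreserving_fst
  have h1 := MeasurePreserving.pi_prod fun i => MeasurePreserving.pi_prod (h0 i)
  convert h1 using 1
  funext x i τ
  simp only [resample]
  split_ifs with h
  · rw [h.1]
  · rfl

/-- An event has small probability if it does conditionally on all but some of the episodes. -/
theorem measureReal_le_of_resample (j : Fin 4) (I : Finset (Fin K))
    {T : Set (Fin 4 → Fin K → E)} (hT : MeasurableSet T) {ε : ℝ}
    (h : ∀ D, (Measure.pi fun _ : Fin K => P).real {D' | resample j I D D' ∈ T} ≤ ε) :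
    (Measure.pi fun _ : Fin 4 => Measure.pi fun _ : Fin K => P).real T ≤ ε := by
  set μ := Measure.pi fun _ : Fin 4 => Measure.pi fun _ : Fin K => P with hμ
  have hmp := measurePreserving_resample P j I
  have hε : 0 ≤ ε := by
    obtain ⟨D⟩ := nonempty_of_isProbabilityMeasure μ
    exact measureReal_nonneg.trans (h D)
  have hT' := hmp.measurable hT
  refine ENNReal.toReal_le_of_le_ofReal hε ?_
  -- Fubini: the data before overwriting are frozen, and only the fresh episodes are random.
  rw [← hmp.measure_preimage hT.nullMeasurableSet, Measure.prod_apply hT']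
  calc _ ≤ ∫⁻ _ : Fin 4 → Fin K → E, ENNReal.ofReal ε ∂μ := lintegral_mono fun D => ?_
    _ = ENNReal.ofReal ε := by simp
  have hev : MeasurePreserving (fun x : Fin 4 → Fin K → E => x j) μ
      (Measure.pi fun _ : Fin K => P) := measurePreserving_eval _ j
  have hms : MeasurableSet {D' | resample j I D D' ∈ T} := by
    have : Measurable fun D' : Fin K → E => resample j I D D' := by
      refine measurable_pi_lambda _ fun i => measurable_pi_lambda _ fun τ => ?_
      unfold resample
      split_ifs
      · exact measurable_pi_apply τ
      · exact measurable_const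
    exact this hT
  have h2 : μ (Prod.mk D ⁻¹' ((fun x : (Fin 4 → Fin K → E) × (Fin 4 → Fin K → E) =>
      resample j I x.1 (x.2 j)) ⁻¹' T)) =
      (Measure.pi fun _ : Fin K => P) {D' | resample j I D D' ∈ T} :=
    hev.measure_preimage hms.nullMeasurableSet
  rw [h2, ← ofReal_measureReal]
  exact ENNReal.ofReal_le_ofReal (h D)

theorem measureReal_eval_le (j : Fin 4) (T : Set (Fin K → E)) :
    (Measure.pi fun _ : Fin 4 => Measure.pi fun _ : Fin K => P).real {D | D j ∈ T} ≤
      (Measure.pi fun _ : Fin K => P).real T := by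
  have hev : MeasurePreserving (fun x : Fin 4 → Fin K → E => x j)
      (Measure.pi fun _ : Fin 4 => Measure.pi fun _ : Fin K => P)
      (Measure.pi fun _ : Fin K => P) := measurePreserving_eval _ j
  refine ENNReal.toReal_mono (measure_ne_top _ _) ?_
  rw [← measure_toMeasurable (μ := Measure.pi fun _ : Fin K => P) T,
    ← hev.measure_preimage (measurableSet_toMeasurable _ _).nullMeasurableSet]
  exact measure_mono fun D hD => subset_toMeasurable _ _ hD

end Resampling

/-! ### Measurability of the estimators in the data -/

section Measurability

open Matrix

variable {H K d : ℕ} {S A B Θ : Type*} [MeasurableSpace S] [MeasurableSpace A]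
  [MeasurableSpace B] [MeasurableSpace Θ]

/-- The inverse is the adjugate over the determinant, a formula that also holds for singular
matrices, where both sides are zero. -/
theorem measurable_matrix_inv {M : Θ → Matrix (Fin d) (Fin d) ℝ}
    (hM : ∀ i j, Measurable fun θ => M θ i j) (i j : Fin d) : Measurable fun θ => (M θ)⁻¹ i j := by
  have hdet : Measurable fun N : Fin d → Fin d → ℝ => (Matrix.of N).det := by
    refine Continuous.measurable (Continuous.matrix_det ?_)
    exact continuous_id
  have hadj : Measurable fun N : Fin d → Fin d → ℝ => (Matrix.of N).adjugate i j := by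
    refine Continuous.measurable (Continuous.matrix_elem (Continuous.matrix_adjugate ?_) i j)
    exact continuous_id
  have hM' : Measurable fun θ => (fun i j => M θ i j : Fin d → Fin d → ℝ) :=
    measurable_pi_lambda _ fun i => measurable_pi_lambda _ fun j => hM i j
  have : ∀ θ, (M θ)⁻¹ i j = ((M θ).det)⁻¹ * (M θ).adjugate i j := fun θ => by
    rw [Matrix.inv_def, Ring.inverse_eq_inv']; rfl
  simp only [this]
  exact (hdet.comp hM').inv.mul (hadj.comp hM')

theorem measurable_dotProduct {u v : Θ → Fin d → ℝ} (hu : Measurable u) (hv : Measurable v) :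
    Measurable fun θ => u θ ⬝ᵥ v θ := by
  unfold dotProduct
  fun_prop

theorem measurable_mulVec {M : Θ → Matrix (Fin d) (Fin d) ℝ} {v : Θ → Fin d → ℝ}
    (hM : ∀ i j, Measurable fun θ => M θ i j) (hv : Measurable v) :
    Measurable fun θ => M θ *ᵥ v θ := by
  refine measurable_pi_lambda _ fun i => ?_
  unfold mulVec dotProduct
  exact Finset.measurable_sum _ fun j _ => (hM i j).mul (by fun_prop)

theorem measurable_wnorm {M : Θ → Matrix (Fin d) (Fin d) ℝ} {v : Θ → Fin d → ℝ}
    (hM : ∀ i j, Measurable fun θ => M θ i j) (hv : Measurable v) :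
    Measurable fun θ => wnorm (M θ) (v θ) :=
  (measurable_dotProduct hv (measurable_mulVec hM hv)).sqrt

theorem measurable_clip {f : Θ → ℝ} (hf : Measurable f) (M : ℝ) :
    Measurable fun θ => clip M (f θ) := by
  unfold clip
  fun_prop

variable {φ : S × A × B → Fin d → ℝ} {lam : ℝ} {D : Θ → Fin K → Episode H S A B}
  {w : Θ → S × A × B → ℝ} {y : Θ → Transition S A B → ℝ}

theorem measurable_transition (hD : Measurable D) (h : Fin H) (τ : Fin K) :
    Measurable fun θ => D θ τ h :=
  (measurable_pi_apply h).comp ((measurable_pi_apply τ).comp hD)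

theorem measurable_gram (hφ : Measurable φ) (hD : Measurable D) (I : Finset (Fin K)) (h : Fin H)
    (hw : Measurable fun p : Θ × (S × A × B) => w p.1 p.2) (i j : Fin d) :
    Measurable fun θ => gram φ lam (D θ) I (w θ) h i j := by
  have hDτ := measurable_transition hD h
  have hwτ : ∀ τ, Measurable fun θ => w θ (D θ τ h).1 := fun τ =>
    hw.comp (measurable_id.prodMk (hDτ τ).fst)
  simp only [gram, Matrix.add_apply, Matrix.sum_apply, Matrix.smul_apply, vecMulVec_apply,
    smul_eq_mul]
  refine Measurable.add_const (Finset.measurable_sum _ fun τ _ => (hwτ τ).inv.mul ?_) _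
  have : Measurable fun θ => φ (D θ τ h).1 := hφ.comp (hDτ τ).fst
  fun_prop

theorem measurable_noiseVec (hφ : Measurable φ) (hD : Measurable D) (I : Finset (Fin K))
    (h : Fin H) (hw : Measurable fun p : Θ × (S × A × B) => w p.1 p.2)
    (hy : Measurable fun p : Θ × Transition S A B => y p.1 p.2) :
    Measurable fun θ => noiseVec φ (D θ) I (w θ) (y θ) h := by
  have hDτ := measurable_transition hD h
  have hwτ : ∀ τ, Measurable fun θ => w θ (D θ τ h).1 := fun τ =>
    hw.comp (measurable_id.prodMk (hDτ τ).fst)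
  have hyτ : ∀ τ, Measurable fun θ => y θ (D θ τ h) := fun τ =>
    hy.comp (measurable_id.prodMk (hDτ τ))
  unfold noiseVec
  refine Finset.measurable_sum _ fun τ _ => ((hyτ τ).div (hwτ τ)).smul ?_
  exact hφ.comp (hDτ τ).fst

theorem measurable_ridge (hφ : Measurable φ) (hD : Measurable D) (I : Finset (Fin K))
    (h : Fin H) (hw : Measurable fun p : Θ × (S × A × B) => w p.1 p.2)
    (hy : Measurable fun p : Θ × Transition S A B => y p.1 p.2) :
    Measurable fun θ => ridge φ lam (D θ) I (w θ) (y θ) h :=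
  measurable_mulVec (measurable_matrix_inv (measurable_gram hφ hD I h hw))
    (measurable_noiseVec hφ hD I h hw hy)

variable {V Vref : Θ → S → ℝ}

theorem measurable_varEst (hφ : Measurable φ) (hD : Measurable D) (h : Fin H)
    (hV : Measurable fun p : Θ × S => V p.1 p.2) :
    Measurable fun p : Θ × (S × A × B) => varEst φ lam (D p.1) (V p.1) h p.2 := by
  have h1 : ∀ k : ℕ, Measurable fun θ => ridge φ lam (D θ) Finset.univ (fun _ => 1)
      (fun t => V θ t.2 ^ k) h := fun k =>
    measurable_ridge hφ hD _ h measurable_const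
      ((hV.comp (measurable_fst.prodMk measurable_snd.snd)).pow_const k)
  have h2 := h1 1
  simp only [pow_one] at h2
  have h3 := fun {u : Θ → Fin d → ℝ} (hu : Measurable u) =>
    measurable_dotProduct (hφ.comp (measurable_snd (α := Θ))) (hu.comp measurable_fst)
  exact measurable_const.max ((measurable_clip (h3 (h1 2)) _).sub
    ((measurable_clip (h3 h2) _).pow_const 2))

variable [MeasurableSingletonClass A] [MeasurableSingletonClass B]

theorem measurable_spmviQ {r : Fin H → S × A × B → ℝ} (hr : ∀ h, Measurable (r h))
    (hφ : Measurable φ) (hD : Measurable D) (β s : ℝ) (h : Fin H)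
    (hV : Measurable fun p : Θ × S => V p.1 p.2) (a : A) (b : B) :
    Measurable fun p : Θ × S => spmviQ r φ lam β (D p.1) s h (V p.1) p.2 a b := by
  have hφ' : Measurable fun p : Θ × S => φ (p.2, a, b) := hφ.comp (by fun_prop)
  have h1 : Measurable fun θ => ridge φ lam (D θ) (fold H K h) (fun _ => 1)
      (fun t => r h t.1 + V θ t.2) h :=
    measurable_ridge hφ hD _ h measurable_const
      (((hr h).comp measurable_snd.fst).add (hV.comp (measurable_fst.prodMk measurable_snd.snd)))
  have h2 := measurable_matrix_inv (measurable_gram (lam := lam) hφ hD (fold H K h) h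
    (w := fun _ _ => 1) measurable_const)
  exact measurable_clip ((measurable_dotProduct hφ' (h1.comp measurable_fst)).add
    (((measurable_wnorm (fun i j => (h2 i j).comp measurable_fst) hφ').const_mul β).const_mul s)) _

theorem measurable_spmviPlusQ {r : Fin H → S × A × B → ℝ} (hr : ∀ h, Measurable (r h))
    {D₀ D₀' D₁ : Θ → Fin K → Episode H S A B}
    (hφ : Measurable φ) (hD₀ : Measurable D₀) (hD₀' : Measurable D₀') (hD₁ : Measurable D₁)
    (κ γ b₁ s : ℝ) (h : Fin H) (hVref : Measurable fun p : Θ × S => Vref p.1 p.2)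
    (hV : Measurable fun p : Θ × S => V p.1 p.2) (a : A) (b : B) :
    Measurable fun p : Θ × S => spmviPlusQ r φ lam κ γ b₁ (D₀ p.1) (D₀' p.1) (D₁ p.1) s h
      (Vref p.1) (V p.1) p.2 a b := by
  have hφ' : Measurable fun p : Θ × S => φ (p.2, a, b) := hφ.comp (by fun_prop)
  have hw := measurable_varEst (lam := lam) hφ hD₀' h hVref
  have hsnd : Measurable fun p : Θ × Transition S A B => (p.1, p.2.2) := by fun_prop
  have h1 : Measurable fun θ => ridge φ lam (D₀ θ) Finset.univ (varEst φ lam (D₀' θ) (Vref θ) h)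
      (fun t => r h t.1 + Vref θ t.2) h :=
    measurable_ridge hφ hD₀ _ h hw (((hr h).comp measurable_snd.fst).add (hVref.comp hsnd))
  have h2 : Measurable fun θ => ridge φ lam (D₁ θ) (fold H K h) (fun _ => 1)
      (fun t => V θ t.2 - Vref θ t.2) h :=
    measurable_ridge hφ hD₁ _ h measurable_const ((hV.comp hsnd).sub (hVref.comp hsnd))
  have h3 := measurable_matrix_inv (measurable_gram (lam := lam) hφ hD₀ Finset.univ h
    (w := fun θ => varEst φ lam (D₀' θ) (Vref θ) h) hw)
  exact ((measurable_dotProduct hφ' (h1.comp measurable_fst)).add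
    (measurable_dotProduct hφ' (h2.comp measurable_fst))).add
    (((((measurable_wnorm (fun i j => (h3 i j).comp measurable_fst) hφ').const_mul γ).add_const
      _).add_const b₁).const_mul s)

end Measurability

/-! ### Size and disjointness of the folds -/

section Fold

theorem mem_fold {H K : ℕ} {h : Fin H} {τ : Fin K} :
    τ ∈ fold H K h ↔ (h : ℕ) * (K / H) ≤ τ ∧ (τ : ℕ) < (h + 1) * (K / H) := by
  simp [fold]

theorem card_fold {H K : ℕ} (h : Fin H) : (fold H K h).card = K / H := by
  have hle : ((h : ℕ) + 1) * (K / H) ≤ K :=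
    (Nat.mul_le_mul_right _ h.2).trans (Nat.mul_div_le K H)
  have h1 : (fold H K h).map Fin.valEmbedding =
      Finset.Ico ((h : ℕ) * (K / H)) ((h + 1) * (K / H)) := by
    ext n
    simp only [Finset.mem_map, mem_fold, Fin.valEmbedding_apply, Finset.mem_Ico]
    constructor
    · rintro ⟨τ, hτ, rfl⟩
      exact hτ
    · intro hn
      exact ⟨⟨n, by omega⟩, hn, rfl⟩
  rw [← Finset.card_map Fin.valEmbedding, h1, Nat.card_Ico, Nat.succ_mul, Nat.add_sub_cancel_left]

theorem notMem_fold_of_lt {H K : ℕ} {h h' : Fin H} (hlt : h < h') {τ : Fin K}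
    (hτ : τ ∈ fold H K h') : τ ∉ fold H K h := by
  rw [mem_fold] at hτ ⊢
  have : ((h : ℕ) + 1) * (K / H) ≤ h' * (K / H) := Nat.mul_le_mul_right _ hlt
  omega

end Fold

/-! ### Estimators depend only on the episodes of their own fold -/

section Locality

variable {H K d : ℕ} {S A B : Type*} {φ : S × A × B → Fin d → ℝ} {lam : ℝ}
  {D D' : Fin K → Episode H S A B} {I : Finset (Fin K)}

theorem gram_congr (hD : ∀ τ ∈ I, D τ = D' τ) (w : S × A × B → ℝ) (h : Fin H) :
    gram φ lam D I w h = gram φ lam D' I w h := by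
  unfold gram
  congr 1
  exact Finset.sum_congr rfl fun τ hτ => by rw [hD τ hτ]

theorem ridge_congr (hD : ∀ τ ∈ I, D τ = D' τ) (w : S × A × B → ℝ) (y : Transition S A B → ℝ)
    (h : Fin H) : ridge φ lam D I w y h = ridge φ lam D' I w y h := by
  unfold ridge
  rw [gram_congr hD]
  congr 1
  exact Finset.sum_congr rfl fun τ hτ => by rw [hD τ hτ]

theorem spmviQ_congr {h : Fin H} (hD : ∀ τ ∈ fold H K h, D τ = D' τ)
    (r : Fin H → S × A × B → ℝ) (β s : ℝ) :
    spmviQ r φ lam β D s h = spmviQ r φ lam β D' s h := by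
  funext V x a b
  unfold spmviQ
  rw [gram_congr hD, ridge_congr hD]

theorem spmviPlusQ_congr {h : Fin H} (hD : ∀ τ ∈ fold H K h, D τ = D' τ)
    (r : Fin H → S × A × B → ℝ) (κ γ b₁ s : ℝ) (D₀ D₀' : Fin K → Episode H S A B) :
    spmviPlusQ r φ lam κ γ b₁ D₀ D₀' D s h = spmviPlusQ r φ lam κ γ b₁ D₀ D₀' D' s h := by
  funext Vref V x a b
  unfold spmviPlusQ
  rw [ridge_congr hD]

end Locality

/-! ### Noise events for regressions with data-dependent targets -/

section NoiseEvent

open Matrix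

variable {H K d : ℕ} {S A B : Type*} [MeasurableSpace S] [MeasurableSpace A] [MeasurableSpace B]
  [Fintype A] [Fintype B] [MeasurableSingletonClass A] [MeasurableSingletonClass B]
  {G : Game H S A B} {φ : S × A × B → Fin d → ℝ} {σ : Policy H S (A × B)} {ρ : Measure S}
  [IsProbabilityMeasure ρ]

/-- The scaled fluctuation `(V(x') - P_h V(x, a, b)) / c`. -/
def condNoise (G : Game H S A B) (h : Fin H) (V : S → ℝ) (c : ℝ) (t : Transition S A B) : ℝ :=
  (V t.2 - ∫ x', V x' ∂(G.trans h t.1)) / c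

theorem integral_condNoise {V : S → ℝ} (hV : Measurable V) {C : ℝ} (hC : ∀ x, |V x| ≤ C)
    (h : Fin H) (c : ℝ) (z : S × A × B) :
    ∫ x', condNoise G h V c (z, x') ∂(G.trans h z) = 0 := by
  simp only [condNoise]
  rw [integral_div, integral_sub (integrable_trans G hV hC h z) (integrable_const _)]
  simp

theorem integral_condNoise_sq {V : S → ℝ} (hV : Measurable V) {C : ℝ} (hC : ∀ x, |V x| ≤ C)
    (h : Fin H) (c : ℝ) (z : S × A × B) :
    ∫ x', condNoise G h V c (z, x') ^ 2 ∂(G.trans h z) = G.condVar h V z / c ^ 2 := by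
  simp only [condNoise, div_pow]
  rw [integral_div]
  congr 1
  set m := ∫ x', V x' ∂(G.trans h z) with hm
  have h1 : ∀ x', (V x' - m) ^ 2 = V x' ^ 2 - 2 * m * V x' + m ^ 2 := fun x' => by ring
  simp only [h1]
  have hi := integrable_trans G hV hC h z
  have hi2 : Integrable (fun x' => V x' ^ 2) (G.trans h z) :=
    integrable_trans G (hV.pow_const 2) (C := C ^ 2) (fun x => by
      rw [abs_pow]; exact pow_le_pow_left₀ (abs_nonneg _) (hC x) 2) h z
  rw [integral_add (f := fun x' => V x' ^ 2 - 2 * m * V x') (hi2.sub (hi.const_mul _))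
    (integrable_const _), integral_sub hi2 (hi.const_mul _), integral_const_mul, ← hm]
  simp only [integral_const, probReal_univ, smul_eq_mul, Game.condVar, ← hm]
  ring

variable (K) in
/-- The four datasets. -/
abbrev Data (H : ℕ) (S A B : Type*) := Fin 4 → Fin K → Episode H S A B

variable (G σ ρ K) in
/-- The law of the four datasets. -/
abbrev dataLaw : Measure (Data K H S A B) := Measure.pi fun _ : Fin 4 => datasetLaw K G σ ρ

theorem measurable_integral_trans {Θ : Type*} [MeasurableSpace Θ] {V : Θ → S → ℝ}
    (hV : Measurable fun p : Θ × S => V p.1 p.2) (h : Fin H) :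
    Measurable fun p : Θ × (S × A × B) => ∫ x', V p.1 x' ∂(G.trans h p.2) := by
  have : StronglyMeasurable fun q : (Θ × (S × A × B)) × S => V q.1.1 q.2 :=
    (hV.comp (by fun_prop : Measurable fun q : (Θ × (S × A × B)) × S =>
      (q.1.1, q.2))).stronglyMeasurable
  exact (this.integral_kernel_prod_right' (κ := (G.trans h).prodMkLeft Θ)).measurable

/-- The event that the noise of the regression of `V(x')` on the episodes `I` of dataset `j`,
scaled by `c`, is large. -/
def noiseBad (G : Game H S A B) (φ : S × A × B → Fin d → ℝ) (lam ι : ℝ) (j : Fin 4)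
    (I : Finset (Fin K)) (h : Fin H) (w : Data K H S A B → S × A × B → ℝ)
    (V : Data K H S A B → S → ℝ) (c : ℝ) : Set (Data K H S A B) :=
  {D | 2 * (d * ι ^ 2) < noiseVec φ (D j) I (w D) (condNoise G h (V D) c) h ⬝ᵥ
    (gram φ lam (D j) I (w D) h)⁻¹ *ᵥ noiseVec φ (D j) I (w D) (condNoise G h (V D) c) h}

/-- The noise is small with high probability if the weight and the regressed function do not depend
on the episodes used for the regression. -/
theorem noiseBad_le (hG : G.IsLinear φ) {lam : ℝ} (hlam : 0 < lam) {ι : ℝ} (j : Fin 4)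
    (I : Finset (Fin K)) (h : Fin H) {w : Data K H S A B → S × A × B → ℝ}
    (hwm : Measurable fun p : Data K H S A B × (S × A × B) => w p.1 p.2)
    (hw : ∀ D z, 1 ≤ w D z) {L : ℝ} (hL : ∀ D z, w D z ≤ L) (hL0 : 0 < L)
    (hI : 4 ≤ I.card) (hι : 2 * L * (d * (√(I.card : ℝ) * ι)) ≤ I.card * G.coverage ρ σ φ)
    {V : Data K H S A B → S → ℝ} (hV : Measurable fun p : Data K H S A B × S => V p.1 p.2)
    {C : ℝ} (hC : ∀ D x, |V D x| ≤ C) {c R : ℝ} (hc : 0 < c)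
    (hR : ∀ D z x, |V D x - ∫ x', V D x' ∂(G.trans h z)| ≤ c * R)
    (hRL : R ^ 2 * L ≤ I.card * G.coverage ρ σ φ)
    (hvar : ∀ D z, G.condVar h (V D) z ≤ c ^ 2 * w D z)
    (hwloc : ∀ D D', w (resample j I D D') = w D) (hVloc : ∀ D D', V (resample j I D D') = V D) :
    (dataLaw K G σ ρ).real (noiseBad G φ lam ι j I h w V c) ≤ 4 * d ^ 2 * Real.exp (1 - ι) := by
  have hφ := hG.measurable_feature
  have hDj : Measurable fun D : Data K H S A B => D j := measurable_pi_apply j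
  have hηm : Measurable fun p : Data K H S A B × Transition S A B =>
      condNoise G h (V p.1) c p.2 := by
    have h1 : Measurable fun p : Data K H S A B × Transition S A B =>
        ∫ x', V p.1 x' ∂(G.trans h p.2.1) :=
      (measurable_integral_trans hV h).comp
        (by fun_prop : Measurable fun p : Data K H S A B × Transition S A B => (p.1, p.2.1))
    have h2 : Measurable fun p : Data K H S A B × Transition S A B => V p.1 p.2.2 :=
      hV.comp (by fun_prop : Measurable fun p : Data K H S A B × Transition S A B => (p.1, p.2.2))
    exact (h2.sub h1).div_const c
  have hnm := measurable_noiseVec hφ hDj I h hwm (y := fun D => condNoise G h (V D) c) hηm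
  have hgm := measurable_matrix_inv (measurable_gram (lam := lam) hφ hDj I h hwm)
  refine measureReal_le_of_resample _ j I
    (measurableSet_lt measurable_const (measurable_dotProduct hnm (measurable_mulVec hgm hnm)))
    fun D => ?_
  have hVm : Measurable (V D) := hV.comp measurable_prodMk_left
  refine le_trans (le_of_eq ?_) (noise_concentration (σ := σ) (ρ := ρ) hG (w := w D)
    (hwm.comp measurable_prodMk_left) (hw D) (hL D) hL0 hlam (ι := ι) h I hI hι
    (η := condNoise G h (V D) c) (hηm.comp measurable_prodMk_left) (R := R) (fun t => ?_) hRL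
    (integral_condNoise hVm (hC D) h c) (fun z => ?_))
  · congr 1
    ext D'
    -- The weight and the regressed function are unaffected by the overwriting, so the event becomes
    -- one about fresh i.i.d. episodes with a deterministic target.
    have hres : ∀ τ ∈ I, resample j I D D' j τ = D' τ := fun τ hτ => resample_apply_mem D D' hτ
    have hnv : noiseVec φ (resample j I D D' j) I (w D) (condNoise G h (V D) c) h =
        noiseVec φ D' I (w D) (condNoise G h (V D) c) h :=
      Finset.sum_congr rfl fun τ hτ => by rw [hres τ hτ]
    simp only [Set.mem_ofPred_eq, hwloc, hVloc, hnv, gram_congr hres]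
  · rw [condNoise, abs_div, abs_of_pos hc, div_le_iff₀ hc, mul_comm]
    exact hR D _ _
  · rw [integral_condNoise_sq hVm (hC D), div_le_iff₀ (by positivity), mul_comm]
    exact hvar D z

theorem gramBad_le (hG : G.IsLinear φ) (j : Fin 4) (h : Fin H) (I : Finset (Fin K))
    (hI : 4 ≤ I.card) (ι : ℝ) :
    (dataLaw K G σ ρ).real {D | D j ∈ (gramGood G φ σ ρ h I (fun _ => 1) ι)ᶜ} ≤
      2 * d ^ 2 * Real.exp (1 - ι) :=
  (measureReal_eval_le _ j _).trans
    (gram_concentration hG measurable_const (fun _ => le_rfl) h I hI ι)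

end NoiseEvent

/-! ### The bad events and their probabilities -/

section Events

open Matrix

variable {H K d : ℕ} {S A B : Type*} [MeasurableSpace S] [MeasurableSpace A] [MeasurableSpace B]
  [Fintype A] [Fintype B]

section Defs

variable (G : Game H S A B) (φ : S × A × B → Fin d → ℝ) (lam β κ γ b₁ ε : ℝ)

/-- The value estimates of SPMVI on the reference dataset. -/
def refValue (s : ℝ) (D : Data K H S A B) : Fin (H + 1) → S → ℝ :=
  sweepValue (spmviQ G.reward φ lam β (D 0) s)

/-- The value estimates of SPMVI+. -/
def plusValue (s : ℝ) (D : Data K H S A B) : Fin (H + 1) → S → ℝ :=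
  sweepValue fun h V => spmviPlusQ G.reward φ lam κ γ b₁ (D 1) (D 2) (D 3) s h
    (refValue G φ lam β s D h.succ) V

/-- The estimated variance, kept above half of the variance of the reference value. -/
def refWeight (s : ℝ) (h : Fin H) (D : Data K H S A B) (z : S × A × B) : ℝ :=
  max (varEst φ lam (D 2) (refValue G φ lam β s D h.succ) h z)
    (G.truncVar h (refValue G φ lam β s D h.succ) z / 2)

/-- The difference of the two value estimates, truncated to `[-ε, ε]`. -/
def advantage (s : ℝ) (h : Fin H) (D : Data K H S A B) (x : S) : ℝ :=
  max (-ε) (min ε (plusValue G φ lam β κ γ b₁ s D h.succ x - refValue G φ lam β s D h.succ x))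

/-- The bad events at step `h` for the sign `s`. -/
def stepNoiseBad (ι s : ℝ) (h : Fin H) (D : Data K H S A B) : Prop :=
  D ∈ noiseBad G φ lam ι 0 (fold H K h) h (fun _ _ => 1)
    (fun D => refValue G φ lam β s D h.succ) H ∨
  D ∈ noiseBad G φ lam ι 2 Finset.univ h (fun _ _ => 1)
    (fun D => refValue G φ lam β s D h.succ) H ∨
  D ∈ noiseBad G φ lam ι 2 Finset.univ h (fun _ _ => 1)
    (fun D x => refValue G φ lam β s D h.succ x ^ 2) (H ^ 2) ∨
  D ∈ noiseBad G φ lam ι 1 Finset.univ h (refWeight G φ lam β s h)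
    (fun D => refValue G φ lam β s D h.succ) √2 ∨
  D ∈ noiseBad G φ lam ι 3 (fold H K h) h (fun _ _ => 1)
    (advantage G φ lam β κ γ b₁ ε s h) (2 * ε)

/-- The bad events for the Gram matrices at step `h`. -/
def stepGramBad (σ : Policy H S (A × B)) (ρ : Measure S) (ι : ℝ) (h : Fin H)
    (D : Data K H S A B) : Prop :=
  D 0 ∈ (gramGood G φ σ ρ h (fold H K h) (fun _ => 1) ι)ᶜ ∨
  D 1 ∈ (gramGood G φ σ ρ h Finset.univ (fun _ => 1) ι)ᶜ ∨
  D 2 ∈ (gramGood G φ σ ρ h Finset.univ (fun _ => 1) ι)ᶜ ∨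
  D 3 ∈ (gramGood G φ σ ρ h (fold H K h) (fun _ => 1) ι)ᶜ

end Defs

variable {G : Game H S A B} {φ : S × A × B → Fin d → ℝ} {σ : Policy H S (A × B)} {ρ : Measure S}
  {lam β κ γ b₁ ε : ℝ} [MeasurableSingletonClass A] [MeasurableSingletonClass B]

theorem clip_mem_Icc {M : ℝ} (hM : 0 ≤ M) (y : ℝ) : clip M y ∈ Set.Icc 0 M :=
  ⟨le_max_left _ _, max_le hM (min_le_left _ _)⟩

theorem refValue_mem [Nonempty A] [Nonempty B] (s : ℝ) (D : Data K H S A B) (k : Fin (H + 1))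
    (x : S) : refValue G φ lam β s D k x ∈ Set.Icc (0 : ℝ) ((H : ℝ) - k) :=
  sweepValue_mem_Icc (fun h _ _ _ _ => clip_mem_Icc (by
    have : ((h : ℕ) : ℝ) ≤ H := by exact_mod_cast h.2.le
    linarith) _) k x

theorem refValue_mem_horizon [Nonempty A] [Nonempty B] (s : ℝ) (D : Data K H S A B)
    (k : Fin (H + 1)) (x : S) : refValue G φ lam β s D k x ∈ Set.Icc (0 : ℝ) H :=
  Set.Icc_subset_Icc_right (by simp) (refValue_mem s D k x)

theorem abs_max_min_le {ε : ℝ} (hε : 0 ≤ ε) (y : ℝ) : |max (-ε) (min ε y)| ≤ ε :=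
  abs_le.2 ⟨le_max_left _ _, max_le (by linarith) (min_le_left _ _)⟩

theorem integral_mem_Icc {V : S → ℝ} (hV : Measurable V) {m M : ℝ}
    (hm : ∀ x, V x ∈ Set.Icc m M) (h : Fin H) (z : S × A × B) :
    ∫ x', V x' ∂(G.trans h z) ∈ Set.Icc m M := by
  have hi := integrable_trans G hV (C := max |m| |M|)
    (fun x => abs_le_max_abs_abs (hm x).1 (hm x).2) h z
  have h1 := integral_mono (integrable_const m) hi fun x => (hm x).1
  have h2 := integral_mono hi (integrable_const M) fun x => (hm x).2
  simp only [integral_const, probReal_univ, smul_eq_mul, one_mul] at h1 h2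
  exact ⟨h1, h2⟩

theorem abs_sub_integral_le {V : S → ℝ} (hV : Measurable V) {m M : ℝ}
    (hm : ∀ x, V x ∈ Set.Icc m M) (h : Fin H) (z : S × A × B) (x : S) :
    |V x - ∫ x', V x' ∂(G.trans h z)| ≤ M - m := by
  have h1 := integral_mem_Icc (G := G) hV hm h z
  have h2 := hm x
  rw [abs_le]
  constructor <;> linarith [h1.1, h1.2, h2.1, h2.2]

theorem condVar_le_sq {V : S → ℝ} (hV : Measurable V) {m M : ℝ}
    (hm : ∀ x, V x ∈ Set.Icc m M) (h : Fin H) (z : S × A × B) :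
    G.condVar h V z ≤ (M - m) ^ 2 := by
  have h1 := integral_condNoise_sq (G := G) hV (C := max |m| |M|)
    (fun x => abs_le_max_abs_abs (hm x).1 (hm x).2) h 1 z
  rw [one_pow, div_one] at h1
  rw [← h1]
  have h2 := norm_integral_le_of_norm_le_const (μ := G.trans h z)
    (f := fun x' => condNoise G h V 1 (z, x') ^ 2) (C := (M - m) ^ 2) (.of_forall fun x' => by
      rw [norm_pow, condNoise, div_one]
      exact pow_le_pow_left₀ (norm_nonneg _) (abs_sub_integral_le hV hm h z x') 2)
  simp only [probReal_univ, mul_one] at h2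
  exact (le_abs_self _).trans h2

theorem varEst_mem (hH : 1 ≤ H) (D : Fin K → Episode H S A B) (V : S → ℝ) (h : Fin H)
    (z : S × A × B) : varEst φ lam D V h z ∈ Set.Icc (1 : ℝ) (H ^ 2) := by
  have hH' : (1 : ℝ) ≤ H := by exact_mod_cast hH
  refine ⟨le_max_left _ _, max_le (one_le_pow₀ hH') ?_⟩
  have := (clip_mem_Icc (sq_nonneg (H : ℝ))
    (φ z ⬝ᵥ ridge φ lam D Finset.univ (fun _ => 1) (fun t => V t.2 ^ 2) h)).2
  linarith [sq_nonneg (clip (H : ℝ)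
    (φ z ⬝ᵥ ridge φ lam D Finset.univ (fun _ => 1) (fun t => V t.2) h))]

variable [IsProbabilityMeasure ρ] [Nonempty A] [Nonempty B]

theorem measurable_section {Θ : Type*} [MeasurableSpace Θ] {f : Θ → S → ℝ}
    (hf : Measurable fun p : Θ × S => f p.1 p.2) (θ : Θ) : Measurable (f θ) :=
  hf.comp measurable_prodMk_left

theorem measurable_refValue (hφ : Measurable φ) (s : ℝ) (k : Fin (H + 1)) :
    Measurable fun p : Data K H S A B × S => refValue G φ lam β s p.1 k p.2 :=
  measurable_sweepValue (fun D : Data K H S A B => spmviQ G.reward φ lam β (D 0) s)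
    (fun _ h a b hV => measurable_spmviQ (D := fun D : Data K H S A B => D 0)
      G.measurable_reward hφ (measurable_pi_apply 0) β s h hV a b) k

theorem measurable_plusValue (hφ : Measurable φ) (s : ℝ) (k : Fin (H + 1)) :
    Measurable fun p : Data K H S A B × S => plusValue G φ lam β κ γ b₁ s p.1 k p.2 :=
  measurable_sweepValue (fun (D : Data K H S A B) h V => spmviPlusQ G.reward φ lam κ γ b₁
      (D 1) (D 2) (D 3) s h (refValue G φ lam β s D h.succ) V)
    (fun _ h a b hV => measurable_spmviPlusQ (D₀ := fun D : Data K H S A B => D 1)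
      (D₀' := fun D => D 2) (D₁ := fun D => D 3)
      (Vref := fun D => refValue G φ lam β s D h.succ)
      G.measurable_reward hφ (measurable_pi_apply 1) (measurable_pi_apply 2)
      (measurable_pi_apply 3) κ γ b₁ s h (measurable_refValue hφ s h.succ) hV a b) k

theorem measurable_truncVar {Θ : Type*} [MeasurableSpace Θ] {V : Θ → S → ℝ}
    (hV : Measurable fun p : Θ × S => V p.1 p.2) (h : Fin H) :
    Measurable fun p : Θ × (S × A × B) => G.truncVar h (V p.1) p.2 := by
  have h1 := measurable_integral_trans (G := G) hV h
  have h2 := measurable_integral_trans (G := G) (V := fun θ x => V θ x ^ 2) (hV.pow_const 2) h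
  exact measurable_const.max (h2.sub (h1.pow_const 2))

theorem measurable_refWeight (hφ : Measurable φ) (s : ℝ) (h : Fin H) :
    Measurable fun p : Data K H S A B × (S × A × B) => refWeight G φ lam β s h p.1 p.2 :=
  Measurable.max (measurable_varEst (D := fun D : Data K H S A B => D 2)
      (V := fun D => refValue G φ lam β s D h.succ) hφ (measurable_pi_apply 2) h
      (measurable_refValue hφ s h.succ))
    ((measurable_truncVar (V := fun D : Data K H S A B => refValue G φ lam β s D h.succ)
      (measurable_refValue hφ s h.succ) h).div_const 2)

theorem measurable_advantage (hφ : Measurable φ) (s : ℝ) (h : Fin H) :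
    Measurable fun p : Data K H S A B × S => advantage G φ lam β κ γ b₁ ε s h p.1 p.2 :=
  measurable_const.max (measurable_const.min
    ((measurable_plusValue hφ s h.succ).sub (measurable_refValue hφ s h.succ)))

/-- The next value is built from the folds of later steps only, and these are disjoint from the fold
of step $h$. -/
theorem refValue_resample_fold (s : ℝ) (h : Fin H) (D : Data K H S A B)
    (D' : Fin K → Episode H S A B) :
    refValue G φ lam β s (resample 0 (fold H K h) D D') h.succ =
      refValue G φ lam β s D h.succ :=
  sweepValue_congr _ fun h' hh => spmviQ_congr (fun τ hτ =>
    resample_apply_notMem 0 0 D D' (notMem_fold_of_lt (by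
      rwa [← Fin.succ_le_castSucc_iff]) hτ)) _ _ _

theorem refValue_resample_ne (s : ℝ) {j : Fin 4} (hj : 0 ≠ j) (I : Finset (Fin K))
    (D : Data K H S A B) (D' : Fin K → Episode H S A B) :
    refValue G φ lam β s (resample j I D D') = refValue G φ lam β s D := by
  unfold refValue
  rw [resample_apply_ne hj]

/-- The reference values and the weights come from the other datasets, and the value at the next
step uses later folds of `D 3` only. -/
theorem advantage_resample (s : ℝ) (h : Fin H) (D : Data K H S A B)
    (D' : Fin K → Episode H S A B) :
    advantage G φ lam β κ γ b₁ ε s h (resample 3 (fold H K h) D D') =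
      advantage G φ lam β κ γ b₁ ε s h D := by
  have h1 : plusValue G φ lam β κ γ b₁ s (resample 3 (fold H K h) D D') h.succ =
      plusValue G φ lam β κ γ b₁ s D h.succ := by
    refine sweepValue_congr _ fun h' hh => ?_
    rw [refValue_resample_ne s (by decide), resample_apply_ne (i := 1) (by decide),
      resample_apply_ne (i := 2) (by decide), spmviPlusQ_congr (D' := D 3) fun τ hτ =>
      resample_apply_notMem 3 3 D D' (notMem_fold_of_lt (by
        rwa [← Fin.succ_le_castSucc_iff]) hτ)]
  funext x
  unfold advantage
  rw [h1, refValue_resample_ne s (by decide)]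

variable {ι : ℝ}

/-- One application of `noiseBad_le` to each of the five regressions. Dividing by the range of the
target makes the noise bounded by one with conditional variance at most one, except in the
variance-weighted regression, where the scale comes from the weight. -/
theorem stepNoiseBad_le (hG : G.IsLinear φ) (hlam : 0 < lam) (hH : 1 ≤ H) (hε : 0 < ε)
    (hfold : 4 ≤ K / H) (hK : 4 ≤ K)
    (hι1 : 2 * (d * (√((K / H : ℕ) : ℝ) * ι)) ≤ (K / H : ℕ) * G.coverage ρ σ φ)
    (hι2 : 2 * H ^ 2 * (d * (√(K : ℝ) * ι)) ≤ K * G.coverage ρ σ φ)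
    (hι3 : 2 * (d * (√(K : ℝ) * ι)) ≤ K * G.coverage ρ σ φ)
    (hR1 : 1 ≤ (K / H : ℕ) * G.coverage ρ σ φ) (hR2 : (H : ℝ) ^ 2 * H ^ 2 ≤ K * G.coverage ρ σ φ)
    (hR3 : 1 ≤ K * G.coverage ρ σ φ) (s : ℝ) (h : Fin H) :
    (dataLaw K G σ ρ).real {D | stepNoiseBad G φ lam β κ γ b₁ ε ι s h D} ≤
      5 * (4 * d ^ 2 * Real.exp (1 - ι)) := by
  have hφ := hG.measurable_feature
  have hH' : (1 : ℝ) ≤ H := by exact_mod_cast hH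
  have hVm := measurable_refValue (K := K) (G := G) (lam := lam) (β := β) hφ s h.succ
  have hmem : ∀ (D : Data K H S A B) x, refValue G φ lam β s D h.succ x ∈ Set.Icc (0 : ℝ) H :=
    fun D x => refValue_mem_horizon s D h.succ x
  have habs : ∀ (D : Data K H S A B) x, |refValue G φ lam β s D h.succ x| ≤ H := fun D x => by
    rw [abs_of_nonneg (hmem D x).1]; exact (hmem D x).2
  have hsec : ∀ D : Data K H S A B, Measurable (refValue G φ lam β s D h.succ) := fun D =>
    measurable_section (f := fun D : Data K H S A B => refValue G φ lam β s D h.succ) hVm D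
  have hmem2 : ∀ (D : Data K H S A B) x,
      refValue G φ lam β s D h.succ x ^ 2 ∈ Set.Icc (0 : ℝ) (H ^ 2) := fun D x =>
    ⟨sq_nonneg _, pow_le_pow_left₀ (hmem D x).1 (hmem D x).2 2⟩
  have hadvm := measurable_advantage (K := K) (G := G) (lam := lam) (β := β) (κ := κ) (γ := γ)
    (b₁ := b₁) (ε := ε) hφ s h
  have hasec : ∀ D : Data K H S A B, Measurable (advantage G φ lam β κ γ b₁ ε s h D) :=
    measurable_section hadvm
  have hadv : ∀ (D : Data K H S A B) x,
      advantage G φ lam β κ γ b₁ ε s h D x ∈ Set.Icc (-ε) ε := fun D x =>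
    abs_le.1 (abs_max_min_le hε.le _)
  have hcard : (Finset.univ : Finset (Fin K)).card = K := by simp
  have e1 := noiseBad_le (σ := σ) (ρ := ρ) hG hlam (ι := ι) 0 (fold H K h) h
    (w := fun _ _ => 1) measurable_const (fun _ _ => le_rfl) (L := 1) (fun _ _ => le_rfl) one_pos
    (by rw [card_fold]; exact hfold) (by rw [card_fold]; linarith) hVm habs (c := H) (R := 1)
    (by linarith) (fun D z x => by
      simpa using abs_sub_integral_le (G := G) (hsec D) (hmem D) h z x)
    (by rw [card_fold]; linarith)
    (fun D z => by simpa using condVar_le_sq (G := G) (hsec D) (hmem D) h z)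
    (fun _ _ => rfl) (fun D D' => refValue_resample_fold s h D D')
  have e2 := noiseBad_le (σ := σ) (ρ := ρ) hG hlam (ι := ι) 2 Finset.univ h
    (w := fun _ _ => 1) measurable_const (fun _ _ => le_rfl) (L := 1) (fun _ _ => le_rfl) one_pos
    (by rw [hcard]; exact hK) (by rw [hcard]; linarith) hVm habs (c := H) (R := 1)
    (by linarith) (fun D z x => by
      simpa using abs_sub_integral_le (G := G) (hsec D) (hmem D) h z x)
    (by rw [hcard]; linarith)
    (fun D z => by simpa using condVar_le_sq (G := G) (hsec D) (hmem D) h z)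
    (fun _ _ => rfl) (fun D D' => by rw [refValue_resample_ne s (by decide)])
  have e3 := noiseBad_le (σ := σ) (ρ := ρ) hG hlam (ι := ι) 2 Finset.univ h
    (w := fun _ _ => 1) measurable_const (fun _ _ => le_rfl) (L := 1) (fun _ _ => le_rfl) one_pos
    (by rw [hcard]; exact hK) (by rw [hcard]; linarith)
    (V := fun D x => refValue G φ lam β s D h.succ x ^ 2) (hVm.pow_const 2) (C := (H : ℝ) ^ 2)
    (fun D x => by
      rw [abs_of_nonneg (hmem2 D x).1]; exact (hmem2 D x).2) (c := H ^ 2) (R := 1)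
    (by positivity) (fun D z x => by
      simpa using abs_sub_integral_le (G := G) ((hsec D).pow_const 2) (hmem2 D) h z x)
    (by rw [hcard]; linarith)
    (fun D z => by simpa using condVar_le_sq (G := G) ((hsec D).pow_const 2) (hmem2 D) h z)
    (fun _ _ => rfl) (fun D D' => by rw [refValue_resample_ne s (by decide)])
  -- The weight is at least half of the true variance for every dataset, so dividing by $\sqrt2$
  -- brings the conditional variance below the weight. The range is then only bounded by $H$ and the
  -- weight by $H^2$, whence the requirement $H^4\le K\kappa$.
  have e4 := noiseBad_le (σ := σ) (ρ := ρ) hG hlam (ι := ι) 1 Finset.univ h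
    (w := refWeight G φ lam β s h) (measurable_refWeight hφ s h)
    (fun D z => (varEst_mem hH _ _ h z).1.trans (le_max_left _ _)) (L := H ^ 2)
    (fun D z => max_le (varEst_mem hH _ _ h z).2 (by
      have h1 := condVar_le_sq (G := G) (hsec D) (hmem D) h z
      have h2 : G.truncVar h (refValue G φ lam β s D h.succ) z ≤ H ^ 2 :=
        max_le (one_le_pow₀ hH') (by simpa using h1)
      have h3 : (0 : ℝ) ≤ H ^ 2 := by positivity
      linarith)) (by positivity)
    (by rw [hcard]; exact hK) (by rw [hcard]; linarith) hVm habs (c := √2) (R := H)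
    (by positivity) (fun D z x => by
      have h1 := abs_sub_integral_le (G := G) (hsec D) (hmem D) h z x
      have h2 : 1 ≤ √(2 : ℝ) := Real.one_le_sqrt.2 (by norm_num)
      nlinarith)
    (by rw [hcard]; linarith)
    (fun D z => by
      rw [Real.sq_sqrt (by norm_num)]
      have h1 : G.truncVar h (refValue G φ lam β s D h.succ) z / 2 ≤
        refWeight G φ lam β s h D z := le_max_right _ _
      have h2 : G.condVar h (refValue G φ lam β s D h.succ) z ≤
        G.truncVar h (refValue G φ lam β s D h.succ) z := le_max_right _ _
      linarith)
    (fun D D' => by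
      funext z
      unfold refWeight
      rw [refValue_resample_ne s (by decide), resample_apply_ne (i := 2) (by decide)])
    (fun D D' => by rw [refValue_resample_ne s (by decide)])
  -- The truncation confines the advantage to $[-\varepsilon,\varepsilon]$ on all data, so
  -- $2\varepsilon$ bounds its fluctuation.
  have e5 := noiseBad_le (σ := σ) (ρ := ρ) hG hlam (ι := ι) 3 (fold H K h) h
    (w := fun _ _ => 1) measurable_const (fun _ _ => le_rfl) (L := 1) (fun _ _ => le_rfl) one_pos
    (by rw [card_fold]; exact hfold) (by rw [card_fold]; linarith) hadvm
    (fun D x => abs_max_min_le hε.le _) (c := 2 * ε) (R := 1)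
    (by linarith) (fun D z x => by
      have := abs_sub_integral_le (G := G) (hasec D) (hadv D) h z x
      linarith)
    (by rw [card_fold]; linarith)
    (fun D z => by
      have := condVar_le_sq (G := G) (hasec D) (hadv D) h z
      rw [show ε - -ε = 2 * ε by ring] at this
      simpa using this)
    (fun _ _ => rfl) (fun D D' => advantage_resample s h D D')
  have hu := fun T U : Set (Data K H S A B) => measureReal_union_le (μ := dataLaw K G σ ρ) T U
  have := (hu _ _).trans (add_le_add e1 ((hu _ _).trans (add_le_add e2 ((hu _ _).trans
    (add_le_add e3 ((hu _ _).trans (add_le_add e4 e5)))))))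
  refine le_trans (le_of_eq ?_) (this.trans_eq (by ring))
  rfl

theorem stepGramBad_le (hG : G.IsLinear φ) (hfold : 4 ≤ K / H) (hK : 4 ≤ K) (h : Fin H) :
    (dataLaw K G σ ρ).real {D | stepGramBad G φ σ ρ ι h D} ≤
      4 * (2 * d ^ 2 * Real.exp (1 - ι)) := by
  have e := fun (j : Fin 4) (I : Finset (Fin K)) (hI : 4 ≤ I.card) =>
    gramBad_le (σ := σ) (ρ := ρ) hG j h I hI ι
  have hf : 4 ≤ (fold H K h).card := by rw [card_fold]; exact hfold
  have hu' : 4 ≤ (Finset.univ : Finset (Fin K)).card := by simpa using hK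
  have hu := fun T U : Set (Data K H S A B) => measureReal_union_le (μ := dataLaw K G σ ρ) T U
  have := (hu _ _).trans (add_le_add (e 0 _ hf) ((hu _ _).trans (add_le_add (e 1 _ hu')
    ((hu _ _).trans (add_le_add (e 2 _ hu') (e 3 _ hf))))))
  refine le_trans (le_of_eq ?_) (this.trans_eq (by ring))
  rfl

end Events

/-! ### From the accuracy of `Q`-estimates to the accuracy of values -/

section Bellman

open Matrix

variable {H d : ℕ} {S A B : Type*} [MeasurableSpace S] [MeasurableSpace A] [MeasurableSpace B]
  [Fintype A] [Fintype B] [MeasurableSingletonClass A] [MeasurableSingletonClass B]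

/-- One of the two value iterations of a sweep. -/
structure IsHalfSweep (Q : Fin H → (S → ℝ) → S → A → B → ℝ) (π : Policy H S A) (ν : Policy H S B)
    (V : Fin (H + 1) → S → ℝ) : Prop where
  last : V (Fin.last H) = 0
  nash : ∀ h x, IsMatrixNash (Q h (V h.succ) x) (π.prob h x) (ν.prob h x)
  value : ∀ h x, V h.castSucc x = payoff (Q h (V h.succ) x) (π.prob h x) (ν.prob h x)

theorem IsSweep.lo {Qlo Qup : Fin H → (S → ℝ) → S → A → B → ℝ}
    {πhat : Policy H S A} {ν' : Policy H S B} {π' : Policy H S A} {νhat : Policy H S B}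
    {Vlo Vup : Fin (H + 1) → S → ℝ} (hs : IsSweep Qlo Qup πhat ν' π' νhat Vlo Vup) :
    IsHalfSweep Qlo πhat ν' Vlo :=
  ⟨hs.lo_last, hs.lo_nash, hs.lo_value⟩

theorem IsSweep.up {Qlo Qup : Fin H → (S → ℝ) → S → A → B → ℝ}
    {πhat : Policy H S A} {ν' : Policy H S B} {π' : Policy H S A} {νhat : Policy H S B}
    {Vlo Vup : Fin (H + 1) → S → ℝ} (hs : IsSweep Qlo Qup πhat ν' π' νhat Vlo Vup) :
    IsHalfSweep Qup π' νhat Vup :=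
  ⟨hs.up_last, hs.up_nash, hs.up_value⟩

theorem sum_prod_eq_payoff (π : Policy H S A) (ν : Policy H S B) (h : Fin H) (x : S)
    (F : S × A × B → ℝ) : ∑ c, (π.prod ν).prob h x c * F (x, c) =
      payoff (fun a b => F (x, a, b)) (π.prob h x) (ν.prob h x) := by
  rw [Fintype.sum_prod_type]
  rfl

variable {G : Game H S A B} {Q : Fin H → (S → ℝ) → S → A → B → ℝ} {π : Policy H S A}
  {ν : Policy H S B} {V : Fin (H + 1) → S → ℝ} {C : ℝ} {e : Fin H → S × A × B → ℝ} {M : ℝ}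

theorem abs_reward_le (G : Game H S A B) (h : Fin H) (z : S × A × B) : |G.reward h z| ≤ 1 := by
  have := G.reward_mem h z
  rw [abs_of_nonneg this.1]
  exact this.2

/-- Replacing `ν` by any `ν₂` can only raise the payoff of the matrix game. So `V` is a subsolution
of the Bellman recursion of `(π, ν₂)` with reward `r + e`. -/
theorem IsHalfSweep.le_expect (hs : IsHalfSweep Q π ν V) (hV : ∀ h, Measurable (V h))
    (hC : ∀ h x, |V h x| ≤ C) (he : ∀ h, Measurable (e h)) (hM : ∀ h z, |e h z| ≤ M)
    (k : Fin (H + 1))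
    (hQ : ∀ h : Fin H, k ≤ h.castSucc → ∀ x a b, Q h (V h.succ) x a b ≤
      G.reward h (x, a, b) + ∫ x', V h.succ x' ∂(G.trans h (x, a, b)) + e h (x, a, b))
    (ν₂ : Policy H S B) (x : S) :
    V k x ≤ G.value π ν₂ k x + G.expect (π.prod ν₂) e k x := by
  rw [Game.value, ← expect_add G (π.prod ν₂) G.measurable_reward (abs_reward_le G) he hM]
  refine le_expect_of_le_bellman G (π.prod ν₂) (f := fun h z => G.reward h z + e h z)
    (M := 1 + M)
    (fun h => (G.measurable_reward h).add (he h))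
    (fun h z => (abs_add_le _ _).trans (add_le_add (abs_reward_le G h z) (hM h z))) hV hC
    (fun x => by rw [hs.last]; rfl) k (fun h hk x => ?_) x
  rw [hs.value]
  obtain ⟨hp, hq, -, h2⟩ := hs.nash h x
  refine (h2 _ (ν₂.mem_simplex h x)).trans ?_
  rw [sum_prod_eq_payoff π ν₂ h x fun z =>
    G.reward h z + e h z + ∫ x', V h.succ x' ∂(G.trans h z)]
  exact payoff_mono hp (ν₂.mem_simplex h x) fun a b => (hQ h hk x a b).trans_eq (by ring)

/-- The mirror image: deviations of the max-player lower the payoff, which makes `V` a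
supersolution. -/
theorem IsHalfSweep.expect_le (hs : IsHalfSweep Q π ν V) (hV : ∀ h, Measurable (V h))
    (hC : ∀ h x, |V h x| ≤ C) (he : ∀ h, Measurable (e h)) (hM : ∀ h z, |e h z| ≤ M)
    (k : Fin (H + 1))
    (hQ : ∀ h : Fin H, k ≤ h.castSucc → ∀ x a b,
      G.reward h (x, a, b) + ∫ x', V h.succ x' ∂(G.trans h (x, a, b)) - e h (x, a, b) ≤
        Q h (V h.succ) x a b)
    (π₂ : Policy H S A) (x : S) :
    G.value π₂ ν k x - G.expect (π₂.prod ν) e k x ≤ V k x := by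
  rw [sub_eq_add_neg, ← expect_neg, Game.value,
    ← expect_add G (π₂.prod ν) G.measurable_reward (abs_reward_le G)
      (g := fun h z => -e h z) (fun h => (he h).neg) (M' := M) (by simpa using hM)]
  refine expect_le_of_bellman_le G (π₂.prod ν) (f := fun h z => G.reward h z + -e h z)
    (M := 1 + M)
    (fun h => (G.measurable_reward h).add (he h).neg)
    (fun h z => (abs_add_le _ _).trans (add_le_add (abs_reward_le G h z) (by simpa using hM h z)))
    hV hC (fun x => by rw [hs.last]; rfl) k (fun h hk x => ?_) x
  rw [hs.value]
  obtain ⟨hp, hq, h1, -⟩ := hs.nash h x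
  refine le_trans ?_ (h1 _ (π₂.mem_simplex h x))
  rw [sum_prod_eq_payoff π₂ ν h x fun z =>
    G.reward h z + -e h z + ∫ x', V h.succ x' ∂(G.trans h z)]
  exact payoff_mono (π₂.mem_simplex h x) hq fun a b =>
    le_trans (le_of_eq (by ring)) (hQ h hk x a b)

variable {πs : Policy H S A} {νs : Policy H S B}

theorem Game.IsNash.value_le (hN : G.IsNash πs νs) (k : Fin (H + 1)) (x : S) (π : Policy H S A) :
    G.value π νs k x ≤ G.value πs νs k x := by
  induction k using Fin.lastCases with
  | last => simp [Game.value]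
  | cast h => exact (hN h x).1 π

theorem Game.IsNash.le_value (hN : G.IsNash πs νs) (k : Fin (H + 1)) (x : S) (ν : Policy H S B) :
    G.value πs νs k x ≤ G.value πs ν k x := by
  induction k using Fin.lastCases with
  | last => simp [Game.value]
  | cast h => exact (hN h x).2 ν

/-- A sweep with accurate `Q`-estimates has accurate values. -/
theorem IsHalfSweep.abs_sub_value_le (hs : IsHalfSweep Q π ν V) (hV : ∀ h, Measurable (V h))
    (hC : ∀ h x, |V h x| ≤ C) {c : ℝ} (hc : 0 ≤ c) (k : Fin (H + 1))
    (hQ : ∀ h : Fin H, k ≤ h.castSucc → ∀ x a b, |Q h (V h.succ) x a b -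
      (G.reward h (x, a, b) + ∫ x', V h.succ x' ∂(G.trans h (x, a, b)))| ≤ c)
    (hN : G.IsNash πs νs) (x : S) : |V k x - G.value πs νs k x| ≤ H * c := by
  have hcb : ∀ (_ : Fin H) (_ : S × A × B), |c| ≤ c := fun _ _ => (abs_of_nonneg hc).le
  -- The sandwich is $V^*-Hc\le V^{\pi^*,\nu}-Hc\le V\le V^{\pi,\nu^*}+Hc\le V^*+Hc$, with the
  -- strategies of the sweep compared to the two halves of the equilibrium.
  have h1 := hs.le_expect (G := G) hV hC (e := fun _ _ => c) (fun _ => measurable_const) hcb k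
    (fun h hk x a b => by linarith [(abs_le.1 (hQ h hk x a b)).2]) νs x
  have h2 := hs.expect_le (G := G) hV hC (e := fun _ _ => c) (fun _ => measurable_const) hcb k
    (fun h hk x a b => by linarith [(abs_le.1 (hQ h hk x a b)).1]) πs x
  have h3 := (abs_le.1 (abs_expect_le G (π.prod νs) hcb k x)).2
  have h4 := (abs_le.1 (abs_expect_le G (πs.prod ν) hcb k x)).2
  have h5 := hN.value_le k x π
  have h6 := hN.le_value k x ν
  have h7 : ((H : ℝ) - k) * c ≤ H * c :=
    mul_le_mul_of_nonneg_right (by simp) hc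
  rw [abs_le]
  constructor <;> linarith

theorem value_mem_Icc (π : Policy H S A) (ν : Policy H S B) (k : Fin (H + 1)) (x : S) :
    G.value π ν k x ∈ Set.Icc (0 : ℝ) H := by
  have h1 := (abs_le.1 (abs_expect_le G (π.prod ν) (abs_reward_le G) k x)).2
  refine ⟨integral_nonneg fun ep => Finset.sum_nonneg fun i _ => (G.reward_mem _ _).1, ?_⟩
  unfold Game.value
  have h2 : (0 : ℝ) ≤ (k : ℕ) := Nat.cast_nonneg _
  linarith

end Bellman

/-! ### Ridge regression outside the bad events -/

section Regression

open Matrix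

variable {H K d : ℕ} {S A B : Type*} [MeasurableSpace S] [MeasurableSpace A] [MeasurableSpace B]
  [Fintype A] [Fintype B] [MeasurableSingletonClass A] [MeasurableSingletonClass B]
  {G : Game H S A B} {φ : S × A × B → Fin d → ℝ} {σ : Policy H S (A × B)} {ρ : Measure S}
  [IsProbabilityMeasure ρ] {lam ι : ℝ} {D : Fin K → Episode H S A B} {I : Finset (Fin K)}
  {h : Fin H} {w : S × A × B → ℝ}

theorem quad_gram_one_le (hlam : 0 ≤ lam) {L : ℝ} (hw : ∀ z, 1 ≤ w z) (hL : ∀ z, w z ≤ L)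
    (hL1 : 1 ≤ L) (v : Fin d → ℝ) :
    v ⬝ᵥ gram φ lam D I (fun _ => 1) h *ᵥ v ≤ L * (v ⬝ᵥ gram φ lam D I w h *ᵥ v) := by
  rw [quad_gram, quad_gram, mul_add, Finset.mul_sum]
  refine add_le_add (Finset.sum_le_sum fun τ _ => ?_) ?_
  · rw [inv_one, one_mul, ← mul_assoc]
    refine le_mul_of_one_le_left (sq_nonneg _) ?_
    rw [← div_eq_mul_inv, one_le_div (lt_of_lt_of_le one_pos (hw _))]
    exact hL _
  · exact le_mul_of_one_le_left (mul_nonneg hlam (dotProduct_self_nonneg' v)) hL1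

/-- The comparison passes through the unweighted Gram matrix, so the same Gram event serves every
weight bounded by $L$, including those that depend on the data. -/
theorem quad_gram_ge (hG : G.IsLinear φ) (hlam : 0 < lam) {L : ℝ} (hw : ∀ z, 1 ≤ w z)
    (hL : ∀ z, w z ≤ L) (hL1 : 1 ≤ L)
    (hι : 2 * (d * (√(I.card : ℝ) * ι)) ≤ I.card * G.coverage ρ σ φ)
    (hD : D ∈ gramGood G φ σ ρ h I (fun _ => 1) ι) (v : Fin d → ℝ) :
    I.card * G.coverage ρ σ φ / (2 * L) * (v ⬝ᵥ v) ≤ v ⬝ᵥ gram φ lam D I w h *ᵥ v := by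
  have h1 := half_pop_le_quad_gram hG (w := fun _ => 1) measurable_const (fun _ => le_rfl)
    (L := 1) (fun _ => le_rfl) one_pos hlam h I (by linarith) hD v
  have h2 := popQuad_ge (σ := σ) (ρ := ρ) hG (w := fun _ => 1) measurable_const (fun _ => le_rfl)
    (L := 1) (fun _ => le_rfl) one_pos h v
  have h3 := quad_gram_one_le (φ := φ) (D := D) (I := I) (h := h) hlam.le hw hL hL1 v
  have hv := dotProduct_self_nonneg' v
  have h4 : I.card * G.coverage ρ σ φ / 2 * (v ⬝ᵥ v) ≤ L * (v ⬝ᵥ gram φ lam D I w h *ᵥ v) := by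
    have h5 : (I.card : ℝ) * (G.coverage ρ σ φ / 1 * (v ⬝ᵥ v)) ≤
      I.card * popQuad G φ σ ρ h (fun _ => 1) v := mul_le_mul_of_nonneg_left h2 (by positivity)
    nlinarith
  have hL0 : 0 < L := by linarith
  calc _ = (I.card * G.coverage ρ σ φ / 2 * (v ⬝ᵥ v)) / L := by field_simp
    _ ≤ _ := by rw [div_le_iff₀ hL0]; linarith

theorem wnorm_inv_le {Z : Matrix (Fin d) (Fin d) ℝ} (hZ : Z.PosDef) {a : ℝ} (ha : 0 < a)
    (h : ∀ v : Fin d → ℝ, a * (v ⬝ᵥ v) ≤ v ⬝ᵥ Z *ᵥ v) (u : Fin d → ℝ) :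
    wnorm Z⁻¹ u ≤ √((u ⬝ᵥ u) / a) :=
  Real.sqrt_le_sqrt (inv_quad_le_of_le_quad hZ ha h u)

theorem wnorm_smul (Λ : Matrix (Fin d) (Fin d) ℝ) {c : ℝ} (hc : 0 ≤ c) (u : Fin d → ℝ) :
    wnorm Λ (c • u) = c * wnorm Λ u := by
  rw [wnorm, wnorm, mulVec_smul, dotProduct_smul, smul_dotProduct, smul_eq_mul, smul_eq_mul,
    ← mul_assoc, ← pow_two, Real.sqrt_mul (sq_nonneg c), Real.sqrt_sq hc]

/-- The error of ridge regression on the good event. -/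
theorem ridge_error_le (hG : G.IsLinear φ) (hκ : 0 < G.coverage ρ σ φ) (hlam : 0 < lam)
    (hlamκ : lam ≤ G.coverage ρ σ φ) (hι0 : 0 ≤ ι) {L : ℝ} (hw : ∀ z, 1 ≤ w z)
    (hL : ∀ z, w z ≤ L) (hL1 : 1 ≤ L) (hI : 0 < I.card)
    (hι : 2 * (d * (√(I.card : ℝ) * ι)) ≤ I.card * G.coverage ρ σ φ)
    (hD : D ∈ gramGood G φ σ ρ h I (fun _ => 1) ι) {g : S × A × B → ℝ} {V : S → ℝ} {c : ℝ}
    (hc : 0 < c)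
    (hnoise : noiseVec φ D I w (condNoise G h V c) h ⬝ᵥ (gram φ lam D I w h)⁻¹ *ᵥ
      noiseVec φ D I w (condNoise G h V c) h ≤ 2 * (d * ι ^ 2))
    {w₀ : Fin d → ℝ} (hw₀ : ∀ z, g z + ∫ x', V x' ∂(G.trans h z) = φ z ⬝ᵥ w₀) {M : ℝ}
    (hM : ∀ z, |g z + ∫ x', V x' ∂(G.trans h z)| ≤ M) (z : S × A × B) :
    |φ z ⬝ᵥ ridge φ lam D I w (fun t => g t.1 + V t.2) h -
        (g z + ∫ x', V x' ∂(G.trans h z))| ≤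
      wnorm (gram φ lam D I w h)⁻¹ (φ z) * (M * √(2 * L / I.card) + c * (√2 * (√(d : ℝ) * ι))) := by
  set κ := G.coverage ρ σ φ with hκdef
  have hn : (0 : ℝ) < I.card := by exact_mod_cast hI
  have hL0 : 0 < L := by linarith
  have hpd := gram_posDef φ lam D I w h hlam fun z => zero_le_one.trans (hw z)
  have hge := quad_gram_ge (σ := σ) (ρ := ρ) hG hlam hw hL hL1 hι hD
  have ha : 0 < I.card * κ / (2 * L) := by positivity
  have herr := ridge_error φ lam D I w h hlam (fun z => zero_le_one.trans (hw z))
    (fun t => g t.1 + V t.2) (fun t => c * condNoise G h V c t) w₀ (fun t => by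
      rw [← hw₀, condNoise, mul_div_cancel₀ _ hc.ne']; ring) (φ z)
  rw [← hw₀] at herr
  refine herr.trans (mul_le_mul_of_nonneg_left (add_le_add ?_ ?_) (wnorm_nonneg _ _))
  · have hM0 : 0 ≤ M := (abs_nonneg _).trans (hM z)
    have h1 := wnorm_inv_le hpd ha hge w₀
    -- The bias is at most $\lambda\|w_0\|\sqrt{2L/(n\kappa)}$. Since $\lambda^2/\kappa\le\kappa$,
    -- this bound on $\|w_0\|$ cancels all dependence on $\kappa$ and $\lambda$.
    have h2 : κ * (w₀ ⬝ᵥ w₀) ≤ M ^ 2 :=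
      hG.coverage_mul_weight_sq_le h fun z => by rw [← hw₀]; exact hM z
    refine (mul_le_mul_of_nonneg_left h1 hlam.le).trans ?_
    have h3 : lam * √((w₀ ⬝ᵥ w₀) / (I.card * κ / (2 * L))) =
        √(lam ^ 2 * ((w₀ ⬝ᵥ w₀) / (I.card * κ / (2 * L)))) := by
      rw [Real.sqrt_mul (sq_nonneg _), Real.sqrt_sq hlam.le]
    have h4 : M * √(2 * L / I.card) = √(M ^ 2 * (2 * L / I.card)) := by
      rw [Real.sqrt_mul (sq_nonneg _), Real.sqrt_sq hM0]
    rw [h3, h4]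
    refine Real.sqrt_le_sqrt ?_
    have h5 : lam ^ 2 * ((w₀ ⬝ᵥ w₀) / (I.card * κ / (2 * L))) =
        (lam ^ 2 / κ * (w₀ ⬝ᵥ w₀)) * (2 * L / I.card) := by field_simp
    rw [h5]
    refine mul_le_mul_of_nonneg_right (le_trans ?_ h2) (by positivity)
    refine mul_le_mul_of_nonneg_right ?_ (dotProduct_self_nonneg' _)
    rw [div_le_iff₀ hκ]
    nlinarith
  · have h1 : ∑ τ ∈ I, (c * condNoise G h V c (D τ h) / w (D τ h).1) • φ (D τ h).1 =
        c • noiseVec φ D I w (condNoise G h V c) h := by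
      rw [noiseVec, Finset.smul_sum]
      refine Finset.sum_congr rfl fun τ _ => ?_
      rw [smul_smul, mul_div_assoc]
    rw [h1, wnorm_smul _ hc.le]
    refine mul_le_mul_of_nonneg_left ?_ hc.le
    refine (Real.sqrt_le_sqrt hnoise).trans_eq ?_
    rw [Real.sqrt_mul zero_le_two, Real.sqrt_mul (Nat.cast_nonneg d), Real.sqrt_sq hι0]

theorem wnorm_gram_feature_le (hG : G.IsLinear φ) (hκ : 0 < G.coverage ρ σ φ) (hlam : 0 < lam)
    {L : ℝ} (hw : ∀ z, 1 ≤ w z) (hL : ∀ z, w z ≤ L) (hL1 : 1 ≤ L) (hI : 0 < I.card)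
    (hι : 2 * (d * (√(I.card : ℝ) * ι)) ≤ I.card * G.coverage ρ σ φ)
    (hD : D ∈ gramGood G φ σ ρ h I (fun _ => 1) ι) (z : S × A × B) :
    wnorm (gram φ lam D I w h)⁻¹ (φ z) ≤ √(2 * L / (I.card * G.coverage ρ σ φ)) := by
  have hn : (0 : ℝ) < I.card := by exact_mod_cast hI
  have hL0 : 0 < L := by linarith
  have hpd := gram_posDef φ lam D I w h hlam fun z => zero_le_one.trans (hw z)
  have ha : 0 < I.card * G.coverage ρ σ φ / (2 * L) := by positivity
  refine (wnorm_inv_le hpd ha (quad_gram_ge hG hlam hw hL hL1 hι hD) (φ z)).trans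
    (Real.sqrt_le_sqrt ?_)
  calc _ ≤ 1 / (I.card * G.coverage ρ σ φ / (2 * L)) :=
        div_le_div_of_nonneg_right (hG.feature_sq_le z) ha.le
    _ = _ := by rw [one_div_div]

/-- The unweighted case of `ridge_error_le`. -/
theorem ridge_error_le_unweighted (hG : G.IsLinear φ) (hκ : 0 < G.coverage ρ σ φ) (hlam : 0 < lam)
    (hlamκ : lam ≤ G.coverage ρ σ φ) (hι1 : 1 ≤ ι) (hd : 1 ≤ d) (hI : 2 ≤ I.card)
    (hι : 2 * (d * (√(I.card : ℝ) * ι)) ≤ I.card * G.coverage ρ σ φ)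
    (hD : D ∈ gramGood G φ σ ρ h I (fun _ => 1) ι) {g : S × A × B → ℝ} {V : S → ℝ} {c : ℝ}
    (hc : 0 < c)
    (hnoise : noiseVec φ D I (fun _ => 1) (condNoise G h V c) h ⬝ᵥ
      (gram φ lam D I (fun _ => 1) h)⁻¹ *ᵥ noiseVec φ D I (fun _ => 1) (condNoise G h V c) h ≤
        2 * (d * ι ^ 2))
    {w₀ : Fin d → ℝ} (hw₀ : ∀ z, g z + ∫ x', V x' ∂(G.trans h z) = φ z ⬝ᵥ w₀)
    (hM : ∀ z, |g z + ∫ x', V x' ∂(G.trans h z)| ≤ c) (z : S × A × B) :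
    |φ z ⬝ᵥ ridge φ lam D I (fun _ => 1) (fun t => g t.1 + V t.2) h -
        (g z + ∫ x', V x' ∂(G.trans h z))| ≤
      3 * c * ι * (√(d : ℝ) * wnorm (gram φ lam D I (fun _ => 1) h)⁻¹ (φ z)) := by
  have h1 := ridge_error_le hG hκ hlam hlamκ (by linarith) (w := fun _ => 1) (fun _ => le_rfl)
    (L := 1) (fun _ => le_rfl) le_rfl (by omega) hι hD hc hnoise hw₀ hM z
  refine h1.trans ?_
  have hn : (2 : ℝ) ≤ I.card := by exact_mod_cast hI
  have h2 : √(2 * 1 / (I.card : ℝ)) ≤ 1 := by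
    rw [Real.sqrt_le_one, div_le_one (by linarith)]
    linarith
  have h3 : √2 ≤ (2 : ℝ) := by
    rw [Real.sqrt_le_left (by norm_num)]; norm_num
  have h4 : 1 ≤ √(d : ℝ) := Real.one_le_sqrt.2 (by exact_mod_cast hd)
  have h5 : 1 ≤ √(d : ℝ) * ι := one_le_mul_of_one_le_of_one_le h4 hι1
  -- The constant $3$ is one for the bias plus $\sqrt2\le2$ for the noise.
  have h6 : c * √(2 * 1 / (I.card : ℝ)) + c * (√2 * (√(d : ℝ) * ι)) ≤ 3 * c * (√(d : ℝ) * ι) := by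
    have h7 : √(2 * 1 / (I.card : ℝ)) + √2 * (√(d : ℝ) * ι) ≤ 3 * (√(d : ℝ) * ι) := by nlinarith
    nlinarith
  refine (mul_le_mul_of_nonneg_left h6 (wnorm_nonneg _ _)).trans_eq ?_
  ring

end Regression

/-! ### Accuracy of the reference values and of the variance estimator -/

section Analysis

open Matrix

variable {H K d : ℕ} {S A B : Type*} [MeasurableSpace S] [MeasurableSpace A] [MeasurableSpace B]
  [Fintype A] [Fintype B] [MeasurableSingletonClass A] [MeasurableSingletonClass B]

/-- The sample size is large enough for the analysis at confidence level `ι`. -/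
structure Regime (G : Game H S A B) (φ : S × A × B → Fin d → ℝ) (κ lam ι : ℝ) (K : ℕ) : Prop where
  linear : G.IsLinear φ
  cov_pos : 0 < κ
  lam_pos : 0 < lam
  lam_le : lam ≤ κ
  cov_le : κ ≤ 1
  one_le_conf : 1 ≤ ι
  one_le_horizon : 1 ≤ H
  one_le_dim : 1 ≤ d
  fold_size : 4 ≤ K / H
  size : 4 ≤ K
  size_le_fold : (K : ℝ) ≤ 2 * H * (K / H : ℕ)
  dev_fold : 2 * (d * (√((K / H : ℕ) : ℝ) * ι)) ≤ (K / H : ℕ) * κ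
  dev_full : 2 * (H : ℝ) ^ 2 * (d * (√(K : ℝ) * ι)) ≤ K * κ
  range_fold : 1 ≤ (K / H : ℕ) * κ
  range_full : (H : ℝ) ^ 2 * H ^ 2 ≤ K * κ
  size_ge : 2 * (H : ℝ) ^ 4 ≤ K
  small : 600 * ι * H ^ 3 * √(d * H / (K * κ)) ≤ 1
  lower_order : 600 * ι ^ 2 * (d * H ^ 3 / (K * κ)) ≤ √(1 / (2 * K))

variable {G : Game H S A B} {φ : S × A × B → Fin d → ℝ} {σ : Policy H S (A × B)} {ρ : Measure S}
  [IsProbabilityMeasure ρ] {lam ι κ : ℝ}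

theorem Regime.dev_full_one (hr : Regime G φ κ lam ι K) :
    2 * (d * (√(K : ℝ) * ι)) ≤ K * κ := by
  refine le_trans ?_ hr.dev_full
  have h1 : (1 : ℝ) ≤ H ^ 2 := one_le_pow₀ (by exact_mod_cast hr.one_le_horizon)
  have h2 : 0 ≤ d * (√(K : ℝ) * ι) := by have := hr.one_le_conf; positivity
  nlinarith

theorem Regime.size_pos (hr : Regime G φ κ lam ι K) : (0 : ℝ) < K := by
  have := hr.size
  exact_mod_cast (by omega : 0 < K)

theorem Regime.rate_sq (hr : Regime G φ κ lam ι K) :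
    √(d * H / (K * κ)) ^ 2 = d * H / (K * κ) :=
  Real.sq_sqrt (by have := hr.cov_pos; positivity)

/-- A fold contains at least $K/(2H)$ episodes and its Gram matrix dominates $n\kappa/2$ times the
identity. This sets the common rate $\sqrt{dH/(K\kappa)}$. -/
theorem Regime.sqrt_dim_mul_wnorm_fold (hr : Regime G φ κ lam ι K) (hκ : κ = G.coverage ρ σ φ)
    {D : Fin K → Episode H S A B} {h : Fin H}
    (hD : D ∈ gramGood G φ σ ρ h (fold H K h) (fun _ => 1) ι) (z : S × A × B) :
    √(d : ℝ) * wnorm (gram φ lam D (fold H K h) (fun _ => 1) h)⁻¹ (φ z) ≤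
      2 * √(d * H / (K * κ)) := by
  have hκ0 := hr.cov_pos
  have hn0 : (0 : ℝ) < (K / H : ℕ) := by
    have := hr.fold_size; exact_mod_cast (by omega : 0 < K / H)
  have hK0 := hr.size_pos
  have h1 := wnorm_gram_feature_le (lam := lam) hr.linear (hκ ▸ hκ0) hr.lam_pos (w := fun _ => 1)
    (fun _ => le_rfl) (L := 1) (fun _ => le_rfl) le_rfl
    (by rw [card_fold]; have := hr.fold_size; omega)
    (by rw [card_fold, ← hκ]; exact hr.dev_fold) hD z
  rw [card_fold, ← hκ] at h1
  refine (mul_le_mul_of_nonneg_left h1 (Real.sqrt_nonneg _)).trans ?_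
  rw [← Real.sqrt_mul (Nat.cast_nonneg d)]
  refine Real.sqrt_le_iff.2 ⟨by positivity, ?_⟩
  rw [mul_pow, hr.rate_sq]
  rw [mul_div_assoc', mul_div_assoc', div_le_div_iff₀ (by positivity) (by positivity)]
  have h2 := hr.size_le_fold
  have h3 : (0 : ℝ) ≤ 2 * d * κ := by positivity
  nlinarith [mul_le_mul_of_nonneg_left h2 h3]

/-- All $K$ episodes are used here, so the factor $H$ in the rate is slack, kept to have one rate
throughout. -/
theorem Regime.sqrt_dim_mul_wnorm_full (hr : Regime G φ κ lam ι K) (hκ : κ = G.coverage ρ σ φ)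
    {D : Fin K → Episode H S A B} {h : Fin H}
    (hD : D ∈ gramGood G φ σ ρ h Finset.univ (fun _ => 1) ι) {w : S × A × B → ℝ} {m : ℝ}
    (hm : 1 ≤ m) (hw : ∀ z, w z ∈ Set.Icc (1 : ℝ) (m ^ 2)) (z : S × A × B) :
    √(d : ℝ) * wnorm (gram φ lam D Finset.univ w h)⁻¹ (φ z) ≤
      2 * m * √(d * H / (K * κ)) := by
  have hκ0 := hr.cov_pos
  have hK0 := hr.size_pos
  have hm0 : 0 < m := by linarith
  have hcard : (Finset.univ : Finset (Fin K)).card = K := by simp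
  have h1 := wnorm_gram_feature_le (lam := lam) hr.linear (hκ ▸ hκ0) hr.lam_pos
    (fun z => (hw z).1) (fun z => (hw z).2) (one_le_pow₀ hm)
    (by rw [hcard]; have := hr.size; omega)
    (by rw [hcard, ← hκ]; exact hr.dev_full_one) hD z
  rw [hcard, ← hκ] at h1
  refine (mul_le_mul_of_nonneg_left h1 (Real.sqrt_nonneg _)).trans ?_
  rw [← Real.sqrt_mul (Nat.cast_nonneg d)]
  refine Real.sqrt_le_iff.2 ⟨by positivity, ?_⟩
  rw [mul_pow, hr.rate_sq]
  rw [mul_div_assoc', mul_div_assoc']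
  refine div_le_div_of_nonneg_right ?_ (by positivity)
  have h2 : (1 : ℝ) ≤ H := by exact_mod_cast hr.one_le_horizon
  have h3 : (0 : ℝ) ≤ d * m ^ 2 := by positivity
  nlinarith

theorem abs_one_max_sub_le (a b : ℝ) : |max 1 a - max 1 b| ≤ |a - b| := by
  rw [max_comm 1 a, max_comm 1 b]
  exact abs_max_sub_max_le_abs a b 1

theorem abs_clip_sub_le {M y q : ℝ} (hq : q ∈ Set.Icc 0 M) : |clip M y - q| ≤ |y - q| := by
  obtain ⟨h0, h1⟩ := hq
  unfold clip
  rcases le_total M y with h | h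
  · rw [min_eq_left h, max_eq_right (h0.trans h1), abs_of_nonneg (by linarith),
      abs_of_nonneg (by linarith)]
    linarith
  · rw [min_eq_right h]
    rcases le_total 0 y with h' | h'
    · rw [max_eq_right h']
    · rw [max_eq_left h', abs_of_nonpos (by linarith), abs_of_nonpos (by linarith)]
      linarith

variable [Nonempty A] [Nonempty B] {β γ b₁ ε s : ℝ} {D : Data K H S A B}

theorem measurable_refValue_section (hφ : Measurable φ) (s : ℝ) (D : Data K H S A B)
    (k : Fin (H + 1)) : Measurable (refValue G φ lam β s D k) :=
  measurable_section (f := fun D : Data K H S A B => refValue G φ lam β s D k)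
    (measurable_refValue hφ s k) D

theorem measurable_plusValue_section (hφ : Measurable φ) (s : ℝ) (D : Data K H S A B)
    (k : Fin (H + 1)) : Measurable (plusValue G φ lam β κ γ b₁ s D k) :=
  measurable_section (f := fun D : Data K H S A B => plusValue G φ lam β κ γ b₁ s D k)
    (measurable_plusValue hφ s k) D

theorem abs_refValue_le (s : ℝ) (D : Data K H S A B) (k : Fin (H + 1)) (x : S) :
    |refValue G φ lam β s D k x| ≤ H := by
  have := refValue_mem_horizon (G := G) (φ := φ) (lam := lam) (β := β) s D k x
  rw [abs_of_nonneg this.1]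
  exact this.2

theorem reward_add_integral_refValue_mem (hφ : Measurable φ) (s : ℝ) (D : Data K H S A B)
    (h : Fin H) (z : S × A × B) :
    G.reward h z + ∫ x', refValue G φ lam β s D h.succ x' ∂(G.trans h z) ∈
      Set.Icc (0 : ℝ) ((H : ℝ) - h) := by
  have h1 := integral_mem_Icc (G := G) (measurable_refValue_section (G := G) (lam := lam) (β := β) hφ s D
    h.succ) (fun x => refValue_mem (G := G) (φ := φ) (lam := lam) (β := β) s D h.succ x) h z
  have h2 := G.reward_mem h z
  have h3 : ((h.succ : Fin (H + 1)) : ℝ) = (h : ℝ) + 1 := by simp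
  obtain ⟨h4, h5⟩ := h1
  constructor
  · linarith [h2.1]
  · simp only [Fin.val_succ, Nat.cast_add, Nat.cast_one] at h5
    linarith [h2.2]

/-- Accuracy of the `Q`-estimates of SPMVI. -/
theorem Regime.spmviQ_error (hr : Regime G φ κ lam ι K) (hκ : κ = G.coverage ρ σ φ) {h : Fin H}
    (hg : ¬ stepGramBad G φ σ ρ ι h D)
    (hn : ¬ stepNoiseBad G φ lam (ι * (√(d : ℝ) * H)) κ γ b₁ ε ι s h D) (hs : |s| = 1)
    (x : S) (a : A) (b : B) :
    |spmviQ G.reward φ lam (ι * (√(d : ℝ) * H)) (D 0) s h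
        (refValue G φ lam (ι * (√(d : ℝ) * H)) s D h.succ) x a b -
      (G.reward h (x, a, b) + ∫ x', refValue G φ lam (ι * (√(d : ℝ) * H)) s D h.succ x'
        ∂(G.trans h (x, a, b)))| ≤ 8 * ι * H * √(d * H / (K * κ)) := by
  set β := ι * (√(d : ℝ) * H)
  simp only [stepGramBad, Set.mem_compl_iff, not_or, not_not] at hg
  simp only [stepNoiseBad, not_or] at hn
  have hφ := hr.linear.measurable_feature
  have hH : (1 : ℝ) ≤ H := by exact_mod_cast hr.one_le_horizon
  have hι := hr.one_le_conf
  obtain ⟨w₀, hw₀⟩ := hr.linear.exists_reward_weight h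
    (measurable_refValue_section (lam := lam) (β := β) (G := G) hφ s D h.succ)
    (abs_refValue_le s D h.succ)
  have hmem := reward_add_integral_refValue_mem (G := G) (lam := lam) (β := β) hφ s D h
  have herr := ridge_error_le_unweighted hr.linear (hκ ▸ hr.cov_pos) hr.lam_pos (hκ ▸ hr.lam_le) hι
    hr.one_le_dim (by rw [card_fold]; have := hr.fold_size; omega)
    (by rw [card_fold, ← hκ]; exact hr.dev_fold) hg.1 (c := H) (by linarith)
    (not_lt.1 hn.1) (g := G.reward h) hw₀
    (fun z => by
      rw [abs_of_nonneg (hmem z).1]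
      exact (hmem z).2.trans (by simp)) (x, a, b)
  have hwn := hr.sqrt_dim_mul_wnorm_fold hκ hg.1 (x, a, b)
  unfold spmviQ
  refine (abs_clip_sub_le (hmem (x, a, b))).trans ?_
  set wn := wnorm (gram φ lam (D 0) (fold H K h) (fun _ => 1) h)⁻¹ (φ (x, a, b))
  -- The regression error contributes $6$ and the bonus $2$ to the constant $8$.
  have hb : |s * (β * wn)| = ι * H * (√(d : ℝ) * wn) := by
    have hwn0 : 0 ≤ wn := wnorm_nonneg _ _
    have hβ0 : 0 ≤ β * wn := by positivity
    rw [abs_mul, hs, one_mul, abs_of_nonneg hβ0]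
    simp only [β]
    ring
  rw [add_sub_right_comm]
  refine (abs_add_le _ _).trans ?_
  rw [hb]
  have h0 : 0 ≤ ι * H := by positivity
  nlinarith [mul_le_mul_of_nonneg_left hwn h0]

/-- The errors of the `Q`-estimates add up over at most $H$ steps. -/
theorem Regime.abs_refValue_sub_le (hr : Regime G φ κ lam ι K) (hκ : κ = G.coverage ρ σ φ)
    (hg : ∀ h, ¬ stepGramBad G φ σ ρ ι h D)
    (hn : ∀ h, ¬ stepNoiseBad G φ lam (ι * (√(d : ℝ) * H)) κ γ b₁ ε ι s h D) (hs : |s| = 1)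
    {π : Policy H S A} {ν : Policy H S B}
    (hsw : IsHalfSweep (spmviQ G.reward φ lam (ι * (√(d : ℝ) * H)) (D 0) s) π ν
      (refValue G φ lam (ι * (√(d : ℝ) * H)) s D)) {πs : Policy H S A} {νs : Policy H S B}
    (hN : G.IsNash πs νs) (k : Fin (H + 1)) (x : S) :
    |refValue G φ lam (ι * (√(d : ℝ) * H)) s D k x - G.value πs νs k x| ≤
      8 * ι * H ^ 2 * √(d * H / (K * κ)) := by
  have hφ := hr.linear.measurable_feature
  have hι := hr.one_le_conf
  have := hsw.abs_sub_value_le (G := G) (fun k => measurable_refValue_section hφ s D k)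
    (fun k x => abs_refValue_le s D k x) (c := 8 * ι * H * √(d * H / (K * κ))) (by positivity) k
    (fun h _ x a b => hr.spmviQ_error hκ (hg h) (hn h) hs x a b) hN x
  refine this.trans_eq (by ring)

/-- Accuracy of the variance estimator. -/
theorem Regime.varEst_error (hr : Regime G φ κ lam ι K) (hκ : κ = G.coverage ρ σ φ) {h : Fin H}
    (hg : ¬ stepGramBad G φ σ ρ ι h D) (hn : ¬ stepNoiseBad G φ lam β κ γ b₁ ε ι s h D)
    (z : S × A × B) :
    |varEst φ lam (D 2) (refValue G φ lam β s D h.succ) h z -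
      G.truncVar h (refValue G φ lam β s D h.succ) z| ≤ 18 * ι * H ^ 2 * √(d * H / (K * κ)) := by
  simp only [stepGramBad, Set.mem_compl_iff, not_or, not_not] at hg
  simp only [stepNoiseBad, not_or] at hn
  have hφ := hr.linear.measurable_feature
  have hH : (1 : ℝ) ≤ H := by exact_mod_cast hr.one_le_horizon
  have hι := hr.one_le_conf
  have hcard : (Finset.univ : Finset (Fin K)).card = K := by simp
  have hK2 : 2 ≤ (Finset.univ : Finset (Fin K)).card := by rw [hcard]; have := hr.size; omega
  have hdev : 2 * (d * (√((Finset.univ : Finset (Fin K)).card : ℝ) * ι)) ≤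
      (Finset.univ : Finset (Fin K)).card * G.coverage ρ σ φ := by
    rw [hcard, ← hκ]; exact hr.dev_full_one
  set V := refValue G φ lam β s D h.succ with hV
  have hVm : Measurable V := measurable_refValue_section hφ s D h.succ
  have hmem : ∀ x, V x ∈ Set.Icc (0 : ℝ) H := refValue_mem_horizon s D h.succ
  have hmem2 : ∀ x, V x ^ 2 ∈ Set.Icc (0 : ℝ) (H ^ 2) := fun x =>
    ⟨sq_nonneg _, pow_le_pow_left₀ (hmem x).1 (hmem x).2 2⟩
  have hi := integral_mem_Icc (G := G) hVm hmem h
  have hi2 := integral_mem_Icc (G := G) (hVm.pow_const 2) hmem2 h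
  obtain ⟨w₁, hw₁⟩ := hr.linear.exists_weight h hVm (C := H) fun x => by
    rw [abs_of_nonneg (hmem x).1]; exact (hmem x).2
  obtain ⟨w₂, hw₂⟩ := hr.linear.exists_weight h (hVm.pow_const 2) (C := H ^ 2) fun x => by
    rw [abs_of_nonneg (hmem2 x).1]; exact (hmem2 x).2
  have herr1 := ridge_error_le_unweighted hr.linear (hκ ▸ hr.cov_pos) hr.lam_pos (hκ ▸ hr.lam_le)
    hι hr.one_le_dim hK2 hdev hg.2.2.1 (c := H) (by linarith) (not_lt.1 hn.2.1) (g := fun _ => 0)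
    (by simpa using hw₁)
    (fun z => by rw [zero_add, abs_of_nonneg (hi z).1]; exact (hi z).2) z
  have herr2 := ridge_error_le_unweighted hr.linear (hκ ▸ hr.cov_pos) hr.lam_pos (hκ ▸ hr.lam_le)
    hι hr.one_le_dim hK2 hdev hg.2.2.1 (c := H ^ 2) (by positivity) (not_lt.1 hn.2.2.1)
    (V := fun x => V x ^ 2) (g := fun _ => 0) (by simpa using hw₂)
    (fun z => by rw [zero_add, abs_of_nonneg (hi2 z).1]; exact (hi2 z).2) z
  have hwn := hr.sqrt_dim_mul_wnorm_full hκ hg.2.2.1 (w := fun _ => 1) (m := 1) le_rfl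
    (fun _ => by simp) z
  simp only [zero_add] at herr1 herr2
  have hc1 := (abs_clip_sub_le (hi z)).trans herr1
  have hc2 := (abs_clip_sub_le (hi2 z)).trans herr2
  have hb := clip_mem_Icc (by linarith : (0 : ℝ) ≤ H)
    (φ z ⬝ᵥ ridge φ lam (D 2) Finset.univ (fun _ => 1) (fun t => V t.2) h)
  unfold varEst Game.truncVar
  refine (abs_one_max_sub_le _ _).trans ?_
  unfold Game.condVar
  set c₁ := clip (H : ℝ) (φ z ⬝ᵥ ridge φ lam (D 2) Finset.univ (fun _ => 1) (fun t => V t.2) h)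
  set c₂ := clip ((H : ℝ) ^ 2)
    (φ z ⬝ᵥ ridge φ lam (D 2) Finset.univ (fun _ => 1) (fun t => V t.2 ^ 2) h)
  set p₁ := ∫ x', V x' ∂(G.trans h z)
  set p₂ := ∫ x', V x' ^ 2 ∂(G.trans h z)
  set q := √(d * H / (K * κ))
  have h1 : |c₁ - p₁| ≤ 6 * H * ι * q := hc1.trans (by
    have : 0 ≤ 3 * H * ι := by positivity
    nlinarith [mul_le_mul_of_nonneg_left hwn this])
  have h2 : |c₂ - p₂| ≤ 6 * H ^ 2 * ι * q := hc2.trans (by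
    have : 0 ≤ 3 * H ^ 2 * ι := by positivity
    nlinarith [mul_le_mul_of_nonneg_left hwn this])
  -- Factoring the difference of squares costs $2H$; together with the second moment this gives
  -- $12+6=18$.
  have h3 : |c₁ ^ 2 - p₁ ^ 2| ≤ 12 * H ^ 2 * ι * q := by
    rw [sq_sub_sq, abs_mul]
    have h4 : |c₁ + p₁| ≤ 2 * H := by
      rw [abs_of_nonneg (add_nonneg hb.1 (hi z).1)]
      linarith [hb.2, (hi z).2]
    refine (mul_le_mul h4 h1 (abs_nonneg _) (by positivity)).trans_eq (by ring)
  rw [show c₂ - c₁ ^ 2 - (p₂ - p₁ ^ 2) = (c₂ - p₂) - (c₁ ^ 2 - p₁ ^ 2) by ring]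
  refine (abs_sub _ _).trans ?_
  linarith

/-- The second moment and the square of the mean are each $2M$-Lipschitz on functions with values in
$[0,M]$. -/
theorem abs_truncVar_sub_le {V W : S → ℝ} (hV : Measurable V) (hW : Measurable W) {M c : ℝ}
    (hVM : ∀ x, V x ∈ Set.Icc 0 M) (hWM : ∀ x, W x ∈ Set.Icc 0 M) (hc : ∀ x, |V x - W x| ≤ c)
    (h : Fin H) (z : S × A × B) :
    |G.truncVar h V z - G.truncVar h W z| ≤ 4 * M * c := by
  have habs : ∀ {U : S → ℝ}, (∀ x, U x ∈ Set.Icc 0 M) → ∀ x, |U x| ≤ M := fun hU x => by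
    rw [abs_of_nonneg (hU x).1]; exact (hU x).2
  have habs2 : ∀ {U : S → ℝ}, (∀ x, U x ∈ Set.Icc 0 M) → ∀ x, |U x ^ 2| ≤ M ^ 2 := fun hU x => by
    rw [abs_pow]; exact pow_le_pow_left₀ (abs_nonneg _) (habs hU x) 2
  have hinteg : ∀ {U W : S → ℝ} {b M₁ M₂ : ℝ}, Measurable U → Measurable W → (∀ x, |U x| ≤ M₁) →
      (∀ x, |W x| ≤ M₂) → (∀ x, |U x - W x| ≤ b) →
      |∫ x', U x' ∂(G.trans h z) - ∫ x', W x' ∂(G.trans h z)| ≤ b := by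
    intro U W b M₁ M₂ hU hW hU1 hW1 hb
    rw [← integral_sub (integrable_trans G hU hU1 h z) (integrable_trans G hW hW1 h z)]
    have := norm_integral_le_of_norm_le_const (μ := G.trans h z) (f := fun x => U x - W x)
      (.of_forall hb)
    simpa using this
  have h1 := hinteg hV hW (habs hVM) (habs hWM) hc
  have hsq : ∀ {a b : ℝ}, a ∈ Set.Icc 0 M → b ∈ Set.Icc 0 M → |a - b| ≤ c →
      |a ^ 2 - b ^ 2| ≤ 2 * M * c := by
    intro a b ha hb hab
    rw [sq_sub_sq, abs_mul]
    have h4 : |a + b| ≤ 2 * M := by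
      rw [abs_of_nonneg (add_nonneg ha.1 hb.1)]
      linarith [ha.2, hb.2]
    exact mul_le_mul h4 hab (abs_nonneg _) ((abs_nonneg _).trans h4)
  have h2 := hinteg (hV.pow_const 2) (hW.pow_const 2) (habs2 hVM) (habs2 hWM)
    fun x => hsq (hVM x) (hWM x) (hc x)
  have h3 := hsq (integral_mem_Icc (G := G) hV hVM h z) (integral_mem_Icc hW hWM h z) h1
  unfold Game.truncVar
  refine (abs_one_max_sub_le _ _).trans ?_
  unfold Game.condVar
  rw [sub_sub_sub_comm]
  refine (abs_sub _ _).trans ?_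
  linarith

end Analysis

/-! ### Accuracy of SPMVI+ outside the bad events -/

section GoodRun

open Matrix

variable {H K d : ℕ} {S A B : Type*} [MeasurableSpace S] [MeasurableSpace A] [MeasurableSpace B]
  [Fintype A] [Fintype B] [MeasurableSingletonClass A] [MeasurableSingletonClass B]

/-- A run of the two algorithms, for the sign `s`, on data outside the bad events. -/
structure GoodRun (G : Game H S A B) (φ : S × A × B → Fin d → ℝ) (σ : Policy H S (A × B))
    (ρ : Measure S) (κ lam ι β γ b₁ ε s : ℝ) (D : Data K H S A B)
    (πs : Policy H S A) (νs : Policy H S B) : Prop where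
  regime : Regime G φ κ lam ι K
  cov_eq : κ = G.coverage ρ σ φ
  abs_sign : |s| = 1
  gram_good : ∀ h, ¬ stepGramBad G φ σ ρ ι h D
  noise_good : ∀ h, ¬ stepNoiseBad G φ lam β κ γ b₁ ε ι s h D
  ref_param : β = ι * (√(d : ℝ) * H)
  sharp_param : γ = 3 * ι * √(d : ℝ)
  adv_param : b₁ = 288 * ι ^ 2 * (d * H ^ 3 / (K * κ))
  radius : ε = 24 * ι * H ^ 2 * √(d * H / (K * κ))
  nash : G.IsNash πs νs
  ref_sweep : ∃ (π : Policy H S A) (ν : Policy H S B),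
    IsHalfSweep (spmviQ G.reward φ lam β (D 0) s) π ν (refValue G φ lam β s D)

variable {G : Game H S A B} {φ : S × A × B → Fin d → ℝ} {σ : Policy H S (A × B)} {ρ : Measure S}
  [IsProbabilityMeasure ρ] {lam ι κ β γ b₁ ε s : ℝ} {D : Data K H S A B}
  {πs : Policy H S A} {νs : Policy H S B}

theorem Regime.one_le_horizon_cast (hr : Regime G φ κ lam ι K) : (1 : ℝ) ≤ H := by
  exact_mod_cast hr.one_le_horizon

theorem Regime.one_le_sqrt_dim (hr : Regime G φ κ lam ι K) : 1 ≤ √(d : ℝ) :=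
  Real.one_le_sqrt.2 (by exact_mod_cast hr.one_le_dim)

theorem Regime.rate_pos (hr : Regime G φ κ lam ι K) : 0 < √(d * H / (K * κ)) := by
  have h1 := hr.cov_pos
  have h2 := hr.size_pos
  have h3 := hr.one_le_horizon_cast
  have h4 : (1 : ℝ) ≤ d := by exact_mod_cast hr.one_le_dim
  exact Real.sqrt_pos.2 (by positivity)

theorem Regime.small_sq (hr : Regime G φ κ lam ι K) :
    600 * (ι * H ^ 2 * √(d * H / (K * κ))) ≤ 1 := by
  refine le_trans ?_ hr.small
  have h1 := hr.rate_pos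
  have h2 := hr.one_le_conf
  have h3 : (H : ℝ) ^ 2 ≤ H ^ 3 := pow_le_pow_right₀ hr.one_le_horizon_cast (by norm_num)
  rw [← mul_assoc, ← mul_assoc]
  gcongr

/-- Since $\lambda\le\kappa\le1$, the constant part of the bonus is of the same order as `b₁`. -/
theorem Regime.bonus_const_le (hreg : Regime G φ κ lam ι K) :
    4 * lam * H ^ 3 * √(d : ℝ) / (K * κ) ≤ 4 * (d * H ^ 3 / (K * κ)) := by
  have h1 : lam * √(d : ℝ) ≤ 1 * d := by
    refine mul_le_mul (hreg.lam_le.trans hreg.cov_le) ?_ (Real.sqrt_nonneg _) zero_le_one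
    rw [Real.sqrt_le_left (by positivity)]
    have : (1 : ℝ) ≤ d := by exact_mod_cast hreg.one_le_dim
    nlinarith
  have h2 : 0 ≤ 4 * (H : ℝ) ^ 3 / (K * κ) := by have := hreg.cov_pos; positivity
  calc 4 * lam * H ^ 3 * √(d : ℝ) / (K * κ) = 4 * H ^ 3 / (K * κ) * (lam * √(d : ℝ)) := by ring
    _ ≤ 4 * H ^ 3 / (K * κ) * (1 * d) := mul_le_mul_of_nonneg_left h1 h2
    _ = _ := by ring

variable [Nonempty A] [Nonempty B]

namespace GoodRun

/-- The estimator errs by at most $18/600$ and is itself at least one. -/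
theorem half_truncVar_le_varEst (hr : GoodRun G φ σ ρ κ lam ι β γ b₁ ε s D πs νs) (h : Fin H)
    (z : S × A × B) : G.truncVar h (refValue G φ lam β s D h.succ) z / 2 ≤
      varEst φ lam (D 2) (refValue G φ lam β s D h.succ) h z := by
  have h1 := (abs_le.1 (hr.regime.varEst_error hr.cov_eq (hr.gram_good h) (hr.noise_good h) z)).1
  have h2 := hr.regime.small_sq
  have h3 := (varEst_mem (φ := φ) (lam := lam) hr.regime.one_le_horizon (D 2)
    (refValue G φ lam β s D h.succ) h z).1
  linarith

/-- The truncation is inactive on good data, so bounds for the surrogate weight apply to the weight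
the algorithm uses. -/
theorem refWeight_eq (hr : GoodRun G φ σ ρ κ lam ι β γ b₁ ε s D πs νs) (h : Fin H) :
    refWeight G φ lam β s h D = varEst φ lam (D 2) (refValue G φ lam β s D h.succ) h :=
  funext fun z => max_eq_left (hr.half_truncVar_le_varEst h z)

theorem abs_refValue_sub_le (hr : GoodRun G φ σ ρ κ lam ι β γ b₁ ε s D πs νs)
    (k : Fin (H + 1)) (x : S) : |refValue G φ lam β s D k x - G.value πs νs k x| ≤
      8 * ι * H ^ 2 * √(d * H / (K * κ)) := by
  obtain ⟨π, ν, hsw⟩ := hr.ref_sweep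
  have hn := hr.noise_good
  have hβ := hr.ref_param
  rw [hβ] at hsw hn ⊢
  exact hr.regime.abs_refValue_sub_le hr.cov_eq hr.gram_good hn hr.abs_sign hsw hr.nash k x

/-- Passing from the reference value to $V^*$ costs $4H\cdot8\iota H^2q$, where $q$ is the common
rate; this is why the regime asks for $\iota H^3q$ to be small. The total error is then less than
one, hence less than the truncated variance. -/
theorem varEst_le (hr : GoodRun G φ σ ρ κ lam ι β γ b₁ ε s D πs νs) (h : Fin H)
    (z : S × A × B) : varEst φ lam (D 2) (refValue G φ lam β s D h.succ) h z ≤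
      2 * G.truncVar h (G.value πs νs h.succ) z := by
  have h1 := (abs_le.1 (hr.regime.varEst_error hr.cov_eq (hr.gram_good h) (hr.noise_good h) z)).2
  have h2 := (abs_le.1 (abs_truncVar_sub_le (G := G)
    (measurable_refValue_section hr.regime.linear.measurable_feature s D h.succ)
    (measurable_expect G (πs.prod νs) G.measurable_reward h.succ)
    (refValue_mem_horizon s D h.succ) (value_mem_Icc πs νs h.succ)
    (fun x => hr.abs_refValue_sub_le h.succ x) h z)).2
  have h3 := hr.regime.small_sq
  have h4 := hr.regime.small
  have h5 : 1 ≤ G.truncVar h (G.value πs νs h.succ) z := le_max_left _ _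
  change _ - G.truncVar h (G.value πs νs h.succ) z ≤ _ at h2
  nlinarith

/-- Accuracy of the reference part of the `Q`-estimates of SPMVI+. -/
theorem ref_error (hr : GoodRun G φ σ ρ κ lam ι β γ b₁ ε s D πs νs) (h : Fin H)
    (z : S × A × B) :
    |φ z ⬝ᵥ ridge φ lam (D 1) Finset.univ
        (varEst φ lam (D 2) (refValue G φ lam β s D h.succ) h)
        (fun t => G.reward h t.1 + refValue G φ lam β s D h.succ t.2) h -
      (G.reward h z + ∫ x', refValue G φ lam β s D h.succ x' ∂(G.trans h z))| ≤
    γ * wnorm (gram φ lam (D 1) Finset.univ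
      (varEst φ lam (D 2) (refValue G φ lam β s D h.succ) h) h)⁻¹ (φ z) := by
  have hg := hr.gram_good h
  have hn := hr.noise_good h
  simp only [stepGramBad, Set.mem_compl_iff, not_or, not_not] at hg
  simp only [stepNoiseBad, not_or] at hn
  have hn1 := hn.2.2.2.1
  -- The noise event concerns the surrogate weight, which is now exchanged for the estimated
  -- variance.
  rw [noiseBad, Set.mem_ofPred_eq, not_lt, hr.refWeight_eq h] at hn1
  have hreg := hr.regime
  have hφ := hreg.linear.measurable_feature
  have hH := hreg.one_le_horizon_cast
  have hcard : (Finset.univ : Finset (Fin K)).card = K := by simp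
  have hmem := reward_add_integral_refValue_mem (G := G) (lam := lam) (β := β) hφ s D h
  obtain ⟨w₀, hw₀⟩ := hreg.linear.exists_reward_weight h
    (measurable_refValue_section (lam := lam) (β := β) (G := G) hφ s D h.succ)
    (abs_refValue_le s D h.succ)
  have hvar := varEst_mem (φ := φ) (lam := lam) hreg.one_le_horizon (D 2)
    (refValue G φ lam β s D h.succ) h
  have h1 := ridge_error_le hreg.linear (hr.cov_eq ▸ hreg.cov_pos) hreg.lam_pos
    (hr.cov_eq ▸ hreg.lam_le) (by linarith [hreg.one_le_conf]) (fun z => (hvar z).1)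
    (fun z => (hvar z).2) (one_le_pow₀ hH) (by rw [hcard]; have := hreg.size; omega)
    (by rw [hcard, ← hr.cov_eq]; exact hreg.dev_full_one) hg.2.1 (by positivity) hn1 hw₀
    (M := H) (fun z => by
      rw [abs_of_nonneg (hmem z).1]
      exact (hmem z).2.trans (by simp)) z
  refine h1.trans ?_
  rw [mul_comm γ, hr.sharp_param]
  refine mul_le_mul_of_nonneg_left ?_ (wnorm_nonneg _ _)
  -- The bias is at most one because $K\ge2H^4$. The noise gives $\sqrt2\cdot\sqrt2\,\sqrt
  -- d\,\iota$, so $\gamma=3\iota\sqrt d$ suffices, without a factor $H$.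
  have h2 : (H : ℝ) * √(2 * H ^ 2 / (Finset.univ : Finset (Fin K)).card) ≤ 1 := by
    rw [hcard]
    have hK := hreg.size_pos
    have h3 : √(2 * (H : ℝ) ^ 2 / K) ≤ 1 / H := by
      rw [Real.sqrt_le_left (by positivity), div_pow, div_le_div_iff₀ hK (by positivity)]
      linarith [hreg.size_ge]
    calc (H : ℝ) * √(2 * H ^ 2 / K) ≤ H * (1 / H) :=
          mul_le_mul_of_nonneg_left h3 (by linarith)
      _ = 1 := by field_simp
  have h3 : 1 ≤ √(d : ℝ) * ι :=
    one_le_mul_of_one_le_of_one_le hreg.one_le_sqrt_dim hreg.one_le_conf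
  have h4 : √2 * (√2 * (√(d : ℝ) * ι)) = 2 * (√(d : ℝ) * ι) := by
    rw [← mul_assoc, Real.mul_self_sqrt zero_le_two]
  rw [h4]
  linarith

theorem radius_pos (hr : GoodRun G φ σ ρ κ lam ι β γ b₁ ε s D πs νs) : 0 < ε := by
  have h1 := hr.regime.rate_pos
  have h2 := hr.regime.one_le_conf
  have h3 := hr.regime.one_le_horizon_cast
  rw [hr.radius]
  positivity

/-- Accuracy of the advantage part of the `Q`-estimates of SPMVI+. -/
theorem adv_error (hr : GoodRun G φ σ ρ κ lam ι β γ b₁ ε s D πs νs) {h : Fin H}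
    (hclose : ∀ x, |plusValue G φ lam β κ γ b₁ s D h.succ x - refValue G φ lam β s D h.succ x| ≤ ε)
    (z : S × A × B) :
    |φ z ⬝ᵥ ridge φ lam (D 3) (fold H K h) (fun _ => 1)
        (fun t => plusValue G φ lam β κ γ b₁ s D h.succ t.2 -
          refValue G φ lam β s D h.succ t.2) h -
      ∫ x', (plusValue G φ lam β κ γ b₁ s D h.succ x' - refValue G φ lam β s D h.succ x')
        ∂(G.trans h z)| ≤ b₁ := by
  have hg := hr.gram_good h
  have hn := hr.noise_good h
  simp only [stepGramBad, Set.mem_compl_iff, not_or, not_not] at hg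
  simp only [stepNoiseBad, not_or] at hn
  -- By `hclose` the truncation at `ε` is inactive.
  have hadv : advantage G φ lam β κ γ b₁ ε s h D = fun x =>
      plusValue G φ lam β κ γ b₁ s D h.succ x - refValue G φ lam β s D h.succ x := by
    funext x
    obtain ⟨h1, h2⟩ := abs_le.1 (hclose x)
    rw [advantage, min_eq_right h2, max_eq_right h1]
  have hn1 := hn.2.2.2.2
  rw [noiseBad, Set.mem_ofPred_eq, not_lt, hadv] at hn1
  have hreg := hr.regime
  have hφ := hreg.linear.measurable_feature
  have hε := hr.radius_pos
  set W : S → ℝ := fun x =>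
    plusValue G φ lam β κ γ b₁ s D h.succ x - refValue G φ lam β s D h.succ x with hW
  have hWm : Measurable W := (measurable_plusValue_section hφ s D h.succ).sub
    (measurable_refValue_section hφ s D h.succ)
  obtain ⟨w₀, hw₀⟩ := hreg.linear.exists_weight h hWm hclose
  have h1 := ridge_error_le_unweighted hreg.linear (hr.cov_eq ▸ hreg.cov_pos) hreg.lam_pos
    (hr.cov_eq ▸ hreg.lam_le) hreg.one_le_conf hreg.one_le_dim
    (by rw [card_fold]; have := hreg.fold_size; omega)
    (by rw [card_fold, ← hr.cov_eq]; exact hreg.dev_fold) hg.2.2.2 (by linarith) hn1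
    (g := fun _ => 0) (by simpa using hw₀) (fun z => by
      have h2 := integral_mem_Icc (G := G) hWm (fun x => abs_le.1 (hclose x)) h z
      rw [zero_add, abs_le]
      constructor <;> linarith [h2.1, h2.2]) z
  simp only [zero_add] at h1
  refine h1.trans ?_
  have hwn := hreg.sqrt_dim_mul_wnorm_fold (lam := lam) hr.cov_eq hg.2.2.2 z
  have hι := hreg.one_le_conf
  have h2 : 0 ≤ 3 * (2 * ε) * ι := by positivity
  refine (mul_le_mul_of_nonneg_left hwn h2).trans_eq ?_
  rw [hr.adv_param, hr.radius]
  -- The error is $3\cdot2\varepsilon\cdot\iota\cdot2q=12\iota q\varepsilon$ with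
  -- $\varepsilon=24\iota H^2q$, which is exactly `b₁`.
  have h3 := hreg.rate_sq
  have h4 : (d : ℝ) * H ^ 3 / (K * κ) = H ^ 2 * √(d * H / (K * κ)) ^ 2 := by
    rw [h3]; ring
  rw [h4]
  ring

/-- Accuracy of the `Q`-estimates of SPMVI+. -/
theorem plusQ_error (hr : GoodRun G φ σ ρ κ lam ι β γ b₁ ε s D πs νs) {h : Fin H}
    (hclose : ∀ x, |plusValue G φ lam β κ γ b₁ s D h.succ x - refValue G φ lam β s D h.succ x| ≤ ε)
    (x : S) (a : A) (b : B) :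
    |spmviPlusQ G.reward φ lam κ γ b₁ (D 1) (D 2) (D 3) s h (refValue G φ lam β s D h.succ)
        (plusValue G φ lam β κ γ b₁ s D h.succ) x a b -
      (G.reward h (x, a, b) + ∫ x', plusValue G φ lam β κ γ b₁ s D h.succ x'
        ∂(G.trans h (x, a, b))) -
      s * (bonus0 φ lam κ γ (D 1) (varEst φ lam (D 2) (refValue G φ lam β s D h.succ) h) h
        (x, a, b) + b₁)| ≤
    bonus0 φ lam κ γ (D 1) (varEst φ lam (D 2) (refValue G φ lam β s D h.succ) h) h (x, a, b) +
      b₁ := by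
  have hφ := hr.regime.linear.measurable_feature
  have h1 := hr.ref_error h (x, a, b)
  have h2 := hr.adv_error hclose (x, a, b)
  have hb : ∀ x', |plusValue G φ lam β κ γ b₁ s D h.succ x'| ≤ ε + H := fun x' => by
    have := abs_add_le (plusValue G φ lam β κ γ b₁ s D h.succ x' - refValue G φ lam β s D h.succ x')
      (refValue G φ lam β s D h.succ x')
    rw [sub_add_cancel] at this
    exact this.trans (add_le_add (hclose x') (abs_refValue_le s D h.succ x'))
  rw [integral_sub (integrable_trans G (measurable_plusValue_section hφ s D h.succ) hb h _)
    (integrable_trans G (measurable_refValue_section hφ s D h.succ)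
      (abs_refValue_le s D h.succ) h _)] at h2
  have h3 : 0 ≤ 4 * lam * H ^ 3 * √(d : ℝ) / (K * κ) := by
    have := hr.regime.lam_pos
    have := hr.regime.cov_pos
    positivity
  unfold spmviPlusQ
  rw [add_sub_right_comm, add_sub_cancel_right]
  refine le_trans (le_trans (le_of_eq (congrArg _ ?_)) (abs_add_le _ _)) (add_le_add
    (h1.trans (le_add_of_nonneg_right h3)) h2)
  ring

/-- The bonus of SPMVI+ is at most of the order of the radius over the horizon. -/
theorem bonus_le (hr : GoodRun G φ σ ρ κ lam ι β γ b₁ ε s D πs νs) (h : Fin H)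
    (z : S × A × B) :
    2 * (bonus0 φ lam κ γ (D 1) (varEst φ lam (D 2) (refValue G φ lam β s D h.succ) h) h z + b₁) ≤
      13 * ι * H * √(d * H / (K * κ)) := by
  have hreg := hr.regime
  have hg := hr.gram_good h
  simp only [stepGramBad, Set.mem_compl_iff, not_or, not_not] at hg
  have hwn := hreg.sqrt_dim_mul_wnorm_full (lam := lam) hr.cov_eq hg.2.1 hreg.one_le_horizon_cast
    (fun z => varEst_mem (φ := φ) (lam := lam) hreg.one_le_horizon (D 2)
    (refValue G φ lam β s D h.succ) h z) z
  have hlow : 4 * lam * H ^ 3 * √(d : ℝ) / (K * κ) ≤ 4 * (H ^ 2 * √(d * H / (K * κ)) ^ 2) := by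
    rw [hreg.rate_sq]
    exact hreg.bonus_const_le.trans_eq (by ring)
  have hb : b₁ = 288 * ι ^ 2 * (H ^ 2 * √(d * H / (K * κ)) ^ 2) := by
    rw [hr.adv_param, hreg.rate_sq]; ring
  have hι := hreg.one_le_conf
  have hq := hreg.rate_pos
  have hH := hreg.one_le_horizon_cast
  unfold bonus0
  set q := √(d * H / (K * κ))
  rw [hb, hr.sharp_param]
  set wn := wnorm (gram φ lam (D 1) Finset.univ
      (varEst φ lam (D 2) (refValue G φ lam β s D h.succ) h) h)⁻¹ (φ z)
  have h1 : 3 * ι * √(d : ℝ) * wn ≤ 6 * (ι * H * q) := by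
    have : 0 ≤ 3 * ι := by positivity
    nlinarith [mul_le_mul_of_nonneg_left hwn this]
  have h2 : H ^ 2 * q ^ 2 ≤ ι ^ 2 * (H ^ 2 * q ^ 2) :=
    le_mul_of_one_le_left (by positivity) (one_le_pow₀ hι)
  -- The quadratic terms, doubled, have coefficient $2(4+288)=584$ and cost at most one more unit
  -- beyond the $12$ of the leading term.
  have h3 : 600 * (ι ^ 2 * (H ^ 2 * q ^ 2)) ≤ ι * H * q := by
    have h4 : 600 * (ι * H * q) ≤ 1 := by
      refine le_trans ?_ hreg.small_sq
      have : (H : ℝ) ≤ H ^ 2 := le_self_pow₀ hH (by norm_num)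
      gcongr
    have h5 : 0 ≤ ι * H * q := by positivity
    nlinarith
  have h6 : 0 ≤ ι ^ 2 * (H ^ 2 * q ^ 2) := by positivity
  linarith

end GoodRun

end GoodRun

/-! ### Pessimism, comparison with the oracle matrices and the duality gap -/

section Gap

open Matrix

variable {H K d : ℕ} {S A B : Type*} [MeasurableSpace S] [MeasurableSpace A] [MeasurableSpace B]
  [Fintype A] [Fintype B] [MeasurableSingletonClass A] [MeasurableSingletonClass B]
  {G : Game H S A B} {φ : S × A × B → Fin d → ℝ} {σ : Policy H S (A × B)} {ρ : Measure S}
  [IsProbabilityMeasure ρ] {lam ι κ β γ b₁ ε s : ℝ} {D : Data K H S A B}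
  {πs : Policy H S A} {νs : Policy H S B}

theorem Game.IsLinear.abs_feature_dotProduct_le (hG : G.IsLinear φ) (w : Fin d → ℝ)
    (z : S × A × B) : |φ z ⬝ᵥ w| ≤ √(w ⬝ᵥ w) := by
  refine Real.abs_le_sqrt ((dotProduct_sq_le _ _).trans ?_)
  exact mul_le_of_le_one_left (dotProduct_self_nonneg' w) (hG.feature_sq_le z)

theorem Game.IsLinear.wnorm_gram_le (hG : G.IsLinear φ) (hlam : 0 < lam)
    {D : Fin K → Episode H S A B} {I : Finset (Fin K)} {w : S × A × B → ℝ} (hw : ∀ z, 0 ≤ w z)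
    (h : Fin H) (z : S × A × B) : wnorm (gram φ lam D I w h)⁻¹ (φ z) ≤ √(1 / lam) := by
  refine (wnorm_inv_le (gram_posDef φ lam D I w h hlam hw) hlam (fun v => ?_) (φ z)).trans
    (Real.sqrt_le_sqrt (div_le_div_of_nonneg_right (hG.feature_sq_le z) hlam.le))
  rw [quad_gram]
  exact le_add_of_nonneg_left (Finset.sum_nonneg fun τ _ =>
    mul_nonneg (inv_nonneg.2 (hw _)) (sq_nonneg _))

variable [Nonempty A] [Nonempty B]

/-- The `Q`-estimates of SPMVI+ are not clipped. A bound depending on the data is enough, since it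
serves only the integrability in the Bellman comparisons. -/
theorem exists_abs_plusValue_le (hG : G.IsLinear φ) (hlam : 0 < lam) (s : ℝ)
    (D : Data K H S A B) : ∃ C, ∀ k x, |plusValue G φ lam β κ γ b₁ s D k x| ≤ C := by
  have key : ∀ k, ∃ C, 0 ≤ C ∧ ∀ x, |plusValue G φ lam β κ γ b₁ s D k x| ≤ C := by
    intro k
    induction k using Fin.lastCases with
    | last => exact ⟨0, le_rfl, fun x => by simp [plusValue]⟩
    | cast h =>
      set V := plusValue G φ lam β κ γ b₁ s D h.succ with hV
      set R := refValue G φ lam β s D h.succ with hR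
      set w₀ := ridge φ lam (D 1) Finset.univ (varEst φ lam (D 2) R h)
        (fun t => G.reward h t.1 + R t.2) h with hw₀
      set w₁ := ridge φ lam (D 3) (fold H K h) (fun _ => 1) (fun t => V t.2 - R t.2) h with hw₁
      set C := √(w₀ ⬝ᵥ w₀) + √(w₁ ⬝ᵥ w₁) +
        |s| * (|γ| * √(1 / lam) + |4 * lam * H ^ 3 * √(d : ℝ) / (K * κ)| + |b₁|) with hC
      refine ⟨C, by positivity, fun x => ?_⟩
      have hQ : ∀ a b, spmviPlusQ G.reward φ lam κ γ b₁ (D 1) (D 2) (D 3) s h R V x a b ∈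
          Set.Icc (-C) C := fun a b => by
        refine Set.mem_Icc.2 (abs_le.1 ?_)
        unfold spmviPlusQ bonus0
        refine (abs_add_le _ _).trans (add_le_add ((abs_add_le _ _).trans (add_le_add
          (hG.abs_feature_dotProduct_le _ _) (hG.abs_feature_dotProduct_le _ _))) ?_)
        rw [abs_mul]
        refine mul_le_mul_of_nonneg_left ((abs_add_le _ _).trans (add_le_add_left
          ((abs_add_le _ _).trans (add_le_add_left ?_ _)) _)) (abs_nonneg _)
        rw [abs_mul, abs_of_nonneg (wnorm_nonneg _ _)]
        exact mul_le_mul_of_nonneg_left (hG.wnorm_gram_le hlam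
          (fun z => zero_le_one.trans (le_max_left _ _)) h _) (abs_nonneg _)
      have h1 := gameValue_mem_Icc hQ
      have h2 : plusValue G φ lam β κ γ b₁ s D h.castSucc x =
          gameValue (spmviPlusQ G.reward φ lam κ γ b₁ (D 1) (D 2) (D 3) s h R V x) := by
        rw [plusValue, sweepValue_castSucc]
        rfl
      rw [h2]
      exact abs_le.2 h1
  choose C hC0 hC using key
  exact ⟨∑ k, C k, fun k x => (hC k x).trans
    (Finset.single_le_sum (f := C) (fun k _ => hC0 k) (Finset.mem_univ k))⟩

namespace GoodRun

/-- The two value estimates are close. -/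
theorem abs_plusValue_sub_le (hr : GoodRun G φ σ ρ κ lam ι β γ b₁ ε s D πs νs)
    {π : Policy H S A} {ν : Policy H S B}
    (hsw : IsHalfSweep (fun h V => spmviPlusQ G.reward φ lam κ γ b₁ (D 1) (D 2) (D 3) s h
      (refValue G φ lam β s D h.succ) V) π ν (plusValue G φ lam β κ γ b₁ s D))
    (k : Fin (H + 1)) (x : S) :
    |plusValue G φ lam β κ γ b₁ s D k x - refValue G φ lam β s D k x| ≤ ε := by
  have hreg := hr.regime
  have hφ := hreg.linear.measurable_feature
  obtain ⟨C, hC⟩ := exists_abs_plusValue_le (β := β) (κ := κ) (γ := γ) (b₁ := b₁) hreg.linear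
    hreg.lam_pos s D
  -- The advantage regression is controlled only if the two values are already close at the next
  -- step. Comparing the value at step $k$ with $V^*$ involves all later steps, so the backward
  -- induction carries all of them.
  suffices ∀ k' : Fin (H + 1), k ≤ k' → ∀ x,
      |plusValue G φ lam β κ γ b₁ s D k' x - refValue G φ lam β s D k' x| ≤ ε from this k le_rfl x
  induction k using Fin.reverseInduction with
  | last =>
    intro k' hk x
    rw [Fin.last_le_iff.1 hk, plusValue, refValue, sweepValue_last, sweepValue_last]
    simpa using hr.radius_pos.le
  | cast h ih =>
    intro k' hk x
    rcases hk.eq_or_lt with rfl | hlt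
    · have hq := hreg.rate_pos
      have hι := hreg.one_le_conf
      have h1 := hsw.abs_sub_value_le (G := G)
        (fun k => measurable_plusValue_section hφ s D k) hC
        (c := 13 * ι * H * √(d * H / (K * κ))) (by positivity) h.castSucc
        (fun h' hh x a b => by
          have hclose := ih h'.succ (Fin.succ_le_succ_iff.2 (Fin.castSucc_le_castSucc_iff.1 hh))
          have h2 := abs_le.1 (hr.plusQ_error hclose x a b)
          have h3 := hr.bonus_le h' (x, a, b)
          have h4 := abs_le.1 hr.abs_sign.le
          have h0 := (abs_nonneg _).trans (hr.plusQ_error hclose x a b)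
          rw [abs_le]
          constructor <;> nlinarith) hr.nash x
      have h2 := hr.abs_refValue_sub_le h.castSucc x
      have h3 := abs_sub_le (plusValue G φ lam β κ γ b₁ s D h.castSucc x)
        (G.value πs νs h.castSucc x) (refValue G φ lam β s D h.castSucc x)
      rw [abs_sub_comm (G.value πs νs h.castSucc x)] at h3
      -- The distances to $V^*$ contribute $13+8\le24$, so the induction closes with the radius at
      -- which the advantage is truncated.
      refine h3.trans ((add_le_add h1 h2).trans ?_)
      rw [hr.radius]
      have : 0 ≤ ι * H ^ 2 * √(d * H / (K * κ)) := by positivity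
      linarith
    · exact ih k' (Fin.castSucc_lt_iff_succ_le.1 hlt) x

/-- The bonus is dominated by the oracle uncertainty. -/
theorem bonus_le_oracle (hr : GoodRun G φ σ ρ κ lam ι β γ b₁ ε s D πs νs) (h : Fin H)
    (z : S × A × B) :
    2 * (bonus0 φ lam κ γ (D 1) (varEst φ lam (D 2) (refValue G φ lam β s D h.succ) h) h z + b₁) ≤
      10 * ι * √(d : ℝ) * wnorm (Zstar G φ lam (D 1) πs νs h)⁻¹ (φ z) := by
  have hreg := hr.regime
  have hK := hreg.size_pos
  have hlam := hreg.lam_pos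
  have hι := hreg.one_le_conf
  have htv : ∀ z, 1 ≤ G.truncVar h (G.value πs νs h.succ) z := fun z => le_max_left _ _
  have hve : ∀ z, 1 ≤ varEst φ lam (D 2) (refValue G φ lam β s D h.succ) h z := fun z =>
    le_max_left _ _
  have hZ : (Zstar G φ lam (D 1) πs νs h).PosDef :=
    gram_posDef φ lam (D 1) Finset.univ _ h hlam fun z => zero_le_one.trans (htv z)
  have hG1 := gram_posDef φ lam (D 1) Finset.univ
    (varEst φ lam (D 2) (refValue G φ lam β s D h.succ) h) h hlam fun z => zero_le_one.trans (hve z)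
  -- The estimated variance is at most twice the oracle one, so the oracle Gram matrix is at most
  -- twice the weighted one and inversion reverses the order.
  have h1 : wnorm (gram φ lam (D 1) Finset.univ
      (varEst φ lam (D 2) (refValue G φ lam β s D h.succ) h) h)⁻¹ (φ z) ≤
      √2 * wnorm (Zstar G φ lam (D 1) πs νs h)⁻¹ (φ z) := by
    rw [wnorm, wnorm, ← Real.sqrt_mul zero_le_two]
    refine Real.sqrt_le_sqrt (inv_quad_le_of_quad_le hZ hG1 zero_le_two (fun v => ?_) (φ z))
    rw [Zstar, quad_gram, quad_gram, mul_add, Finset.mul_sum]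
    refine add_le_add (Finset.sum_le_sum fun τ _ => ?_) ?_
    · rw [← mul_assoc]
      refine mul_le_mul_of_nonneg_right ?_ (sq_nonneg _)
      have h2 := hr.varEst_le h (D 1 τ h).1
      rw [← div_eq_mul_inv, inv_eq_one_div, div_le_div_iff₀ (by linarith [htv (D 1 τ h).1])
        (by linarith [hve (D 1 τ h).1])]
      linarith
    · have := mul_nonneg hlam.le (dotProduct_self_nonneg' v)
      linarith
  -- All weights are at least one, so $Z_h^*\le(K+\lambda)I\le2KI$, while $d\,\|\phi\|^2\ge1$. The
  -- constant part of the bonus and `b₁` are absorbed by this lower bound.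
  have h2 : √(1 / (2 * (K : ℝ))) ≤
      √(d : ℝ) * wnorm (Zstar G φ lam (D 1) πs νs h)⁻¹ (φ z) := by
    rw [wnorm, ← Real.sqrt_mul (Nat.cast_nonneg d)]
    refine Real.sqrt_le_sqrt ?_
    have h3 := le_inv_quad_of_quad_le hZ (b := 2 * K) (by positivity) (fun v => ?_) (φ z)
    · have h4 := hreg.linear.one_le_feature_sq h z
      calc 1 / (2 * (K : ℝ)) ≤ (d * (φ z ⬝ᵥ φ z)) / (2 * K) :=
            div_le_div_of_nonneg_right h4 (by positivity)
        _ = d * ((φ z ⬝ᵥ φ z) / (2 * K)) := by ring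
        _ ≤ _ := mul_le_mul_of_nonneg_left h3 (Nat.cast_nonneg d)
    · rw [Zstar, quad_gram]
      have h5 : ∑ τ : Fin K, (G.truncVar h (G.value πs νs h.succ) (D 1 τ h).1)⁻¹ *
          (φ (D 1 τ h).1 ⬝ᵥ v) ^ 2 ≤ ∑ _τ : Fin K, v ⬝ᵥ v := by
        refine Finset.sum_le_sum fun τ _ => ?_
        have h6 : (φ (D 1 τ h).1 ⬝ᵥ v) ^ 2 ≤ v ⬝ᵥ v := (dotProduct_sq_le _ _).trans
          (mul_le_of_le_one_left (dotProduct_self_nonneg' v) (hreg.linear.feature_sq_le _))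
        exact (mul_le_of_le_one_left (sq_nonneg _) (inv_le_one_of_one_le₀ (htv _))).trans h6
      rw [Finset.sum_const, Finset.card_univ, Fintype.card_fin, nsmul_eq_mul] at h5
      have h6 : lam * (v ⬝ᵥ v) ≤ K * (v ⬝ᵥ v) := by
        refine mul_le_mul_of_nonneg_right ?_ (dotProduct_self_nonneg' v)
        have : (4 : ℝ) ≤ K := by exact_mod_cast hreg.size
        linarith [hreg.lam_le, hreg.cov_le]
      linarith
  set wz := wnorm (Zstar G φ lam (D 1) πs νs h)⁻¹ (φ z)
  have hwz : 0 ≤ wz := wnorm_nonneg _ _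
  have hs2 : √2 ≤ (1.5 : ℝ) := by rw [Real.sqrt_le_left (by norm_num)]; norm_num
  have hlow := hreg.bonus_const_le
  have hlo := hreg.lower_order
  have hκ := hreg.cov_pos
  have h3 : 0 ≤ (d : ℝ) * H ^ 3 / (K * κ) := by positivity
  have h4 : (d : ℝ) * H ^ 3 / (K * κ) ≤ ι ^ 2 * (d * H ^ 3 / (K * κ)) :=
    le_mul_of_one_le_left h3 (one_le_pow₀ hι)
  have h5 : √(d : ℝ) * wz ≤ ι * (√(d : ℝ) * wz) := le_mul_of_one_le_left (by positivity) hι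
  unfold bonus0
  rw [hr.sharp_param, hr.adv_param]
  have h6 : 3 * ι * √(d : ℝ) * wnorm (gram φ lam (D 1) Finset.univ
      (varEst φ lam (D 2) (refValue G φ lam β s D h.succ) h) h)⁻¹ (φ z) ≤
      4.5 * (ι * (√(d : ℝ) * wz)) := by
    have h7 := h1.trans (mul_le_mul_of_nonneg_right hs2 hwz)
    calc _ ≤ 3 * ι * √(d : ℝ) * (1.5 * wz) := mul_le_mul_of_nonneg_left h7 (by positivity)
      _ = _ := by ring
  linarith

variable {π : Policy H S A} {ν : Policy H S B}

/-- With the sign $-1$ the `Q`-estimates never exceed the Bellman backup, so the comparison holds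
with zero error. -/
theorem le_value_of_lower (hr : GoodRun G φ σ ρ κ lam ι β γ b₁ ε (-1) D πs νs)
    (hsw : IsHalfSweep (fun h V => spmviPlusQ G.reward φ lam κ γ b₁ (D 1) (D 2) (D 3) (-1) h
      (refValue G φ lam β (-1) D h.succ) V) π ν (plusValue G φ lam β κ γ b₁ (-1) D))
    (ν₂ : Policy H S B) (x : S) :
    plusValue G φ lam β κ γ b₁ (-1) D 0 x ≤ G.value π ν₂ 0 x := by
  have hreg := hr.regime
  have hφ := hreg.linear.measurable_feature
  obtain ⟨C, hC⟩ := exists_abs_plusValue_le (β := β) (κ := κ) (γ := γ) (b₁ := b₁) hreg.linear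
    hreg.lam_pos (-1) D
  have h1 := hsw.le_expect (G := G) (fun k => measurable_plusValue_section hφ (-1) D k) hC
    (e := fun _ _ => 0) (M := 0) (fun _ => measurable_const) (fun _ _ => by simp) 0
    (fun h _ x a b => by
      have h2 := abs_le.1 (hr.plusQ_error (fun x => hr.abs_plusValue_sub_le hsw h.succ x) x a b)
      linarith [h2.2]) ν₂ x
  have h2 := abs_expect_le G (π.prod ν₂) (f := fun _ _ => 0) (M := 0) (by simp) 0 x
  rw [mul_zero, abs_nonpos_iff] at h2
  rwa [h2, add_zero] at h1

theorem value_le_of_upper (hr : GoodRun G φ σ ρ κ lam ι β γ b₁ ε 1 D πs νs)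
    (hsw : IsHalfSweep (fun h V => spmviPlusQ G.reward φ lam κ γ b₁ (D 1) (D 2) (D 3) 1 h
      (refValue G φ lam β 1 D h.succ) V) π ν (plusValue G φ lam β κ γ b₁ 1 D))
    (π₂ : Policy H S A) (x : S) :
    G.value π₂ ν 0 x ≤ plusValue G φ lam β κ γ b₁ 1 D 0 x := by
  have hreg := hr.regime
  have hφ := hreg.linear.measurable_feature
  obtain ⟨C, hC⟩ := exists_abs_plusValue_le (β := β) (κ := κ) (γ := γ) (b₁ := b₁) hreg.linear
    hreg.lam_pos 1 D
  have h1 := hsw.expect_le (G := G) (fun k => measurable_plusValue_section hφ 1 D k) hC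
    (e := fun _ _ => 0) (M := 0) (fun _ => measurable_const) (fun _ _ => by simp) 0
    (fun h _ x a b => by
      have h2 := abs_le.1 (hr.plusQ_error (fun x => hr.abs_plusValue_sub_le hsw h.succ x) x a b)
      linarith [h2.1]) π₂ x
  have h2 := abs_expect_le G (π₂.prod ν) (f := fun _ _ => 0) (M := 0) (by simp) 0 x
  rw [mul_zero, abs_nonpos_iff] at h2
  rwa [h2, sub_zero] at h1

theorem abs_oracle_le (hr : GoodRun G φ σ ρ κ lam ι β γ b₁ ε s D πs νs) (h : Fin H)
    (z : S × A × B) : |wnorm (Zstar G φ lam (D 1) πs νs h)⁻¹ (φ z)| ≤ √(1 / lam) := by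
  rw [abs_of_nonneg (wnorm_nonneg _ _)]
  exact hr.regime.linear.wnorm_gram_le hr.regime.lam_pos
    (fun z => zero_le_one.trans (le_max_left _ _)) h z

/-- Needed for the suprema in the bound: a supremum of an unbounded real family is zero by
convention. -/
theorem uncertainty_le (hr : GoodRun G φ σ ρ κ lam ι β γ b₁ ε s D πs νs) (π : Policy H S A)
    (ν : Policy H S B) (x : S) :
    uncertainty G φ (Zstar G φ lam (D 1) πs νs) π ν x ≤ H * √(1 / lam) := by
  have := (abs_le.1 (abs_expect_le G (π.prod ν) hr.abs_oracle_le 0 x)).2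
  simpa [uncertainty] using this

/-- The two sides compare with $(\pi^*,\nu)$ and $(\pi,\nu^*)$, where `π` and `ν` are the
equilibrium strategies of the sweep. For the lower sweep `ν` is the auxiliary strategy of the
opponent, hence the maximum over $\nu$ in the final bound. -/
theorem sub_uncertainty_le (hr : GoodRun G φ σ ρ κ lam ι β γ b₁ ε s D πs νs)
    (hsw : IsHalfSweep (fun h V => spmviPlusQ G.reward φ lam κ γ b₁ (D 1) (D 2) (D 3) s h
      (refValue G φ lam β s D h.succ) V) π ν (plusValue G φ lam β κ γ b₁ s D)) (x : S) :
    G.value πs νs 0 x - 10 * ι * √(d : ℝ) *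
        uncertainty G φ (Zstar G φ lam (D 1) πs νs) πs ν x ≤
      plusValue G φ lam β κ γ b₁ s D 0 x ∧
    plusValue G φ lam β κ γ b₁ s D 0 x ≤ G.value πs νs 0 x + 10 * ι * √(d : ℝ) *
        uncertainty G φ (Zstar G φ lam (D 1) πs νs) π νs x := by
  have hreg := hr.regime
  have hφ := hreg.linear.measurable_feature
  have hι := hreg.one_le_conf
  obtain ⟨C, hC⟩ := exists_abs_plusValue_le (β := β) (κ := κ) (γ := γ) (b₁ := b₁) hreg.linear
    hreg.lam_pos s D
  have herr : ∀ (h : Fin H) x a b,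
      |spmviPlusQ G.reward φ lam κ γ b₁ (D 1) (D 2) (D 3) s h (refValue G φ lam β s D h.succ)
        (plusValue G φ lam β κ γ b₁ s D h.succ) x a b -
      (G.reward h (x, a, b) + ∫ x', plusValue G φ lam β κ γ b₁ s D h.succ x'
        ∂(G.trans h (x, a, b)))| ≤
      10 * ι * √(d : ℝ) * wnorm (Zstar G φ lam (D 1) πs νs h)⁻¹ (φ (x, a, b)) := by
    intro h x a b
    have h1 := hr.plusQ_error (fun x => hr.abs_plusValue_sub_le hsw h.succ x) x a b
    have h2 := abs_le.1 h1
    have h3 := hr.bonus_le_oracle h (x, a, b)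
    have h4 := abs_le.1 hr.abs_sign.le
    have h0 := (abs_nonneg _).trans h1
    rw [abs_le]
    constructor <;> nlinarith
  have he : ∀ h, Measurable fun z =>
      10 * ι * √(d : ℝ) * wnorm (Zstar G φ lam (D 1) πs νs h)⁻¹ (φ z) := fun h =>
    (measurable_wnorm (M := fun _ => (Zstar G φ lam (D 1) πs νs h)⁻¹)
      (fun _ _ => measurable_const) hφ).const_mul _
  have hM : ∀ h z, |10 * ι * √(d : ℝ) * wnorm (Zstar G φ lam (D 1) πs νs h)⁻¹ (φ z)| ≤
      10 * ι * √(d : ℝ) * √(1 / lam) := fun h z => by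
    rw [abs_mul, abs_of_nonneg (by positivity : 0 ≤ 10 * ι * √(d : ℝ))]
    exact mul_le_mul_of_nonneg_left (hr.abs_oracle_le h z) (by positivity)
  have h1 := hsw.expect_le (G := G) (fun k => measurable_plusValue_section hφ s D k) hC he hM 0
    (fun h _ x a b => by linarith [(abs_le.1 (herr h x a b)).1]) πs x
  have h2 := hsw.le_expect (G := G) (fun k => measurable_plusValue_section hφ s D k) hC he hM 0
    (fun h _ x a b => by linarith [(abs_le.1 (herr h x a b)).2]) νs x
  rw [expect_const_mul] at h1 h2
  have h3 := hr.nash.le_value 0 x ν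
  have h4 := hr.nash.value_le 0 x π
  unfold uncertainty
  constructor <;> linarith

end GoodRun

/-- The duality gap of the output of SPMVI+ on data outside the bad events. -/
theorem duality_gap_le {γ b₁ ε : ℝ} {πhat π' : Policy H S A} {νhat ν' : Policy H S B}
    (hlo : GoodRun G φ σ ρ κ lam ι β γ b₁ ε (-1) D πs νs)
    (hup : GoodRun G φ σ ρ κ lam ι β γ b₁ ε 1 D πs νs)
    (hslo : IsHalfSweep (fun h V => spmviPlusQ G.reward φ lam κ γ b₁ (D 1) (D 2) (D 3) (-1) h
      (refValue G φ lam β (-1) D h.succ) V) πhat ν' (plusValue G φ lam β κ γ b₁ (-1) D))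
    (hsup : IsHalfSweep (fun h V => spmviPlusQ G.reward φ lam κ γ b₁ (D 1) (D 2) (D 3) 1 h
      (refValue G φ lam β 1 D h.succ) V) π' νhat (plusValue G φ lam β κ γ b₁ 1 D)) (x : S) :
    G.valueBestMax νhat 0 x - G.valueBestMin πhat 0 x ≤
      10 * ι * √(d : ℝ) *
        ((⨆ ν : Policy H S B, uncertainty G φ (Zstar G φ lam (D 1) πs νs) πs ν x) +
          ⨆ π : Policy H S A, uncertainty G φ (Zstar G φ lam (D 1) πs νs) π νs x) := by
  have : Nonempty (Policy H S A) := ⟨πs⟩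
  have : Nonempty (Policy H S B) := ⟨νs⟩
  have hι := hlo.regime.one_le_conf
  have h1 : plusValue G φ lam β κ γ b₁ (-1) D 0 x ≤ G.valueBestMin πhat 0 x :=
    le_ciInf fun ν₂ => hlo.le_value_of_lower hslo ν₂ x
  have h2 : G.valueBestMax νhat 0 x ≤ plusValue G φ lam β κ γ b₁ 1 D 0 x :=
    ciSup_le fun π₂ => hup.value_le_of_upper hsup π₂ x
  have h3 := (hlo.sub_uncertainty_le hslo x).1
  have h4 := (hup.sub_uncertainty_le hsup x).2
  have h5 : uncertainty G φ (Zstar G φ lam (D 1) πs νs) πs ν' x ≤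
      ⨆ ν : Policy H S B, uncertainty G φ (Zstar G φ lam (D 1) πs νs) πs ν x :=
    le_ciSup (f := fun ν => uncertainty G φ (Zstar G φ lam (D 1) πs νs) πs ν x)
      ⟨_, by rintro _ ⟨ν, rfl⟩; exact hlo.uncertainty_le πs ν x⟩ ν'
  have h6 : uncertainty G φ (Zstar G φ lam (D 1) πs νs) π' νs x ≤
      ⨆ π : Policy H S A, uncertainty G φ (Zstar G φ lam (D 1) πs νs) π νs x :=
    le_ciSup (f := fun π => uncertainty G φ (Zstar G φ lam (D 1) πs νs) π νs x)
      ⟨_, by rintro _ ⟨π, rfl⟩; exact hlo.uncertainty_le π νs x⟩ π'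
  have h7 : 0 ≤ 10 * ι * √(d : ℝ) := by positivity
  have h8 := mul_le_mul_of_nonneg_left (add_le_add h5 h6) h7
  rw [mul_add] at h8
  linarith

end Gap

/-! ### The sample size condition and the removal of $\log K$ -/

section SampleSize

/-- Replaces the logarithm `t` without $K$ by `t + log K`. If `log K` is at most a multiple of `t`
the constant $10^{52}$ pays for it; otherwise $X\le\sqrt K$ and the polynomial in `log K` is paid by
the other $\sqrt K$. -/
theorem pow_log_mul_le {K X t : ℝ} (hX : 1 ≤ X) (ht : 1 ≤ t) (hXt : X ≤ Real.exp (13 * t))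
    (hK : 10 ^ 52 * t ^ 4 * X < K) : 10 ^ 6 * (t + Real.log K) ^ 4 * X ≤ K := by
  have h0 : (10 : ℝ) ^ 52 ≤ K := by
    have h1 : (1 : ℝ) ≤ t ^ 4 * X := one_le_mul_of_one_le_of_one_le (one_le_pow₀ ht) hX
    nlinarith
  have hK0 : 0 < K := lt_of_lt_of_le (by positivity) h0
  set u := Real.log K with hu
  have hu0 : 0 ≤ u := Real.log_nonneg (by linarith)
  rcases le_or_gt u (26 * t) with h | h
  · have h1 : (t + u) ^ 4 ≤ (27 * t) ^ 4 := pow_le_pow_left₀ (by linarith) (by linarith) 4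
    have h2 : 10 ^ 6 * (t + u) ^ 4 * X ≤ 10 ^ 6 * (27 * t) ^ 4 * X := by gcongr
    have h3 : 0 ≤ t ^ 4 * X := by positivity
    nlinarith
  · have h1 : (t + u) ^ 4 ≤ (2 * u) ^ 4 := pow_le_pow_left₀ (by linarith) (by linarith) 4
    have h2 : X ≤ Real.exp (u / 2) := hXt.trans (Real.exp_le_exp.2 (by linarith))
    have h3 : u / 16 ≤ Real.exp (u / 16) := by linarith [Real.add_one_le_exp (u / 16)]
    have h4 : (u / 16) ^ 4 ≤ Real.exp (u / 4) := by
      refine (pow_le_pow_left₀ (by positivity) h3 4).trans_eq ?_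
      rw [← Real.exp_nat_mul]
      congr 1
      push_cast
      ring
    -- From $K\ge10^{52}$; the numerical factor $10^6\cdot2^4\cdot16^4$ below is less than
    -- $10^{13}$.
    have h5 : (10 : ℝ) ^ 13 ≤ Real.exp (u / 4) := by
      have h6 : Real.log (10 ^ 13) ≤ u / 4 := by
        have := Real.log_le_log (by positivity) h0
        rw [show (10 : ℝ) ^ 52 = (10 ^ 13) ^ 4 by norm_num, Real.log_pow] at this
        exact (le_div_iff₀' (by norm_num)).2 (by exact_mod_cast this)
      calc (10 : ℝ) ^ 13 = Real.exp (Real.log (10 ^ 13)) := (Real.exp_log (by positivity)).symm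
        _ ≤ _ := Real.exp_le_exp.2 h6
    have h6 : K = Real.exp (u / 4) * Real.exp (u / 4) * Real.exp (u / 2) := by
      rw [← Real.exp_add, ← Real.exp_add, show u / 4 + u / 4 + u / 2 = u by ring, hu,
        Real.exp_log hK0]
    have h7 : 10 ^ 6 * (t + u) ^ 4 ≤ Real.exp (u / 4) * Real.exp (u / 4) :=
      calc 10 ^ 6 * (t + u) ^ 4 ≤ 10 ^ 6 * (2 * u) ^ 4 := by gcongr
        _ = 10 ^ 6 * 2 ^ 4 * 16 ^ 4 * (u / 16) ^ 4 := by ring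
        _ ≤ 10 ^ 13 * (u / 16) ^ 4 := by
          refine mul_le_mul_of_nonneg_right (by norm_num) (by positivity)
        _ ≤ _ := mul_le_mul h5 h4 (by positivity) (Real.exp_pos _).le
    calc _ ≤ Real.exp (u / 4) * Real.exp (u / 4) * Real.exp (u / 2) :=
          mul_le_mul h7 h2 (by linarith) (by positivity)
      _ = K := h6.symm

variable {H K d : ℕ} {κ δ : ℝ}

theorem one_le_base (hH : 1 ≤ H) (hd : 1 ≤ d) (hκ : 0 < κ) (hκ1 : κ ≤ 1) (hδ : 0 < δ)
    (hδ1 : δ < 1) : (4 : ℝ) ≤ 4 * H * d / (δ * κ ^ 2) := by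
  have h1 : (1 : ℝ) ≤ H := by exact_mod_cast hH
  have h2 : (1 : ℝ) ≤ d := by exact_mod_cast hd
  have h3 : δ * κ ^ 2 ≤ 1 := mul_le_one₀ hδ1.le (by positivity) (pow_le_one₀ hκ.le hκ1)
  rw [le_div_iff₀ (by positivity)]
  have h4 : (1 : ℝ) ≤ H * d := one_le_mul_of_one_le_of_one_le h1 h2
  nlinarith

/-- The assumption on the sample size, with the logarithm of the sample size absorbed. -/
theorem sample_size_ge (hH : 1 ≤ H) (hd : 1 ≤ d) (hκ : 0 < κ) (hκ1 : κ ≤ 1) (hδ : 0 < δ)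
    (hδ1 : δ < 1)
    (hK : 10 ^ 52 * Real.log (4 * H * d / (δ * κ ^ 2)) ^ 4 * (d * H ^ 13 / κ ^ 4) < K) :
    1 ≤ Real.log (4 * H * d * K / (δ * κ ^ 2)) ∧
      10 ^ 6 * Real.log (4 * H * d * K / (δ * κ ^ 2)) ^ 4 * (d * H ^ 13 / κ ^ 4) ≤ K := by
  have h1 : (1 : ℝ) ≤ H := by exact_mod_cast hH
  have h2 : (1 : ℝ) ≤ d := by exact_mod_cast hd
  have hY := one_le_base hH hd hκ hκ1 hδ hδ1
  have hY0 : 0 < 4 * H * d / (δ * κ ^ 2) := by linarith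
  have ht : 1 ≤ Real.log (4 * H * d / (δ * κ ^ 2)) := by
    have h3 := Real.log_le_log (by norm_num) hY
    rw [show (4 : ℝ) = 2 ^ 2 by norm_num, Real.log_pow] at h3
    have h4 := Real.log_two_gt_d9
    rw [show (2 : ℝ) ^ 2 = 4 by norm_num] at h3
    push_cast at h3
    linarith
  have hX : 1 ≤ d * H ^ 13 / κ ^ 4 := by
    rw [le_div_iff₀ (by positivity), one_mul]
    exact (pow_le_one₀ hκ.le hκ1).trans (one_le_mul_of_one_le_of_one_le h2 (one_le_pow₀ h1))
  -- The thirteenth power of $4Hd/(\delta\kappa^2)$ dominates each factor separately.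
  have hXt : d * H ^ 13 / κ ^ 4 ≤ Real.exp (13 * Real.log (4 * H * d / (δ * κ ^ 2))) := by
    have h3 : Real.exp (13 * Real.log (4 * H * d / (δ * κ ^ 2))) =
        (4 * H * d / (δ * κ ^ 2)) ^ 13 := by
      have := Real.exp_nat_mul (Real.log (4 * H * d / (δ * κ ^ 2))) 13
      rw [Real.exp_log hY0] at this
      exact_mod_cast this
    rw [h3, div_pow]
    refine div_le_div₀ (by positivity) ?_ (by positivity) ?_
    · rw [mul_pow, mul_pow]
      have h4 : (d : ℝ) ≤ d ^ 13 := le_self_pow₀ h2 (by norm_num)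
      have h5 : (H : ℝ) ^ 13 ≤ 4 ^ 13 * H ^ 13 := le_mul_of_one_le_left (by positivity) (by norm_num)
      rw [mul_comm]
      gcongr
    · rw [mul_pow, ← pow_mul]
      calc δ ^ 13 * κ ^ (2 * 13) ≤ 1 * κ ^ 4 := by
            refine mul_le_mul (pow_le_one₀ hδ.le hδ1.le) ?_ (by positivity) zero_le_one
            exact pow_le_pow_of_le_one hκ.le hκ1 (by norm_num)
        _ = κ ^ 4 := one_mul _
  have hK0 : (1 : ℝ) ≤ K := by
    have h3 : (1 : ℝ) ≤ Real.log (4 * H * d / (δ * κ ^ 2)) ^ 4 * (d * H ^ 13 / κ ^ 4) :=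
      one_le_mul_of_one_le_of_one_le (one_le_pow₀ ht) hX
    nlinarith
  have hlog : Real.log (4 * H * d * K / (δ * κ ^ 2)) =
      Real.log (4 * H * d / (δ * κ ^ 2)) + Real.log K := by
    rw [← Real.log_mul hY0.ne' (by linarith)]
    congr 1
    ring
  rw [hlog]
  exact ⟨by linarith [Real.log_nonneg hK0], pow_log_mul_le hX ht hXt hK⟩

variable {S A B : Type*} [MeasurableSpace S] [MeasurableSpace A] [MeasurableSpace B]
  [Fintype A] [Fintype B] [MeasurableSingletonClass A] [MeasurableSingletonClass B]
  {G : Game H S A B} {φ : S × A × B → Fin d → ℝ} {lam ι : ℝ}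

/-- Every numerical requirement of the regime reduces to a monomial bound $\iota^ad^bH^c\lesssim
K\kappa^2$ with $a\le4$, $b\le2$, $c\le13$. -/
theorem Regime.of_sample_size (hG : G.IsLinear φ) (hH : 1 ≤ H) (hd : 1 ≤ d) (hκ : 0 < κ)
    (hdκ : d * κ ≤ 1) (hlam : 0 < lam) (hlamκ : lam ≤ κ) (hι : 1 ≤ ι)
    (hK : 10 ^ 6 * ι ^ 4 * (d * H ^ 13 / κ ^ 4) ≤ K) : Regime G φ κ lam ι K := by
  have h1 : (1 : ℝ) ≤ H := by exact_mod_cast hH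
  have h2 : (1 : ℝ) ≤ d := by exact_mod_cast hd
  have hκ1 : κ ≤ 1 := by nlinarith
  have hK0 : (0 : ℝ) < K := lt_of_lt_of_le (by positivity) hK
  -- The second factor $d$ is paid for by $d\kappa^2\le1$, which uses up two of the four powers of
  -- $\kappa$.
  have key : 10 ^ 6 * (ι ^ 4 * d ^ 2 * H ^ 13) ≤ K * κ ^ 2 := by
    have h3 : 10 ^ 6 * (ι ^ 4 * (d * H ^ 13)) ≤ K * κ ^ 4 := by
      have := mul_le_mul_of_nonneg_right hK (by positivity : 0 ≤ κ ^ 4)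
      refine le_trans (le_of_eq ?_) this
      field_simp
    have h4 : d * κ ^ 2 ≤ 1 := by nlinarith
    have h5 : 10 ^ 6 * (ι ^ 4 * d ^ 2 * H ^ 13) * κ ^ 2 ≤ K * κ ^ 2 * κ ^ 2 :=
      calc 10 ^ 6 * (ι ^ 4 * d ^ 2 * H ^ 13) * κ ^ 2 =
            10 ^ 6 * (ι ^ 4 * (d * H ^ 13)) * (d * κ ^ 2) := by ring
        _ ≤ 10 ^ 6 * (ι ^ 4 * (d * H ^ 13)) := mul_le_of_le_one_right (by positivity) h4
        _ ≤ K * κ ^ 4 := h3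
        _ = _ := by ring
    exact le_of_mul_le_mul_right h5 (by positivity)
  have hsub : ∀ {a b c : ℕ}, a ≤ 4 → b ≤ 2 → c ≤ 13 →
      10 ^ 6 * (ι ^ a * d ^ b * H ^ c) ≤ K * κ ^ 2 := fun ha hb hc => by
    refine le_trans ?_ key
    have := pow_le_pow_right₀ hι ha
    have := pow_le_pow_right₀ h2 hb
    have := pow_le_pow_right₀ h1 hc
    gcongr
  have hKκ : K * κ ^ 2 ≤ K * κ := by
    refine mul_le_mul_of_nonneg_left ?_ hK0.le
    nlinarith
  have hKκ1 : K * κ ≤ K := mul_le_of_le_one_right hK0.le hκ1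
  have hKH : 10 ^ 6 * (H : ℝ) ≤ K := by
    have := hsub (a := 0) (b := 0) (c := 1) (by norm_num) (by norm_num) (by norm_num)
    simp only [pow_zero, pow_one, one_mul] at this
    linarith
  have hKH' : 10 ^ 6 * H ≤ K := by exact_mod_cast hKH
  have hfold : 4 ≤ K / H := by
    rw [Nat.le_div_iff_mul_le (by omega)]
    omega
  have hn : (4 : ℝ) ≤ (K / H : ℕ) := by exact_mod_cast hfold
  have hsf : (K : ℝ) ≤ 2 * H * (K / H : ℕ) := by
    have h3 : K < H * (K / H + 1) := Nat.lt_mul_div_succ K (by omega)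
    have h4 : (K : ℝ) < H * ((K / H : ℕ) + 1) := by exact_mod_cast h3
    nlinarith
  have hdev : ∀ {n c : ℝ}, 0 ≤ n → 0 ≤ c → 4 * c ^ 2 * (d ^ 2 * ι ^ 2) ≤ n * κ ^ 2 →
      2 * c * (d * (√n * ι)) ≤ n * κ := by
    intro n c hn hc h
    have h3 : 2 * c * (d * ι) ≤ √n * κ := by
      refine abs_le_of_sq_le_sq' ?_ (by positivity) |>.2
      rw [mul_pow (√n), Real.sq_sqrt hn]
      refine le_trans (le_of_eq (by ring)) h
    calc 2 * c * (d * (√n * ι)) = √n * (2 * c * (d * ι)) := by ring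
      _ ≤ √n * (√n * κ) := mul_le_mul_of_nonneg_left h3 (Real.sqrt_nonneg n)
      _ = n * κ := by rw [← mul_assoc, Real.mul_self_sqrt hn]
  refine ⟨hG, hκ, hlam, hlamκ, hκ1, hι, hH, hd, hfold, by omega, hsf, ?_, ?_, ?_, ?_, ?_, ?_, ?_⟩
  · have h3 := hsub (a := 2) (b := 2) (c := 1) (by norm_num) (by norm_num) (by norm_num)
    have h4 : (K : ℝ) * κ ^ 2 ≤ 2 * H * (K / H : ℕ) * κ ^ 2 := by gcongr
    have h5 : (H : ℝ) * (10 ^ 6 * (ι ^ 2 * d ^ 2)) ≤ H * (2 * ((K / H : ℕ) * κ ^ 2)) := by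
      refine le_trans (le_of_eq (by ring)) (h3.trans (h4.trans_eq (by ring)))
    have h6 := le_of_mul_le_mul_left h5 (by linarith)
    have h7 : 0 ≤ ι ^ 2 * (d : ℝ) ^ 2 := by positivity
    have := hdev (n := (K / H : ℕ)) (c := 1) (by positivity) zero_le_one (by nlinarith)
    simpa using this
  · have h3 := hsub (a := 2) (b := 2) (c := 4) (by norm_num) (by norm_num) (by norm_num)
    refine hdev hK0.le (by positivity) ?_
    have h7 : 0 ≤ ι ^ 2 * (d : ℝ) ^ 2 * H ^ 4 := by positivity
    refine le_trans ?_ h3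
    nlinarith
  · have h3 := hsub (a := 0) (b := 0) (c := 1) (by norm_num) (by norm_num) (by norm_num)
    simp only [pow_zero, pow_one, one_mul] at h3
    have h4 : (K : ℝ) * κ ≤ 2 * H * (K / H : ℕ) * κ := by gcongr
    have h5 : (H : ℝ) * 10 ^ 6 ≤ H * (2 * ((K / H : ℕ) * κ)) := by
      refine le_trans (le_of_eq (by ring)) (h3.trans (hKκ.trans (h4.trans_eq (by ring))))
    have h6 := le_of_mul_le_mul_left h5 (by linarith)
    linarith
  · have h3 := hsub (a := 0) (b := 0) (c := 4) (by norm_num) (by norm_num) (by norm_num)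
    simp only [pow_zero, one_mul] at h3
    have : 0 ≤ (H : ℝ) ^ 4 := by positivity
    rw [show (H : ℝ) ^ 2 * H ^ 2 = H ^ 4 by ring]
    linarith
  · have h3 := hsub (a := 0) (b := 0) (c := 4) (by norm_num) (by norm_num) (by norm_num)
    simp only [pow_zero, one_mul] at h3
    have : 0 ≤ (H : ℝ) ^ 4 := by positivity
    linarith
  · have h3 := hsub (a := 2) (b := 1) (c := 7) (by norm_num) (by norm_num) (by norm_num)
    have h4 : √(d * H / (K * κ)) ≤ 1 / (600 * ι * H ^ 3) := by
      rw [Real.sqrt_le_left (by positivity), div_pow, div_le_div_iff₀ (by positivity)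
        (by positivity)]
      have h5 : 0 ≤ ι ^ 2 * (d : ℝ) ^ 1 * H ^ 7 := by positivity
      nlinarith
    calc 600 * ι * H ^ 3 * √(d * H / (K * κ)) ≤ 600 * ι * H ^ 3 * (1 / (600 * ι * H ^ 3)) :=
          mul_le_mul_of_nonneg_left h4 (by positivity)
      _ = 1 := by field_simp
  · have h3 := hsub (a := 4) (b := 2) (c := 6) (by norm_num) (by norm_num) (by norm_num)
    refine Real.le_sqrt_of_sq_le ?_
    have h4 : (600 * ι ^ 2 * (d * H ^ 3 / (K * κ))) ^ 2 =
        360000 * (ι ^ 4 * d ^ 2 * H ^ 6) / (K * (K * κ ^ 2)) := by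
      rw [mul_div_assoc', div_pow]
      congr 1 <;> ring
    rw [h4, div_le_div_iff₀ (by positivity) (by positivity)]
    have h5 : 0 ≤ ι ^ 4 * (d : ℝ) ^ 2 * H ^ 6 := by positivity
    have h6 : 360000 * (ι ^ 4 * d ^ 2 * H ^ 6) * 2 ≤ K * κ ^ 2 := by linarith
    have := mul_le_mul_of_nonneg_right h6 hK0.le
    linarith

end SampleSize

/-! ### The union bound over all bad events -/

section BadEvent

variable {H K d : ℕ} {S A B : Type*} [MeasurableSpace S] [MeasurableSpace A] [MeasurableSpace B]
  [Fintype A] [Fintype B] [MeasurableSingletonClass A] [MeasurableSingletonClass B]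
  {G : Game H S A B} {φ : S × A × B → Fin d → ℝ} {σ : Policy H S (A × B)} {ρ : Measure S}
  [IsProbabilityMeasure ρ] {lam ι κ β γ b₁ ε : ℝ}

theorem Policy.nonempty_action {C : Type*} [Fintype C] (π : Policy H S C) (h : Fin H) (x : S) :
    Nonempty C := by
  by_contra hC
  rw [not_nonempty_iff] at hC
  simpa using (π.mem_simplex h x).2

variable [Nonempty A] [Nonempty B]

/-- The union of all the bad events. -/
def badEvent (G : Game H S A B) (φ : S × A × B → Fin d → ℝ) (σ : Policy H S (A × B))
    (ρ : Measure S) (lam β κ γ b₁ ε ι : ℝ) : Set (Data K H S A B) :=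
  {D | ∃ h, stepGramBad G φ σ ρ ι h D ∨ stepNoiseBad G φ lam β κ γ b₁ ε ι (-1) h D ∨
    stepNoiseBad G φ lam β κ γ b₁ ε ι 1 h D}

/-- Per step there are four Gram events of cost $2$ and, for each of the two signs, five noise
events of cost $4$, in units of $d^2e^{1-\iota}$: $8+40=48$. -/
theorem badEvent_le (hr : Regime G φ κ lam ι K) (hκ : κ = G.coverage ρ σ φ) (hε : 0 < ε) :
    (dataLaw K G σ ρ).real (badEvent G φ σ ρ lam β κ γ b₁ ε ι) ≤
      H * (48 * d ^ 2 * Real.exp (1 - ι)) := by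
  have hR3 : 1 ≤ K * κ := le_trans (by
    have := one_le_pow₀ (n := 2) hr.one_le_horizon_cast
    nlinarith) hr.range_full
  have hnoise : ∀ s h, (dataLaw K G σ ρ).real
      {D | stepNoiseBad G φ lam β κ γ b₁ ε ι s h D} ≤ 5 * (4 * d ^ 2 * Real.exp (1 - ι)) :=
    fun s h => stepNoiseBad_le hr.linear hr.lam_pos hr.one_le_horizon hε hr.fold_size hr.size
      (hκ ▸ hr.dev_fold) (hκ ▸ hr.dev_full) (hκ ▸ hr.dev_full_one) (hκ ▸ hr.range_fold)
      (hκ ▸ hr.range_full) (hκ ▸ hR3) s h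
  have hgram : ∀ h, (dataLaw K G σ ρ).real {D | stepGramBad G φ σ ρ ι h D} ≤
      4 * (2 * d ^ 2 * Real.exp (1 - ι)) :=
    fun h => stepGramBad_le hr.linear hr.fold_size hr.size h
  have hu := fun T U : Set (Data K H S A B) => measureReal_union_le (μ := dataLaw K G σ ρ) T U
  have heq : badEvent G φ σ ρ lam β κ γ b₁ ε ι = ⋃ h : Fin H,
      ({D | stepGramBad G φ σ ρ ι h D} ∪ ({D | stepNoiseBad G φ lam β κ γ b₁ ε ι (-1) h D} ∪
        {D | stepNoiseBad G φ lam β κ γ b₁ ε ι 1 h D}) : Set (Data K H S A B)) := by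
    ext D
    simp [badEvent]
  rw [heq]
  refine (measureReal_iUnion_fintype_le _).trans ?_
  refine (Finset.sum_le_sum (g := fun _ => 48 * d ^ 2 * Real.exp (1 - ι)) fun h _ => ?_).trans_eq
    (by simp)
  refine ((hu _ _).trans (add_le_add (hgram h) ((hu _ _).trans
    (add_le_add (hnoise (-1) h) (hnoise 1 h))))).trans_eq ?_
  ring

/-- The choice of $\iota$ turns the left side into $\delta\cdot12e\,d\kappa^2/K$, and
$d\kappa^2\le1$. -/
theorem failure_bound {δ : ℝ} (hH : 1 ≤ H) (hd : 1 ≤ d) (hκ : 0 < κ) (hdκ : d * κ ≤ 1)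
    (hδ : 0 < δ) (hK : 512 ≤ K) :
    H * (48 * d ^ 2 * Real.exp (1 - Real.log (4 * H * d * K / (δ * κ ^ 2)))) ≤ δ := by
  have h1 : (1 : ℝ) ≤ H := by exact_mod_cast hH
  have h2 : (1 : ℝ) ≤ d := by exact_mod_cast hd
  have h3 : (512 : ℝ) ≤ K := by exact_mod_cast hK
  have h4 : d * κ ^ 2 ≤ 1 := by nlinarith
  rw [Real.exp_sub, Real.exp_log (by positivity)]
  have h5 : H * (48 * d ^ 2 * (Real.exp 1 / (4 * H * d * K / (δ * κ ^ 2)))) =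
      δ * (12 * Real.exp 1 * (d * κ ^ 2) / K) := by
    field_simp
    ring
  rw [h5]
  refine mul_le_of_le_one_right hδ.le ?_
  rw [div_le_one (by linarith)]
  have h6 := Real.exp_one_lt_d9
  have h7 : 12 * Real.exp 1 * (d * κ ^ 2) ≤ 12 * Real.exp 1 :=
    mul_le_of_le_one_right (by positivity) h4
  linarith

theorem GoodRun.of_notMem {κ s : ℝ} {D : Data K H S A B} {πs : Policy H S A} {νs : Policy H S B}
    (hr : Regime G φ κ lam ι K) (hκ : κ = G.coverage ρ σ φ) (hs : s = -1 ∨ s = 1)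
    (hD : D ∉ badEvent G φ σ ρ lam β κ γ b₁ ε ι) (hβ : β = ι * (√(d : ℝ) * H))
    (hγ : γ = 3 * ι * √(d : ℝ)) (hb : b₁ = 288 * ι ^ 2 * (d * H ^ 3 / (K * κ)))
    (hε : ε = 24 * ι * H ^ 2 * √(d * H / (K * κ))) (hN : G.IsNash πs νs)
    {π : Policy H S A} {ν : Policy H S B}
    (hsw : IsHalfSweep (spmviQ G.reward φ lam β (D 0) s) π ν (refValue G φ lam β s D)) :
    GoodRun G φ σ ρ κ lam ι β γ b₁ ε s D πs νs := by
  have hD' : ∀ h, ¬ stepGramBad G φ σ ρ ι h D ∧ ¬ stepNoiseBad G φ lam β κ γ b₁ ε ι (-1) h D ∧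
      ¬ stepNoiseBad G φ lam β κ γ b₁ ε ι 1 h D := by
    simpa [badEvent, not_or] using hD
  refine ⟨hr, hκ, ?_, fun h => (hD' h).1, fun h => ?_, hβ, hγ, hb, hε, hN, π, ν, hsw⟩
  · rcases hs with rfl | rfl <;> simp
  · rcases hs with rfl | rfl
    · exact (hD' h).2.1
    · exact (hD' h).2.2

end BadEvent

end ZeroSumMG

end

/-! ### The main theorem -/

theorem theorem4 :
    ∃ (cβ c₀ c₁ cK C₁ C₂ : ℝ) (pβ p₀ p₁ pK q₁ q₂ : ℕ),
      0 < cβ ∧ 0 < c₀ ∧ 0 < c₁ ∧ 0 < cK ∧ 0 < C₁ ∧ 0 < C₂ ∧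
      ∀ (S : Type*) (A : Type*) (B : Type*) [MeasurableSpace S]
        [MeasurableSpace A] [MeasurableSingletonClass A] [Fintype A]
        [MeasurableSpace B] [MeasurableSingletonClass B] [Fintype B]
        (H K d : ℕ) (G : Game H S A B) (φ : S × A × B → Fin d → ℝ) (_ : G.IsLinear φ)
        (ρ : Measure S) (_ : IsProbabilityMeasure ρ) (σ : Policy H S (A × B))
        (κ : ℝ) (_ : κ = G.coverage ρ σ φ) (_ : 0 < κ)
        (lam δ : ℝ) (_ : 0 < lam) (_ : lam < κ) (_ : 0 < δ) (_ : δ < 1)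
        (_ : max (512 * H * Real.log (4 * H * d / (δ * κ ^ 2)))
            (cK * Real.log (4 * H * d / (δ * κ ^ 2)) ^ pK * (d * H ^ 13 / κ ^ 4)) < K)
        (πs : Policy H S A) (νs : Policy H S B) (_ : G.IsNash πs νs)
        (ι : ℝ) (_ : ι = Real.log (4 * H * d * K / (δ * κ ^ 2))),
        (Measure.pi fun _ : Fin 4 => Measure.pi fun _ : Fin K => G.episodeLaw ρ σ)
          {D | ¬ ∀ (πhat : Policy H S A) (νhat : Policy H S B),
            IsSpmviPlusOutput G.reward φ lam κ
                (cβ * ι ^ pβ * (√(d : ℝ) * H))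
                (c₀ * ι ^ p₀ * √(d : ℝ))
                (c₁ * ι ^ p₁ * (d * H ^ 3 / (K * κ)))
                (D 0) (D 1) (D 2) (D 3) πhat νhat →
            ∀ x : S,
              G.valueBestMax νhat 0 x - G.valueBestMin πhat 0 x ≤
                C₁ * ι ^ q₁ * √(d : ℝ) *
                  ((⨆ ν : Policy H S B,
                      uncertainty G φ (Zstar G φ lam (D 1) πs νs) πs ν x) +
                    ⨆ π : Policy H S A,
                      uncertainty G φ (Zstar G φ lam (D 1) πs νs) π νs x) +
                C₂ * ι ^ q₂ * (d * H ^ 3 / (K * κ))}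
          ≤ ENNReal.ofReal δ := by
  -- The parameters are $\beta=\iota\sqrt dH$, $\gamma=3\iota\sqrt d$ and
  -- $b_1=288\iota^2dH^3/(K\kappa)$. The last additive term of the bound is already absorbed by the
  -- uncertainty, so its constants are arbitrary.
  refine ⟨1, 3, 288, 10 ^ 52, 10, 1, 1, 1, 2, 4, 1, 0, by norm_num, by norm_num, by norm_num,
    by norm_num, by norm_num, by norm_num, ?_⟩
  intro S A B _ _ _ _ _ _ _ H K d G φ hG ρ _ σ κ hκ hκ0 lam δ hlam hlamκ hδ hδ1 hK πs νs hN ι hι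
  have hcov : 0 < G.coverage ρ σ φ := hκ ▸ hκ0
  have hH : 1 ≤ H := horizon_pos hcov
  have hd : 1 ≤ d := dim_pos hcov
  have hdκ : d * κ ≤ 1 := hκ ▸ hG.dim_mul_coverage_le hcov
  have hκ1 : κ ≤ 1 := by
    have : (1 : ℝ) ≤ d := by exact_mod_cast hd
    nlinarith
  obtain ⟨x₀⟩ : Nonempty S := ρ.nonempty_of_neZero
  have : Nonempty A := πs.nonempty_action ⟨0, hH⟩ x₀
  have : Nonempty B := νs.nonempty_action ⟨0, hH⟩ x₀
  obtain ⟨hι1, hKι⟩ := sample_size_ge hH hd hκ0 hκ1 hδ hδ1 ((le_max_right _ _).trans_lt hK)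
  have hK512 : 512 ≤ K := by
    have h1 : (1 : ℝ) ≤ d * H ^ 13 / κ ^ 4 := by
      rw [le_div_iff₀ (by positivity), one_mul]
      exact (pow_le_one₀ hκ0.le hκ1).trans (one_le_mul_of_one_le_of_one_le
        (by exact_mod_cast hd) (one_le_pow₀ (by exact_mod_cast hH)))
    have h2 := one_le_mul_of_one_le_of_one_le (one_le_pow₀ hι1 (n := 4)) h1
    have h3 : (512 : ℝ) ≤ K := by nlinarith
    exact_mod_cast h3
  rw [← hι] at hι1 hKι
  have hr : Regime G φ κ lam ι K :=
    Regime.of_sample_size hG hH hd hκ0 hdκ hlam hlamκ.le hι1 hKι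
  have hrate := hr.rate_pos
  have hprob := (badEvent_le (σ := σ) (ρ := ρ) (β := 1 * ι ^ 1 * (√(d : ℝ) * H))
    (γ := 3 * ι ^ 1 * √(d : ℝ)) (b₁ := 288 * ι ^ 2 * (d * H ^ 3 / (K * κ)))
    (ε := 24 * ι * H ^ 2 * √(d * H / (K * κ))) hr hκ (by positivity)).trans
    (hι ▸ failure_bound hH hd hκ0 hdκ hδ hK512)
  -- The failure set quantifies over all output policies and states and need not be measurable;
  -- inclusion in the bad event bounds its outer measure.
  refine (measure_mono fun D hD => ?_).trans
    ((ENNReal.le_ofReal_iff_toReal_le (measure_ne_top _ _) hδ.le).2 hprob)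
  by_contra hbad
  refine hD ?_
  rintro πhat νhat ⟨Vloref, Vupref, ⟨π₁, ν₁, π₂, ν₂, href⟩, ν', π', Vlo, Vup, hplus⟩ x
  obtain ⟨rfl, rfl⟩ := href.eq_sweepValue
  obtain ⟨rfl, rfl⟩ := hplus.eq_sweepValue
  have hlo := GoodRun.of_notMem hr hκ (.inl rfl) hbad (by ring) (by ring) rfl rfl hN href.lo
  have hup := GoodRun.of_notMem hr hκ (.inr rfl) hbad (by ring) (by ring) rfl rfl hN href.up
  have hgap := duality_gap_le hlo hup hplus.lo hplus.up x
  refine hgap.trans ?_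
  rw [pow_one]
  exact le_add_of_nonneg_right (by positivity)
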